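/- Let $k$ be a field of characteristic $0$. A conformal algebra over $k$ is a vector space $C$ with a linear operator $\partial$ and bilinear $n$-products $a_{(n)}b$, $n=0,1,2,\dots$, such that $a_{(n)}b=0$ for all large $n$ (depending on $a,b$), $(\partial a)_{(n)}b=-n\,a_{(n-1)}b$ and $a_{(n)}\partial b=\partial(a_{(n)}b)+n\,a_{(n-1)}b$. Write $L_n^a b=a_{(n)}b$, $\{b_{(n)}a\}=\sum_{s\ge0}\frac{(-1)^{n+s}}{s!}\partial^s(b_{(n+s)}a)$ and $[a_{(n)}b]=a_{(n)}b-\{b_{(n)}a\}$. The algebra $C$ is associative if $(a_{(n)}b)_{(m)}c=\sum_{s=0}^{n}(-1)^s\binom ns a_{(n-s)}(b_{(m+s)}c)$ always holds, and it is commutative if it is associative and all commutators $[a_{(n)}b]$ vanish. For a set $Y$, let $\mathrm{ComConf}(Y,2)$ be the free commutative conformal algebra generated by $Y$ with locality function $2$, i.e. the universal one with $x_{(n)}y=0$ for all $x,y\in Y$, $n\ge 2$. For a Lie algebra $\mathfrak g$ over $k$ with a symmetric invariant bilinear form $\langle\cdot|\cdot\rangle$ let $\mathrm{Cur}\,\mathfrak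 g=k[\partial]\otimes\mathfrak g$ be the Lie conformal algebra with $[a_{(0)}b]=[a,b]$ and $[a_{(n)}b]=0$ for $n\ge1$, $a,b\in\mathfrak g$, and let $K(\mathfrak g)=(k[\partial]\otimes\mathfrak g)\oplus ke$ be the Lie conformal algebra with $\partial e=0$, $[a_{(0)}b]=[a,b]$, $[a_{(1)}b]=\langle a|b\rangle e$, $[a_{(n)}b]=0$ for $n\ge2$, and $[a_{(n)}e]=[e_{(n)}a]=[e_{(n)}e]=0$ for $n\ge 0$, $a,b\in\mathfrak g$. For a Lie conformal algebra $L$ generated by a set $X$, let $U(L;X,2)$ be its universal enveloping associative conformal algebra with locality $2$ on $X$: the universal associative conformal algebra with a homomorphism from $L$ to its commutator conformal algebra such that $x_{(n)}y=0$ for the images of any $x,y\in X$ and all $n\ge2$. Let $\mathrm{gr}\,U(L;X,2)=\bigoplus_n F_n/F_{n-1}$ be the associated graded conformal algebra of its filtration by degree in $X$, where $F_n$ is spanned by the conformal monomials with at most $n$ letters from $X$. (1) For every linearly ordered set $Y$, the following monomials, where $n\ge0$ and $x_i,y,z\in Y$, are pairwise distinct and form a linear basis of $\mathrm{ComConf}(Y,2)$: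 $$L_0^{x_1}\cdots L_0^{x_n}\partial^s z,\qquad x_1\le\dots\le x_n,\ s\ge0;$$ $$L_0^{x_1}\cdots L_0^{x_n}L_1^{y}z,\qquad x_1\le\dots\le x_n\le z,\ y<z.$$ (2) For every Lie algebra $\mathfrak g$ over $k$ with a linear basis $X_1$ and every symmetric invariant bilinear form on $\mathfrak g$, with $X=X_1\cup\{e\}$, there is an isomorphism of conformal algebras $$\mathrm{gr}\,U(K(\mathfrak g);X,2)\simeq\mathrm{ComConf}(X_1,2)\oplus ke,$$ where $ke$ is one-dimensional with $\partial e=0$ and zero products, that sends the class in $F_1/F_0$ of each $x\in X_1$ to the generator $x$ and the class of $e$ to $e$. (3) For every Lie algebra $\mathfrak g$ over $k$ with a linear basis $X_1$ there is an isomorphism of conformal algebras $\mathrm{gr}\,U(\mathrm{Cur}\,\mathfrak g;X_1,2)\simeq\mathrm{ComConf}(X_1,2)$ that sends the class in $F_1/F_0$ of each $x\in X_1$ to the generator $x$. -/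

import Mathlib

open scoped DirectSum

namespace ConformalAlg

/-! ### Conformal algebras -/

/-- A vector space with a linear operator `D` (written `∂` on paper) and bilinear
`n`-products `a (n) b`, `n = 0, 1, 2, …`; no laws yet. -/
class PreConformal (k : Type*) (V : Type*) [Field k] [AddCommGroup V] [Module k V] where
  D : V →ₗ[k] V
  mul : ℕ → V →ₗ[k] V →ₗ[k] V

/-- Conformal algebra: sesquilinearity of the `n`-products and locality. -/
class ConformalAlgebra (k : Type*) (V : Type*) [Field k] [AddCommGroup V] [Module k V]
    extends PreConformal k V where
  D_mul : ∀ (n : ℕ) (a b : V), mul n (D a) b = -((n : k) • mul (n - 1) a b)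
  mul_D : ∀ (n : ℕ) (a b : V), mul n a (D b) = D (mul n a b) + (n : k) • mul (n - 1) a b
  locality : ∀ a b : V, ∃ N : ℕ, ∀ n, N ≤ n → mul n a b = 0

section Basic

variable (k : Type*) {V W : Type*} [Field k] [AddCommGroup V] [Module k V]
  [AddCommGroup W] [Module k W]

/-- The derivation `∂`. -/
abbrev der [PreConformal k V] : V →ₗ[k] V := PreConformal.D

/-- The `n`-product `a (n) b`; equivalently `L_n^a b`. -/
abbrev nmul [PreConformal k V] (n : ℕ) : V →ₗ[k] V →ₗ[k] V := PreConformal.mul n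

/-- `{b (n) a} = ∑_{s ≥ 0} (-1)^(n+s) (1/s!) ∂^s (b (n+s) a)`; the sum is finite by locality. -/
noncomputable def rmul [PreConformal k V] (n : ℕ) (a b : V) : V :=
  ∑ᶠ s : ℕ, ((-1 : k) ^ (n + s) * ((Nat.factorial s : k))⁻¹) •
    ((der k)^[s] (nmul k (n + s) b a))

/-- The commutator `[a (n) b] = a (n) b - {b (n) a}`. -/
noncomputable def comm [PreConformal k V] (n : ℕ) (a b : V) : V :=
  nmul k n a b - rmul k n a b

/-- The associativity law
`(a (n) b) (m) c = ∑_{s ≤ n} (-1)^s (n choose s) a (n-s) (b (m+s) c)`,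
i.e. `(a_λ b)_{λ+μ} c = a_λ (b_μ c)`. -/
def IsAssoc (V : Type*) [AddCommGroup V] [Module k V] [PreConformal k V] : Prop :=
  ∀ (n m : ℕ) (a b c : V), nmul k m (nmul k n a b) c =
    ∑ s ∈ Finset.range (n + 1), ((-1 : k) ^ s * (n.choose s : k)) •
      nmul k (n - s) a (nmul k (m + s) b c)

/-- Commutativity: all commutators vanish, i.e. `a_λ b = b_{-∂-λ} a`. -/
def IsComm (V : Type*) [AddCommGroup V] [Module k V] [PreConformal k V] : Prop :=
  ∀ (n : ℕ) (a b : V), comm k n a b = 0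

/-- Homomorphisms of conformal algebras. -/
structure IsConfHom [PreConformal k V] [PreConformal k W] (f : V →ₗ[k] W) : Prop where
  map_der : ∀ a, f (der k a) = der k (f a)
  map_nmul : ∀ n a b, f (nmul k n a b) = nmul k n (f a) (f b)

/-- Isomorphisms of conformal algebras. -/
structure ConfEquiv (V W : Type*) [AddCommGroup V] [Module k V] [AddCommGroup W] [Module k W]
    [PreConformal k V] [PreConformal k W] extends V ≃ₗ[k] W where
  isConfHom : IsConfHom k toLinearEquiv.toLinearMap

variable {k}

theorem iter_smul_add [PreConformal k V] (s : ℕ) (c : k) (a b : V) :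
    (der k)^[s] (c • a + b) = c • (der k)^[s] a + (der k)^[s] b := by
  induction s generalizing a b with
  | zero => rfl
  | succ s ih => simp only [Function.iterate_succ_apply, map_add, map_smul, ih]

theorem rmul_finite [ConformalAlgebra k V] (n : ℕ) (a b : V) :
    (Function.support (fun s : ℕ => ((-1 : k) ^ (n + s) *
      ((Nat.factorial s : k))⁻¹) • ((der k)^[s] (nmul k (n + s) b a)))).Finite := by
  obtain ⟨N, hN⟩ := ConformalAlgebra.locality (k := k) b a
  refine (Set.finite_lt_nat N).subset fun s hs => ?_
  by_contra hlt
  have : N ≤ n + s := by simp only [Set.mem_ofPred_eq] at hlt; omega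
  refine hs ?_
  have h0 := iter_smul_add (k := k) s 0 (0 : V) 0
  simp only [zero_smul, zero_add, add_zero] at h0
  have h1 := iter_smul_add (k := k) s 1 (0 : V) 0
  simp only [one_smul, add_zero] at h1
  simp only [nmul]
  rw [hN _ this, left_eq_add.1 h1, smul_zero]

theorem comm_smul_add_left [ConformalAlgebra k V] (n : ℕ) (c : k) (a a' b : V) :
    comm k n (c • a + a') b = c • comm k n a b + comm k n a' b := by
  have : rmul k n (c • a + a') b = c • rmul k n a b + rmul k n a' b := by
    unfold rmul
    rw [smul_finsum' _ (rmul_finite n a b), ← finsum_add_distrib _ (rmul_finite n a' b)]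
    · refine finsum_congr fun s => ?_
      rw [map_add, map_smul, iter_smul_add, smul_add, smul_comm]
    · exact (rmul_finite n a b).subset (Function.support_const_smul_subset _ _)
  unfold comm
  rw [this, map_add, map_smul, LinearMap.add_apply, LinearMap.smul_apply, smul_sub]
  abel

theorem comm_smul_add_right [ConformalAlgebra k V] (n : ℕ) (c : k) (a b b' : V) :
    comm k n a (c • b + b') = c • comm k n a b + comm k n a b' := by
  have : rmul k n a (c • b + b') = c • rmul k n a b + rmul k n a b' := by
    unfold rmul
    rw [smul_finsum' _ (rmul_finite n a b), ← finsum_add_distrib _ (rmul_finite n a b')]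
    · refine finsum_congr fun s => ?_
      rw [map_add, map_smul, LinearMap.add_apply, LinearMap.smul_apply, iter_smul_add, smul_add,
        smul_comm]
    · exact (rmul_finite n a b).subset (Function.support_const_smul_subset _ _)
  unfold comm
  rw [this, map_add, map_smul, smul_sub]
  abel

/-- The commutator products as bilinear maps. -/
noncomputable def commBil (k : Type*) {V : Type*} [Field k] [AddCommGroup V] [Module k V]
    [ConformalAlgebra k V] (n : ℕ) : V →ₗ[k] V →ₗ[k] V :=
  LinearMap.mk₂ k (comm k n)
    (fun a a' b => by simpa using comm_smul_add_left (k := k) n 1 a a' b)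
    (fun c a b => by
      have h0 : comm k n (0 : V) b = 0 := by
        simpa using comm_smul_add_left (k := k) n 1 (0 : V) 0 b
      simpa [h0] using comm_smul_add_left (k := k) n c a 0 b)
    (fun a b b' => by simpa using comm_smul_add_right (k := k) n 1 a b b')
    (fun c a b => by
      have h0 : comm k n a (0 : V) = 0 := by
        simpa using comm_smul_add_right (k := k) n 1 a (0 : V) 0
      simpa [h0] using comm_smul_add_right (k := k) n c a b 0)

theorem comm_map [ConformalAlgebra k V] [PreConformal k W] {f : V →ₗ[k] W}
    (hf : IsConfHom k f) (n : ℕ) (a b : V) : f (comm k n a b) = comm k n (f a) (f b) := by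
  have hD : ∀ (s : ℕ) (v : V), f ((der k)^[s] v) = (der k)^[s] (f v) := by
    intro s
    induction s with
    | zero => intro v; rfl
    | succ s ih => intro v; simp only [Function.iterate_succ_apply, ih, hf.map_der]
  unfold comm rmul
  rw [map_sub, hf.map_nmul]
  congr 1
  refine (AddMonoidHom.map_finsum f.toAddMonoidHom (rmul_finite n a b)).trans ?_
  refine finsum_congr fun s => ?_
  simp only [LinearMap.toAddMonoidHom_coe, map_smul, hD, hf.map_nmul]

/-- Locality of a bilinear family may be checked on a spanning set. -/
theorem local_of_span {V' : Type*} [AddCommGroup V'] [Module k V']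
    (m : ℕ → V →ₗ[k] V' →ₗ[k] W) {S : Set V} {T : Set V'}
    (hS : Submodule.span k S = ⊤) (hT : Submodule.span k T = ⊤)
    (h : ∀ a ∈ S, ∀ b ∈ T, ∃ N : ℕ, ∀ n, N ≤ n → m n a b = 0) (a : V) (b : V') :
    ∃ N : ℕ, ∀ n, N ≤ n → m n a b = 0 := by
  have h1 : ∀ a ∈ S, ∀ b : V', ∃ N : ℕ, ∀ n, N ≤ n → m n a b = 0 := by
    intro a ha b
    have hb : b ∈ Submodule.span k T := by rw [hT]; trivial
    induction hb using Submodule.span_induction with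
    | mem x hx => exact h a ha x hx
    | zero => exact ⟨0, fun n _ => by simp⟩
    | add x y _ _ hx hy =>
      obtain ⟨N, hN⟩ := hx
      obtain ⟨M, hM⟩ := hy
      exact ⟨max N M, fun n hn => by
        rw [map_add, hN n (le_trans (le_max_left _ _) hn),
          hM n (le_trans (le_max_right _ _) hn), add_zero]⟩
    | smul c x _ hx =>
      obtain ⟨N, hN⟩ := hx
      exact ⟨N, fun n hn => by rw [map_smul, hN n hn, smul_zero]⟩
  have ha : a ∈ Submodule.span k S := by rw [hS]; trivial
  induction ha using Submodule.span_induction with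
  | mem x hx => exact h1 x hx b
  | zero => exact ⟨0, fun n _ => by simp⟩
  | add x y _ _ hx hy =>
    obtain ⟨N, hN⟩ := hx
    obtain ⟨M, hM⟩ := hy
    exact ⟨max N M, fun n hn => by
      rw [map_add, LinearMap.add_apply, hN n (le_trans (le_max_left _ _) hn),
        hM n (le_trans (le_max_right _ _) hn), add_zero]⟩
  | smul c x _ hx =>
    obtain ⟨N, hN⟩ := hx
    exact ⟨N, fun n hn => by rw [map_smul, LinearMap.smul_apply, hN n hn, smul_zero]⟩

/-- A bilinear map that vanishes on `p` and `q` descends to the quotients. -/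
def quotBil {V' : Type*} [AddCommGroup V'] [Module k V'] (f : V →ₗ[k] V' →ₗ[k] W)
    (p : Submodule k V) (q : Submodule k V') (hp : ∀ a ∈ p, ∀ b, f a b = 0)
    (hq : ∀ a, ∀ b ∈ q, f a b = 0) : (V ⧸ p) →ₗ[k] (V' ⧸ q) →ₗ[k] W :=
  p.liftQ (q.liftQ f.flip fun b hb => by ext a; exact hq a b hb).flip fun a ha => by
    rw [LinearMap.mem_ker]
    ext b
    exact hp a ha b

end Basic

/-! ### Ideals, quotients and direct sums -/

section Quotient

variable {k V : Type*} [Field k] [AddCommGroup V] [Module k V]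

/-- A subspace that is closed under `∂` and under all products with arbitrary elements. -/
structure IsConfIdeal [PreConformal k V] (I : Submodule k V) : Prop where
  der_mem : ∀ a ∈ I, der k a ∈ I
  nmul_mem_left : ∀ n, ∀ a ∈ I, ∀ b, nmul k n a b ∈ I
  nmul_mem_right : ∀ n a, ∀ b ∈ I, nmul k n a b ∈ I

/-- The (two-sided) ideal generated by a set. -/
def idealGen (k : Type*) {V : Type*} [Field k] [AddCommGroup V] [Module k V] [PreConformal k V]
    (S : Set V) : Submodule k V :=
  sInf {I | IsConfIdeal I ∧ S ⊆ I}

theorem subset_idealGen [PreConformal k V] (S : Set V) : S ⊆ idealGen k S := by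
  intro s hs
  simp only [idealGen, SetLike.mem_coe, Submodule.mem_sInf]
  exact fun I hI => hI.2 hs

theorem idealGen_le [PreConformal k V] {S : Set V} {I : Submodule k V} (hI : IsConfIdeal I)
    (hS : S ⊆ I) : idealGen k S ≤ I :=
  sInf_le ⟨hI, hS⟩

theorem isConfIdeal_idealGen [PreConformal k V] (S : Set V) : IsConfIdeal (idealGen k S) := by
  constructor
  · intro a ha
    simp only [idealGen, Submodule.mem_sInf] at ha ⊢
    exact fun I hI => hI.1.der_mem a (ha I hI)
  · intro n a ha b
    simp only [idealGen, Submodule.mem_sInf] at ha ⊢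
    exact fun I hI => hI.1.nmul_mem_left n a (ha I hI) b
  · intro n a b hb
    simp only [idealGen, Submodule.mem_sInf] at hb ⊢
    exact fun I hI => hI.1.nmul_mem_right n a b (hb I hI)

/-- The quotient by the ideal generated by `S`. -/
abbrev ConfQuot (k : Type*) {V : Type*} [Field k] [AddCommGroup V] [Module k V]
    [PreConformal k V] (S : Set V) : Type _ :=
  V ⧸ idealGen k S

instance [PreConformal k V] (S : Set V) : PreConformal k (ConfQuot k S) where
  D := (idealGen k S).mapQ (idealGen k S) (der k)
    fun a ha => (isConfIdeal_idealGen S).der_mem a ha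
  mul n := quotBil ((nmul k n).compr₂ (idealGen k S).mkQ) (idealGen k S) (idealGen k S)
    (fun a ha b => by
      simpa using (isConfIdeal_idealGen S).nmul_mem_left n a ha b)
    (fun a b hb => by
      simpa using (isConfIdeal_idealGen S).nmul_mem_right n a b hb)

/-- The projection to the quotient. -/
def ConfQuot.mk [PreConformal k V] (S : Set V) : V →ₗ[k] ConfQuot k S := (idealGen k S).mkQ

theorem ConfQuot.mk_surjective [PreConformal k V] (S : Set V) :
    Function.Surjective (ConfQuot.mk (k := k) S) :=
  Submodule.mkQ_surjective _

theorem ConfQuot.mk_hom [PreConformal k V] (S : Set V) : IsConfHom k (ConfQuot.mk (k := k) S) :=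
  ⟨fun _ => rfl, fun _ _ _ => rfl⟩

theorem ConfQuot.mk_eq_zero [PreConformal k V] {S : Set V} {a : V} (ha : a ∈ S) :
    ConfQuot.mk (k := k) S a = 0 :=
  (Submodule.Quotient.mk_eq_zero _).2 (subset_idealGen S ha)

theorem ConfQuot.assoc [PreConformal k V] (S : Set V) (h : IsAssoc k V) :
    IsAssoc k (ConfQuot k S) := by
  intro n m a b c
  obtain ⟨a, rfl⟩ := ConfQuot.mk_surjective S a
  obtain ⟨b, rfl⟩ := ConfQuot.mk_surjective S b
  obtain ⟨c, rfl⟩ := ConfQuot.mk_surjective S c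
  simp only [← (ConfQuot.mk_hom S).map_nmul, h n m a b c, map_sum, map_smul]

instance [ConformalAlgebra k V] (S : Set V) : ConformalAlgebra k (ConfQuot k S) where
  D_mul n a b := by
    obtain ⟨a, rfl⟩ := ConfQuot.mk_surjective S a
    obtain ⟨b, rfl⟩ := ConfQuot.mk_surjective S b
    change ConfQuot.mk S (nmul k n (der k a) b) = -((n : k) • ConfQuot.mk S (nmul k (n - 1) a b))
    rw [← map_smul, ← map_neg]
    exact congrArg _ (ConformalAlgebra.D_mul n a b)
  mul_D n a b := by
    obtain ⟨a, rfl⟩ := ConfQuot.mk_surjective S a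
    obtain ⟨b, rfl⟩ := ConfQuot.mk_surjective S b
    change ConfQuot.mk S (nmul k n a (der k b)) =
      ConfQuot.mk S (der k (nmul k n a b)) + (n : k) • ConfQuot.mk S (nmul k (n - 1) a b)
    rw [← map_smul, ← map_add]
    exact congrArg _ (ConformalAlgebra.mul_D n a b)
  locality a b := by
    obtain ⟨a, rfl⟩ := ConfQuot.mk_surjective S a
    obtain ⟨b, rfl⟩ := ConfQuot.mk_surjective S b
    obtain ⟨N, hN⟩ := ConformalAlgebra.locality (k := k) a b
    exact ⟨N, fun n hn => (congrArg (ConfQuot.mk S) (hN n hn)).trans (map_zero _)⟩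

/-- A homomorphism that kills `S` factors uniquely through the quotient. -/
theorem ConfQuot.existsUnique_lift {W : Type*} [AddCommGroup W] [Module k W] [PreConformal k V]
    [PreConformal k W] (S : Set V) {f : V →ₗ[k] W} (hf : IsConfHom k f)
    (hS : ∀ s ∈ S, f s = 0) :
    ∃! F : ConfQuot k S →ₗ[k] W, IsConfHom k F ∧ ∀ v, F (ConfQuot.mk S v) = f v := by
  have hI : IsConfIdeal (LinearMap.ker f) := by
    refine ⟨fun a ha => ?_, fun n a ha b => ?_, fun n a b hb => ?_⟩
    · rw [LinearMap.mem_ker] at *; rw [hf.map_der, ha, map_zero]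
    · rw [LinearMap.mem_ker] at *; rw [hf.map_nmul, ha, map_zero, LinearMap.zero_apply]
    · rw [LinearMap.mem_ker] at *; rw [hf.map_nmul, hb, map_zero]
  refine ⟨(idealGen k S).liftQ f (idealGen_le hI hS), ⟨⟨fun a => ?_, fun n a b => ?_⟩,
    fun _ => rfl⟩, fun G hG => ?_⟩
  · obtain ⟨a, rfl⟩ := ConfQuot.mk_surjective S a
    exact hf.map_der a
  · obtain ⟨a, rfl⟩ := ConfQuot.mk_surjective S a
    obtain ⟨b, rfl⟩ := ConfQuot.mk_surjective S b
    exact hf.map_nmul n a b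
  · ext a
    exact hG.2 a

/-- Direct sum of two conformal algebras, with componentwise operations. -/
instance {W : Type*} [AddCommGroup W] [Module k W] [PreConformal k V] [PreConformal k W] :
    PreConformal k (V × W) where
  D := (der k).prodMap (der k)
  mul n := LinearMap.mk₂ k (fun p q => (nmul k n p.1 q.1, nmul k n p.2 q.2))
    (fun _ _ _ => by ext <;> simp) (fun _ _ _ => by ext <;> simp)
    (fun _ _ _ => by ext <;> simp) (fun _ _ _ => by ext <;> simp)

instance {W : Type*} [AddCommGroup W] [Module k W] [ConformalAlgebra k V]
    [ConformalAlgebra k W] : ConformalAlgebra k (V × W) where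
  D_mul n a b := Prod.ext (ConformalAlgebra.D_mul n a.1 b.1) (ConformalAlgebra.D_mul n a.2 b.2)
  mul_D n a b := Prod.ext (ConformalAlgebra.mul_D n a.1 b.1) (ConformalAlgebra.mul_D n a.2 b.2)
  locality a b := by
    obtain ⟨N, hN⟩ := ConformalAlgebra.locality (k := k) a.1 b.1
    obtain ⟨M, hM⟩ := ConformalAlgebra.locality (k := k) a.2 b.2
    exact ⟨max N M, fun n hn => Prod.ext (hN n (le_trans (le_max_left _ _) hn))
      (hM n (le_trans (le_max_right _ _) hn))⟩

end Quotient

/-- The one-dimensional conformal algebra `k e` with `∂ e = 0` and `e (n) e = 0`;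
the element `e` is `1 : k`. -/
def TorsionLine (k : Type*) : Type _ := k

namespace TorsionLine

variable (k : Type*) [Field k]

instance : AddCommGroup (TorsionLine k) := inferInstanceAs (AddCommGroup k)

instance : Module k (TorsionLine k) := inferInstanceAs (Module k k)

/-- The basis vector `e`. -/
def e : TorsionLine k := (1 : k)

instance : ConformalAlgebra k (TorsionLine k) where
  D := 0
  mul _ := 0
  D_mul _ _ _ := by simp
  mul_D _ _ _ := by simp
  locality _ _ := ⟨0, fun _ _ => rfl⟩

end TorsionLine

/-! ### Monomials and free objects -/

/-- Nonassociative conformal monomials in the letters `X`. -/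
inductive Mon (X : Type*) : Type _
  | of : X → Mon X
  | d : Mon X → Mon X
  | mul : ℕ → Mon X → Mon X → Mon X

/-- The degree in `X`: the number of letters. -/
def Mon.deg {X : Type*} : Mon X → ℕ
  | .of _ => 1
  | .d u => u.deg
  | .mul _ u v => u.deg + v.deg

/-- The value of a monomial, for given operations and given values of the letters. -/
def Mon.eval {X V : Type*} (d : V → V) (m : ℕ → V → V → V) (f : X → V) : Mon X → V
  | .of x => f x
  | .d u => d (u.eval d m f)
  | .mul n u v => m n (u.eval d m f) (v.eval d m f)

/-- Linear combinations of monomials. -/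
abbrev FreeMag (k X : Type*) [Field k] : Type _ := Mon X →₀ k

section Free

variable {k X V : Type*} [Field k] [AddCommGroup V] [Module k V]

noncomputable instance : PreConformal k (FreeMag k X) where
  D := Finsupp.linearCombination k fun u => Finsupp.single (Mon.d u) 1
  mul n := Finsupp.linearCombination k fun u =>
    Finsupp.linearCombination k fun v => Finsupp.single (Mon.mul n u v) 1

/-- The value of a linear combination of monomials. -/
noncomputable def FreeMag.eval (k : Type*) {X V : Type*} [Field k] [AddCommGroup V] [Module k V]
    (d : V → V) (m : ℕ → V → V → V) (f : X → V) : FreeMag k X →ₗ[k] V :=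
  Finsupp.linearCombination k (Mon.eval d m f)

theorem FreeMag.der_single (u : Mon X) :
    der k (Finsupp.single u 1 : FreeMag k X) = Finsupp.single (Mon.d u) 1 :=
  (Finsupp.linearCombination_single k 1 u).trans (one_smul _ _)

theorem FreeMag.nmul_single (n : ℕ) (u v : Mon X) :
    nmul k n (Finsupp.single u 1 : FreeMag k X) (Finsupp.single v 1) =
      Finsupp.single (Mon.mul n u v) 1 := by
  have h : nmul k n (Finsupp.single u 1 : FreeMag k X) =
      Finsupp.linearCombination k fun v => Finsupp.single (Mon.mul n u v) (1 : k) :=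
    (Finsupp.linearCombination_single k 1 u).trans (one_smul _ _)
  rw [h, Finsupp.linearCombination_single, one_smul]

theorem FreeMag.eval_single (d : V → V) (m : ℕ → V → V → V) (f : X → V) (u : Mon X) :
    FreeMag.eval k d m f (Finsupp.single u 1) = u.eval d m f :=
  (Finsupp.linearCombination_single k 1 u).trans (one_smul _ _)

/-- The letter `x` as an element. -/
noncomputable def FreeMag.of (k : Type*) {X : Type*} [Field k] (x : X) : FreeMag k X :=
  Finsupp.single (Mon.of x) 1

theorem FreeMag.hom_eval [PreConformal k V] (f : X → V) :
    IsConfHom k (FreeMag.eval k (der k) (fun n a b => nmul k n a b) f) := by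
  constructor
  · intro a
    have : (FreeMag.eval k (der k) (fun n a b => nmul k n a b) f) ∘ₗ der k =
        der k ∘ₗ (FreeMag.eval k (der k) (fun n a b => nmul k n a b) f) := by
      refine Finsupp.lhom_ext' fun u => LinearMap.ext_ring ?_
      change FreeMag.eval k _ _ f (der k (Finsupp.single u 1)) =
        der k (FreeMag.eval k _ _ f (Finsupp.single u 1))
      rw [FreeMag.der_single, FreeMag.eval_single, FreeMag.eval_single]
      rfl
    exact LinearMap.congr_fun this a
  · intro n a b
    have : (nmul k n).compr₂ (FreeMag.eval k (der k) (fun n a b => nmul k n a b) f) =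
        (nmul k n).compl₁₂ (FreeMag.eval k (der k) (fun n a b => nmul k n a b) f)
          (FreeMag.eval k (der k) (fun n a b => nmul k n a b) f) := by
      refine Finsupp.lhom_ext' fun u => LinearMap.ext_ring (Finsupp.lhom_ext' fun v =>
        LinearMap.ext_ring ?_)
      change FreeMag.eval k _ _ f (nmul k n (Finsupp.single u 1) (Finsupp.single v 1)) =
        nmul k n (FreeMag.eval k _ _ f (Finsupp.single u 1))
          (FreeMag.eval k _ _ f (Finsupp.single v 1))
      rw [FreeMag.nmul_single, FreeMag.eval_single, FreeMag.eval_single, FreeMag.eval_single]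
      rfl
    exact LinearMap.congr_fun (LinearMap.congr_fun this a) b

/-- Defining relations of the free associative conformal algebra with locality function `N`. -/
inductive AssRel (k : Type*) {X : Type*} [Field k] (N : X → X → ℕ) : FreeMag k X → Prop
  | D_mul (n : ℕ) (a b : FreeMag k X) :
      AssRel k N (nmul k n (der k a) b + (n : k) • nmul k (n - 1) a b)
  | mul_D (n : ℕ) (a b : FreeMag k X) :
      AssRel k N (nmul k n a (der k b) - (der k (nmul k n a b) + (n : k) • nmul k (n - 1) a b))
  | assoc (n m : ℕ) (a b c : FreeMag k X) :
      AssRel k N (nmul k m (nmul k n a b) c -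
        ∑ s ∈ Finset.range (n + 1), ((-1 : k) ^ s * (n.choose s : k)) •
          nmul k (n - s) a (nmul k (m + s) b c))
  | loc (x y : X) (n : ℕ) (h : N x y ≤ n) :
      AssRel k N (nmul k n (FreeMag.of k x) (FreeMag.of k y))

/-- The free associative conformal algebra generated by `X` with respect to the locality
function `N`. -/
abbrev AssConf (k : Type*) {X : Type*} [Field k] (N : X → X → ℕ) : Type _ :=
  ConfQuot k {a : FreeMag k X | AssRel k N a}

namespace AssConf

variable (k) in
/-- The generators. -/
noncomputable def gen (N : X → X → ℕ) (x : X) : AssConf k N :=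
  ConfQuot.mk _ (FreeMag.of k x)

theorem isAssoc (N : X → X → ℕ) : IsAssoc k (AssConf k N) := by
  intro n m a b c
  obtain ⟨a, rfl⟩ := ConfQuot.mk_surjective _ a
  obtain ⟨b, rfl⟩ := ConfQuot.mk_surjective _ b
  obtain ⟨c, rfl⟩ := ConfQuot.mk_surjective _ c
  have h := ConfQuot.mk_eq_zero (k := k) (S := {a : FreeMag k X | AssRel k N a})
    (AssRel.assoc n m a b c)
  rw [map_sub, sub_eq_zero, map_sum] at h
  simpa only [map_smul, (ConfQuot.mk_hom _).map_nmul] using h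

theorem der_nmul (N : X → X → ℕ) (n : ℕ) (a b : AssConf k N) :
    nmul k n (der k a) b = -((n : k) • nmul k (n - 1) a b) := by
  obtain ⟨a, rfl⟩ := ConfQuot.mk_surjective _ a
  obtain ⟨b, rfl⟩ := ConfQuot.mk_surjective _ b
  have h := ConfQuot.mk_eq_zero (k := k) (S := {a : FreeMag k X | AssRel k N a})
    (AssRel.D_mul n a b)
  rw [map_add] at h
  simpa only [map_smul, (ConfQuot.mk_hom _).map_nmul, (ConfQuot.mk_hom _).map_der]
    using eq_neg_of_add_eq_zero_left h

theorem nmul_der (N : X → X → ℕ) (n : ℕ) (a b : AssConf k N) :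
    nmul k n a (der k b) = der k (nmul k n a b) + (n : k) • nmul k (n - 1) a b := by
  obtain ⟨a, rfl⟩ := ConfQuot.mk_surjective _ a
  obtain ⟨b, rfl⟩ := ConfQuot.mk_surjective _ b
  have h := ConfQuot.mk_eq_zero (k := k) (S := {a : FreeMag k X | AssRel k N a})
    (AssRel.mul_D n a b)
  rw [map_sub, sub_eq_zero, map_add] at h
  simpa only [map_smul, (ConfQuot.mk_hom _).map_nmul, (ConfQuot.mk_hom _).map_der] using h

theorem gen_local (N : X → X → ℕ) (x y : X) (n : ℕ) (h : N x y ≤ n) :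
    nmul k n (gen k N x) (gen k N y) = 0 := by
  have h := ConfQuot.mk_eq_zero (k := k) (S := {a : FreeMag k X | AssRel k N a})
    (AssRel.loc x y n h)
  rwa [(ConfQuot.mk_hom _).map_nmul] at h

/-- The value of a monomial in the free associative conformal algebra. -/
noncomputable def mon (k : Type*) {X : Type*} [Field k] (N : X → X → ℕ) (u : Mon X) :
    AssConf k N :=
  u.eval (der k) (fun n a b => nmul k n a b) (gen k N)

theorem mon_eq (N : X → X → ℕ) (u : Mon X) :
    mon k N u = ConfQuot.mk _ (Finsupp.single u (1 : k)) := by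
  induction u with
  | of x => rfl
  | d u ih =>
    change der k (mon k N u) = _
    rw [ih, ← (ConfQuot.mk_hom _).map_der, FreeMag.der_single]
  | mul n u v ihu ihv =>
    change nmul k n (mon k N u) (mon k N v) = _
    rw [ihu, ihv, ← (ConfQuot.mk_hom _).map_nmul, FreeMag.nmul_single]

theorem span_mon (N : X → X → ℕ) : Submodule.span k (Set.range (mon k N)) = ⊤ := by
  rw [eq_top_iff]
  intro a _
  obtain ⟨a, rfl⟩ := ConfQuot.mk_surjective _ a
  induction a using Finsupp.induction_linear with
  | zero => rw [map_zero]; exact Submodule.zero_mem _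
  | add f g hf hg => rw [map_add]; exact Submodule.add_mem _ (hf trivial) (hg trivial)
  | single u c =>
    have : Finsupp.single u c = c • Finsupp.single u (1 : k) := by simp
    rw [this, map_smul, ← mon_eq]
    exact Submodule.smul_mem _ _ (Submodule.subset_span ⟨u, rfl⟩)

theorem local_mul_left (N : X → X → ℕ) {b c : AssConf k N} {M : ℕ}
    (h : ∀ n, M ≤ n → nmul k n b c = 0) (i : ℕ) (a : AssConf k N) (n : ℕ) (hn : M ≤ n) :
    nmul k n (nmul k i a b) c = 0 := by
  rw [isAssoc N i n a b c]
  refine Finset.sum_eq_zero fun s _ => ?_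
  rw [h (n + s) (by omega), map_zero, smul_zero]

theorem local_mul_right (N : X → X → ℕ) {a b c : AssConf k N} {M₁ M₂ : ℕ}
    (h₁ : ∀ n, M₁ ≤ n → nmul k n a b = 0) (h₂ : ∀ n, M₂ ≤ n → nmul k n b c = 0) :
    ∀ j m p : ℕ, M₂ - m ≤ j → M₁ + M₂ ≤ p + m → nmul k p a (nmul k m b c) = 0 := by
  intro j
  induction j with
  | zero =>
    intro m p hj _
    rw [h₂ m (by omega), map_zero]
  | succ j ih =>
    intro m p hj hp
    by_cases hm : M₂ ≤ m
    · rw [h₂ m hm, map_zero]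
    · have h := isAssoc N p m a b c
      rw [h₁ p (by omega), map_zero, LinearMap.zero_apply, Finset.sum_range_succ',
        Finset.sum_eq_zero] at h
      · simpa using h.symm
      · intro s hs
        rw [Finset.mem_range] at hs
        rw [ih (m + (s + 1)) (p - (s + 1)) (by omega) (by omega), smul_zero]

theorem mon_local (N : X → X → ℕ) : ∀ (j : ℕ) (u v : Mon X), sizeOf u + sizeOf v ≤ j →
    ∃ M : ℕ, ∀ n, M ≤ n → nmul k n (mon k N u) (mon k N v) = 0 := by
  intro j
  induction j with
  | zero => intro u v h; cases u <;> simp at h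
  | succ j ih =>
    intro u v h
    cases u with
    | d u =>
      obtain ⟨M, hM⟩ := ih u v (by simp at h ⊢; omega)
      refine ⟨M + 1, fun n hn => ?_⟩
      change nmul k n (der k (mon k N u)) _ = 0
      rw [der_nmul, hM (n - 1) (by omega), smul_zero, neg_zero]
    | mul i u w =>
      obtain ⟨M, hM⟩ := ih w v (by simp at h ⊢; omega)
      exact ⟨M, local_mul_left N hM i _⟩
    | of x =>
      cases v with
      | of y => exact ⟨N x y, fun n hn => gen_local N x y n hn⟩
      | d v =>
        obtain ⟨M, hM⟩ := ih (.of x) v (by simp at h ⊢; omega)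
        refine ⟨M + 1, fun n hn => ?_⟩
        change nmul k n _ (der k (mon k N v)) = 0
        rw [nmul_der, hM n (by omega), hM (n - 1) (by omega), smul_zero, map_zero, add_zero]
      | mul i v w =>
        obtain ⟨M₁, h₁⟩ := ih (.of x) v (by simp at h ⊢; omega)
        obtain ⟨M₂, h₂⟩ := ih v w (by simp at h ⊢; omega)
        exact ⟨M₁ + M₂, fun n hn => local_mul_right N h₁ h₂ M₂ i n (by omega) (by omega)⟩

noncomputable instance (N : X → X → ℕ) : ConformalAlgebra k (AssConf k N) where
  D_mul := der_nmul N
  mul_D := nmul_der N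
  locality := local_of_span _ (span_mon N) (span_mon N) (by
    rintro _ ⟨u, rfl⟩ _ ⟨v, rfl⟩
    exact mon_local N _ u v le_rfl)

/-- The universal property of the free associative conformal algebra. -/
theorem existsUnique_lift [ConformalAlgebra k V] (hV : IsAssoc k V) (N : X → X → ℕ) (f : X → V)
    (hf : ∀ x y n, N x y ≤ n → nmul k n (f x) (f y) = 0) :
    ∃! F : AssConf k N →ₗ[k] V, IsConfHom k F ∧ ∀ x, F (gen k N x) = f x := by
  have hE := FreeMag.hom_eval (k := k) f
  have hx : ∀ x, FreeMag.eval k (der k) (fun n a b => nmul k n a b) f (FreeMag.of k x) = f x := by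
    intro x; simp [FreeMag.eval, FreeMag.of, Mon.eval]
  obtain ⟨F, ⟨hF, hF'⟩, -⟩ := ConfQuot.existsUnique_lift {a : FreeMag k X | AssRel k N a} hE (by
    intro s hs
    cases hs with
    | D_mul n a b =>
      rw [map_add, map_smul, hE.map_nmul, hE.map_nmul, hE.map_der]
      simp only [der, nmul, ConformalAlgebra.D_mul, neg_add_cancel]
    | mul_D n a b =>
      rw [map_sub, map_add, map_smul, hE.map_nmul, hE.map_der, hE.map_nmul, hE.map_der,
        hE.map_nmul]
      simp only [der, nmul, ConformalAlgebra.mul_D, sub_self]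
    | assoc n m a b c =>
      rw [map_sub, map_sum, sub_eq_zero]
      simp only [map_smul, hE.map_nmul]
      exact hV n m _ _ _
    | loc x y n h => rw [hE.map_nmul, hx, hx, hf x y n h])
  refine ⟨F, ⟨hF, fun x => (hF' _).trans (hx x)⟩, fun G hG => ?_⟩
  have key : ∀ u : Mon X, G (mon k N u) = F (mon k N u) := by
    intro u
    induction u with
    | of x => exact (hG.2 x).trans ((hF' _).trans (hx x)).symm
    | d u ih =>
      change G (der k (mon k N u)) = F (der k (mon k N u))
      rw [hG.1.map_der, hF.map_der, ih]
    | mul n u v ihu ihv =>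
      change G (nmul k n (mon k N u) (mon k N v)) = F (nmul k n (mon k N u) (mon k N v))
      rw [hG.1.map_nmul, hF.map_nmul, ihu, ihv]
  exact LinearMap.ext_on (span_mon N) (by rintro _ ⟨u, rfl⟩; exact key u)

end AssConf

/-- The free commutative conformal algebra generated by `X` with respect to the locality
function `N`: all commutators of the free associative one are set to zero. -/
abbrev ComConf (k : Type*) {X : Type*} [Field k] (N : X → X → ℕ) : Type _ :=
  ConfQuot k {c : AssConf k N | ∃ (n : ℕ) (a b : AssConf k N), c = comm k n a b}

namespace ComConf

variable (k) in
/-- The generators. -/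
noncomputable def gen (N : X → X → ℕ) (x : X) : ComConf k N :=
  ConfQuot.mk _ (AssConf.gen k N x)

theorem isAssoc (N : X → X → ℕ) : IsAssoc k (ComConf k N) :=
  ConfQuot.assoc _ (AssConf.isAssoc N)

theorem isComm (N : X → X → ℕ) : IsComm k (ComConf k N) := by
  intro n a b
  obtain ⟨a, rfl⟩ := ConfQuot.mk_surjective _ a
  obtain ⟨b, rfl⟩ := ConfQuot.mk_surjective _ b
  rw [← comm_map (ConfQuot.mk_hom _)]
  exact ConfQuot.mk_eq_zero ⟨n, a, b, rfl⟩

/-- The universal property of the free commutative conformal algebra. -/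
theorem existsUnique_lift [ConformalAlgebra k V] (hV : IsAssoc k V) (hV' : IsComm k V)
    (N : X → X → ℕ) (f : X → V) (hf : ∀ x y n, N x y ≤ n → nmul k n (f x) (f y) = 0) :
    ∃! F : ComConf k N →ₗ[k] V, IsConfHom k F ∧ ∀ x, F (gen k N x) = f x := by
  obtain ⟨F₀, ⟨h₀, h₀'⟩, hu⟩ := AssConf.existsUnique_lift hV N f hf
  obtain ⟨F, ⟨hF, hF'⟩, huF⟩ := ConfQuot.existsUnique_lift
    {c : AssConf k N | ∃ (n : ℕ) (a b : AssConf k N), c = comm k n a b} h₀ (by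
      rintro _ ⟨n, a, b, rfl⟩
      rw [comm_map h₀]
      exact hV' n _ _)
  refine ⟨F, ⟨hF, fun x => (hF' _).trans (h₀' x)⟩, fun G hG => huF G ⟨hG.1, fun v => ?_⟩⟩
  have h := hu (G ∘ₗ ConfQuot.mk _) ⟨⟨fun a => by
    rw [LinearMap.comp_apply, (ConfQuot.mk_hom _).map_der, hG.1.map_der]; rfl, fun n a b => by
    rw [LinearMap.comp_apply, (ConfQuot.mk_hom _).map_nmul, hG.1.map_nmul]; rfl⟩, hG.2⟩
  exact LinearMap.congr_fun h v

end ComConf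

/-- The universal enveloping associative conformal algebra `U(L; X, N)` of a Lie conformal
algebra `L` generated by a family `x : X → L`, with respect to the locality function `N`:
the quotient of the free associative conformal algebra by the values, under the commutator
products, of all conformal polynomials in `X` that vanish in `L`. -/
abbrev UEnv (k : Type*) {X L : Type*} [Field k] [AddCommGroup L] [Module k L]
    [PreConformal k L] (x : X → L) (N : X → X → ℕ) : Type _ :=
  ConfQuot k {r : AssConf k N | ∃ t : FreeMag k X,
    FreeMag.eval k (der k) (fun n a b => nmul k n a b) x t = 0 ∧
    r = FreeMag.eval k (der k) (comm k) (AssConf.gen k N) t}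

namespace UEnv

variable {L : Type*} [AddCommGroup L] [Module k L]

variable (k) in
/-- The images of the generators. -/
noncomputable def gen [PreConformal k L] (x : X → L) (N : X → X → ℕ) (i : X) : UEnv k x N :=
  ConfQuot.mk _ (AssConf.gen k N i)

theorem isAssoc [PreConformal k L] (x : X → L) (N : X → X → ℕ) : IsAssoc k (UEnv k x N) :=
  ConfQuot.assoc _ (AssConf.isAssoc N)

/-- If `x` generates `L`, then `L` maps homomorphically to `U(L; X, N)` with the commutator
products. -/
theorem exists_map [PreConformal k L] (x : X → L) (N : X → X → ℕ)
    (hx : Function.Surjective (FreeMag.eval k (der k) (fun n a b => nmul k n a b) x)) :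
    ∃ ρ : L →ₗ[k] UEnv k x N, (∀ i, ρ (x i) = gen k x N i) ∧
      (∀ a, ρ (der k a) = der k (ρ a)) ∧ ∀ n a b, ρ (nmul k n a b) = comm k n (ρ a) (ρ b) := by
  set ev := FreeMag.eval k (der k) (fun n a b => nmul k n a b) x with hev
  set ev' := FreeMag.eval k (der k) (comm k) (AssConf.gen k N) with hev'
  have h1 : IsConfHom k ev := FreeMag.hom_eval x
  have h2 : ∀ a, ev' (der k a) = der k (ev' a) := by
    intro a
    refine LinearMap.congr_fun (f := ev' ∘ₗ der k) (g := der k ∘ₗ ev') ?_ a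
    refine Finsupp.lhom_ext' fun u => LinearMap.ext_ring ?_
    change ev' (der k (Finsupp.single u 1)) = der k (ev' (Finsupp.single u 1))
    rw [FreeMag.der_single, hev', FreeMag.eval_single, FreeMag.eval_single]
    rfl
  have h3 : ∀ n a b, ev' (nmul k n a b) = comm k n (ev' a) (ev' b) := by
    intro n a b
    have : (nmul k n).compr₂ ev' = (commBil k n).compl₁₂ ev' ev' := by
      refine Finsupp.lhom_ext' fun u => LinearMap.ext_ring (Finsupp.lhom_ext' fun v =>
        LinearMap.ext_ring ?_)
      change ev' (nmul k n (Finsupp.single u 1) (Finsupp.single v 1)) =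
        comm k n (ev' (Finsupp.single u 1)) (ev' (Finsupp.single v 1))
      rw [FreeMag.nmul_single, hev', FreeMag.eval_single, FreeMag.eval_single,
        FreeMag.eval_single]
      rfl
    exact LinearMap.congr_fun (LinearMap.congr_fun this a) b
  let p : AssConf k N →ₗ[k] UEnv k x N := ConfQuot.mk _
  have hp : IsConfHom k p := ConfQuot.mk_hom _
  have hk : LinearMap.ker ev ≤ LinearMap.ker (p ∘ₗ ev') := by
    intro t ht
    exact ConfQuot.mk_eq_zero ⟨t, ht, rfl⟩
  let ρ : L →ₗ[k] UEnv k x N := (LinearMap.ker ev).liftQ (p ∘ₗ ev') hk ∘ₗ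
    (ev.quotKerEquivOfSurjective hx).symm.toLinearMap
  have hρ : ∀ t, ρ (ev t) = p (ev' t) := by
    intro t
    have : (ev.quotKerEquivOfSurjective hx).symm (ev t) = Submodule.Quotient.mk t := by
      rw [LinearEquiv.symm_apply_eq]; rfl
    change (LinearMap.ker ev).liftQ (p ∘ₗ ev') hk
      ((ev.quotKerEquivOfSurjective hx).symm (ev t)) = _
    rw [this]
    rfl
  refine ⟨ρ, fun i => ?_, fun a => ?_, fun n a b => ?_⟩
  · have h := hρ (FreeMag.of k i)
    rw [FreeMag.of, hev, hev', FreeMag.eval_single, FreeMag.eval_single] at h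
    exact h
  · obtain ⟨t, rfl⟩ := hx a
    rw [← h1.map_der, hρ, hρ, h2, hp.map_der]
  · obtain ⟨t, rfl⟩ := hx a
    obtain ⟨t', rfl⟩ := hx b
    rw [← h1.map_nmul, hρ, hρ, hρ, h3, comm_map hp]

/-- The universal property: a homomorphism from `L` to the commutator algebra of an associative
conformal algebra, with the prescribed locality on `X`, extends uniquely to `U(L; X, N)`. -/
theorem existsUnique_lift [PreConformal k L] [ConformalAlgebra k V] (hV : IsAssoc k V)
    (x : X → L) (N : X → X → ℕ) (ρ : L →ₗ[k] V) (hρ : ∀ a, ρ (der k a) = der k (ρ a))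
    (hρ' : ∀ n a b, ρ (nmul k n a b) = comm k n (ρ a) (ρ b))
    (hN : ∀ i j n, N i j ≤ n → nmul k n (ρ (x i)) (ρ (x j)) = 0) :
    ∃! F : UEnv k x N →ₗ[k] V, IsConfHom k F ∧ ∀ i, F (gen k x N i) = ρ (x i) := by
  obtain ⟨F₀, ⟨h₀, h₀'⟩, hu⟩ := AssConf.existsUnique_lift hV N (fun i => ρ (x i)) hN
  have key : ∀ u : Mon X, F₀ (u.eval (der k) (comm k) (AssConf.gen k N)) =
      ρ (u.eval (der k) (fun n a b => nmul k n a b) x) := by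
    intro u
    induction u with
    | of i => exact h₀' i
    | d u ih => simp only [Mon.eval]; rw [h₀.map_der, hρ, ih]
    | mul n u v ihu ihv => simp only [Mon.eval]; rw [comm_map h₀, hρ', ihu, ihv]
  have key' : ∀ t : FreeMag k X, F₀ (FreeMag.eval k (der k) (comm k) (AssConf.gen k N) t) =
      ρ (FreeMag.eval k (der k) (fun n a b => nmul k n a b) x t) := by
    intro t
    have : F₀ ∘ₗ (FreeMag.eval k (der k) (comm k) (AssConf.gen k N)) =
        ρ ∘ₗ (FreeMag.eval k (der k) (fun n a b => nmul k n a b) x) := by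
      ext u
      simp [FreeMag.eval, key]
    exact LinearMap.congr_fun this t
  obtain ⟨F, ⟨hF, hF'⟩, huF⟩ := ConfQuot.existsUnique_lift
    {r : AssConf k N | ∃ t : FreeMag k X,
      FreeMag.eval k (der k) (fun n a b => nmul k n a b) x t = 0 ∧
      r = FreeMag.eval k (der k) (comm k) (AssConf.gen k N) t} h₀ (by
      rintro _ ⟨t, ht, rfl⟩
      rw [key', ht, map_zero])
  refine ⟨F, ⟨hF, fun i => (hF' _).trans (h₀' i)⟩, fun G hG => huF G ⟨hG.1, fun v => ?_⟩⟩
  have h := hu (G ∘ₗ ConfQuot.mk _) ⟨⟨fun a => by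
    rw [LinearMap.comp_apply, (ConfQuot.mk_hom _).map_der, hG.1.map_der]; rfl, fun n a b => by
    rw [LinearMap.comp_apply, (ConfQuot.mk_hom _).map_nmul, hG.1.map_nmul]; rfl⟩, hG.2⟩
  exact LinearMap.congr_fun h v

end UEnv

end Free

/-! ### Current and Kac–Moody conformal algebras -/

section Lie

variable {k g : Type*} [Field k] [LieRing g] [LieAlgebra k g]

/-- The bilinear map on `k[∂] ⊗ g` with prescribed values on `(∂^i a, ∂^j b)`. -/
noncomputable def bil {W : Type*} [AddCommGroup W] [Module k W]
    (β : ℕ → ℕ → g →ₗ[k] g →ₗ[k] W) : (ℕ →₀ g) →ₗ[k] (ℕ →₀ g) →ₗ[k] W :=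
  Finsupp.lsum k fun i => (Finsupp.lsum k fun j => (β i j).flip).flip

theorem bil_single {W : Type*} [AddCommGroup W] [Module k W]
    (β : ℕ → ℕ → g →ₗ[k] g →ₗ[k] W) (i j : ℕ) (a b : g) :
    bil β (Finsupp.single i a) (Finsupp.single j b) = β i j a b := by
  simp [bil]

/-- The Lie bracket as a bilinear map. -/
def brk (k g : Type*) [Field k] [LieRing g] [LieAlgebra k g] : g →ₗ[k] g →ₗ[k] g :=
  LinearMap.mk₂ k (fun a b => ⁅a, b⁆) add_lie smul_lie lie_add lie_smul

/-- The current conformal algebra `Cur g = k[∂] ⊗ g`; `Finsupp.single i a` is `∂^i a`. -/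
def Cur (g : Type*) [LieRing g] : Type _ := ℕ →₀ g

namespace Cur

noncomputable instance : AddCommGroup (Cur g) := inferInstanceAs (AddCommGroup (ℕ →₀ g))

noncomputable instance : Module k (Cur g) := inferInstanceAs (Module k (ℕ →₀ g))

/-- The element `∂^i a`. -/
noncomputable def mk (i : ℕ) (a : g) : Cur g := Finsupp.single i a

/-- `∂ (∂^i a) = ∂^(i+1) a`, and the `n`-products are the coefficients at `λ^n / n!` of
`[∂^i a _λ ∂^j b] = (-λ)^i (∂ + λ)^j [a, b]`. -/
noncomputable instance : PreConformal k (Cur g) where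
  D := (Finsupp.lsum k fun i => Finsupp.lsingle (i + 1) : (ℕ →₀ g) →ₗ[k] (ℕ →₀ g))
  mul n := (bil fun i j =>
    if i ≤ n then ((-1 : k) ^ i * (Nat.factorial n : k) * (j.choose (n - i) : k)) •
      (brk k g).compr₂ (Finsupp.lsingle (i + j - n)) else 0 :
      (ℕ →₀ g) →ₗ[k] (ℕ →₀ g) →ₗ[k] (ℕ →₀ g))

theorem der_mk (i : ℕ) (a : g) : der k (mk i a) = mk (i + 1) a := by
  exact Finsupp.lsum_single k (fun i => Finsupp.lsingle (i + 1)) i a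

theorem nmul_mk (n i j : ℕ) (a b : g) : nmul k n (mk i a) (mk j b) =
    if i ≤ n then ((-1 : k) ^ i * (Nat.factorial n : k) * (j.choose (n - i) : k)) •
      mk (i + j - n) ⁅a, b⁆ else 0 := by
  refine (bil_single (W := ℕ →₀ g) _ i j a b).trans ?_
  split_ifs <;> rfl

theorem span_mk :
    Submodule.span k (Set.range fun p : ℕ × g => (mk p.1 p.2 : Cur g)) = ⊤ := by
  rw [eq_top_iff]
  intro a _
  induction a using Finsupp.induction_linear with
  | zero => exact Submodule.zero_mem _
  | add f h hf hh => exact Submodule.add_mem _ (hf trivial) (hh trivial)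
  | single i a => exact Submodule.subset_span ⟨(i, a), rfl⟩

theorem ext_mk {W : Type*} [AddCommGroup W] [Module k W] {f h : Cur g →ₗ[k] Cur g →ₗ[k] W}
    (H : ∀ i a j b, f (mk i a) (mk j b) = h (mk i a) (mk j b)) : f = h := by
  refine LinearMap.ext_on span_mk ?_
  rintro _ ⟨⟨i, a⟩, rfl⟩
  refine LinearMap.ext_on span_mk ?_
  rintro _ ⟨⟨j, b⟩, rfl⟩
  exact H i a j b

noncomputable instance : ConformalAlgebra k (Cur g) where
  D_mul n a b := by
    have : (nmul k n : Cur g →ₗ[k] Cur g →ₗ[k] Cur g) ∘ₗ der k =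
        -((n : k) • nmul k (n - 1)) := by
      refine ext_mk fun i a j b => ?_
      simp only [LinearMap.comp_apply, LinearMap.neg_apply, LinearMap.smul_apply]
      rw [der_mk, nmul_mk, nmul_mk]
      rcases n with _ | n
      · simp
      · by_cases h : i ≤ n
        · simp only [Nat.succ_le_succ_iff, h, if_true, Nat.add_sub_cancel, Nat.factorial_succ,
            Nat.add_sub_add_right, smul_smul, ← neg_smul]
          congr 1
          · push_cast; ring
          · congr 1; omega
        · simp [h]
    exact LinearMap.congr_fun (LinearMap.congr_fun this a) b
  mul_D n a b := by
    have : (nmul k n : Cur g →ₗ[k] Cur g →ₗ[k] Cur g).compl₂ (der k) =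
        (nmul k n).compr₂ (der k) + (n : k) • nmul k (n - 1) := by
      refine ext_mk fun i a j b => ?_
      simp only [LinearMap.compl₂_apply, LinearMap.compr₂_apply, LinearMap.add_apply,
        LinearMap.smul_apply]
      rw [der_mk, nmul_mk, nmul_mk, nmul_mk]
      rcases n with _ | n
      · rcases i with _ | i
        · simp [der_mk]
        · simp
      · by_cases h : i ≤ n
        · have e1 : n + 1 - i = n - i + 1 := by omega
          have e2 : i + (j + 1) - (n + 1) = i + j - n := by omega
          rw [if_pos (by omega), if_pos (by omega), if_pos (by omega), map_smul, der_mk, e1, e2,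
            Nat.choose_succ_succ, Nat.factorial_succ, Nat.add_sub_cancel]
          by_cases h' : n + 1 ≤ i + j
          · have e3 : i + j - (n + 1) + 1 = i + j - n := by omega
            rw [e3, smul_smul, ← add_smul]
            congr 1
            push_cast
            ring
          · rw [Nat.choose_eq_zero_of_lt (show j < n - i + 1 by omega)]
            simp only [Nat.cast_zero, mul_zero, zero_smul, zero_add, smul_smul, add_zero]
            congr 1
            push_cast
            ring
        · by_cases h' : i = n + 1
          · subst h'
            have e3 : n + 1 + (j + 1) - (n + 1) = n + 1 + j - (n + 1) + 1 := by omega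
            simp [der_mk, e3]
          · rw [if_neg (by omega), if_neg (by omega), if_neg (by omega)]
            simp
    exact LinearMap.congr_fun (LinearMap.congr_fun this a) b
  locality := local_of_span _ span_mk span_mk (by
    rintro _ ⟨⟨i, a⟩, rfl⟩ _ ⟨⟨j, b⟩, rfl⟩
    refine ⟨i + j + 1, fun n hn => (nmul_mk n i j a b).trans ?_⟩
    rw [Nat.choose_eq_zero_of_lt (by omega)]
    simp)

end Cur

/-- The Kac–Moody conformal algebra `K(g) = (k[∂] ⊗ g) ⊕ k e` of a Lie algebra `g` with
bilinear form `B`. -/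
def KM (_B : LinearMap.BilinForm k g) : Type _ := Cur g × k

namespace KM

variable (B : LinearMap.BilinForm k g)

noncomputable instance : AddCommGroup (KM B) := inferInstanceAs (AddCommGroup (Cur g × k))

noncomputable instance : Module k (KM B) := inferInstanceAs (Module k (Cur g × k))

/-- The coefficient of `e` in the `n`-product on `K(g)`: the coefficient at `λ^n / n!` of
`(-λ)^i (∂ + λ)^j λ ⟨a|b⟩ e`, where `∂ e = 0`. -/
noncomputable def form (n : ℕ) : Cur g →ₗ[k] Cur g →ₗ[k] k :=
  (bil fun i j => if n = i + j + 1 then ((-1 : k) ^ i * (Nat.factorial n : k)) • B else 0 :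
    (ℕ →₀ g) →ₗ[k] (ℕ →₀ g) →ₗ[k] k)

theorem form_mk (n i j : ℕ) (a b : g) : form B n (Cur.mk i a) (Cur.mk j b) =
    if n = i + j + 1 then (-1 : k) ^ i * (Nat.factorial n : k) * B a b else 0 := by
  refine (bil_single _ i j a b).trans ?_
  split_ifs <;> simp

/-- `∂ e = 0`, `[a _λ b] = [a, b] + λ ⟨a|b⟩ e`, `[a _λ e] = [e _λ e] = 0` for `a, b ∈ g`. -/
noncomputable instance : PreConformal k (KM B) where
  D := ((der k).prodMap 0 : Cur g × k →ₗ[k] Cur g × k)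
  mul n := (LinearMap.mk₂ k (fun p q => (nmul k n p.1 q.1, form B n p.1 q.1))
    (fun _ _ _ => by ext <;> simp) (fun _ _ _ => by ext <;> simp)
    (fun _ _ _ => by ext <;> simp) (fun _ _ _ => by ext <;> simp) :
    Cur g × k →ₗ[k] Cur g × k →ₗ[k] Cur g × k)

noncomputable instance : ConformalAlgebra k (KM B) where
  D_mul n p q := by
    refine Prod.ext (ConformalAlgebra.D_mul n p.1 q.1) ?_
    have : form B n ∘ₗ der k = -((n : k) • form B (n - 1)) := by
      refine Cur.ext_mk fun i a j b => ?_
      simp only [LinearMap.comp_apply, LinearMap.neg_apply, LinearMap.smul_apply]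
      rw [Cur.der_mk, form_mk, form_mk]
      rcases n with _ | n
      · simp
      · by_cases h : n = i + j + 1
        · subst h
          rw [if_pos (by omega), if_pos (by omega), Nat.factorial_succ, smul_eq_mul]
          push_cast [Nat.add_sub_cancel]
          ring
        · rw [if_neg (by omega), if_neg (by omega), smul_zero, neg_zero]
    exact LinearMap.congr_fun (LinearMap.congr_fun this p.1) q.1
  mul_D n p q := by
    refine Prod.ext (ConformalAlgebra.mul_D n p.1 q.1) ?_
    have : (form B n).compl₂ (der k) = (n : k) • form B (n - 1) := by
      refine Cur.ext_mk fun i a j b => ?_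
      simp only [LinearMap.compl₂_apply, LinearMap.smul_apply]
      rw [Cur.der_mk, form_mk, form_mk]
      rcases n with _ | n
      · simp
      · by_cases h : n = i + j + 1
        · subst h
          rw [if_pos (by omega), if_pos (by omega), Nat.factorial_succ, smul_eq_mul]
          push_cast [Nat.add_sub_cancel]
          ring
        · rw [if_neg (by omega), if_neg (by omega), smul_zero]
    exact (LinearMap.congr_fun (LinearMap.congr_fun this p.1) q.1).trans (zero_add _).symm
  locality p q := by
    obtain ⟨N, hN⟩ := ConformalAlgebra.locality (k := k) p.1 q.1
    obtain ⟨M, hM⟩ := local_of_span (form B) Cur.span_mk Cur.span_mk (by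
      rintro _ ⟨⟨i, a⟩, rfl⟩ _ ⟨⟨j, b⟩, rfl⟩
      refine ⟨i + j + 2, fun n hn => (form_mk B n i j a b).trans ?_⟩
      rw [if_neg (by omega)]) p.1 q.1
    exact ⟨max N M, fun n hn => Prod.ext (hN n (le_trans (le_max_left _ _) hn))
      (hM n (le_trans (le_max_right _ _) hn))⟩

/-- The generators `X = X_1 ∪ {e}` of `K(g)`, for a linear basis `X_1` of `g`; the letter `none`
stands for `e`. -/
noncomputable def genFamily {ι : Type*} (b : Module.Basis ι k g) : Option ι → KM B
  | some i => ((Cur.mk 0 (b i), 0) : Cur g × k)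
  | none => ((0, 1) : Cur g × k)

end KM

end Lie

/-! ### The filtration by degree and the associated graded conformal algebra -/

section Graded

variable (k : Type*) {X V : Type*} [Field k] [AddCommGroup V] [Module k V]

/-- The value of a monomial in a conformal algebra. -/
def monVal [PreConformal k V] (x : X → V) (u : Mon X) : V :=
  u.eval (der k) (fun n a b => nmul k n a b) x

/-- `F_n`: the span of all monomials of degree at most `n` in the generators `x`. -/
def filLE [PreConformal k V] (x : X → V) (n : ℕ) : Submodule k V :=
  Submodule.span k {v | ∃ u : Mon X, u.deg ≤ n ∧ v = monVal k x u}

/-- `F_{n-1}`: the span of all monomials of degree less than `n` in the generators `x`. -/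
def filLT [PreConformal k V] (x : X → V) (n : ℕ) : Submodule k V :=
  Submodule.span k {v | ∃ u : Mon X, u.deg < n ∧ v = monVal k x u}

variable {k}

theorem der_span [PreConformal k V] (x : X → V) (P : ℕ → Prop) (a : V)
    (ha : a ∈ Submodule.span k {v | ∃ u : Mon X, P u.deg ∧ v = monVal k x u}) :
    der k a ∈ Submodule.span k {v | ∃ u : Mon X, P u.deg ∧ v = monVal k x u} := by
  induction ha using Submodule.span_induction with
  | mem a h =>
    obtain ⟨u, hu, rfl⟩ := h
    exact Submodule.subset_span ⟨.d u, hu, rfl⟩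
  | zero => simp
  | add a b _ _ ha hb => rw [map_add]; exact Submodule.add_mem _ ha hb
  | smul c a _ ha => rw [map_smul]; exact Submodule.smul_mem _ _ ha

theorem nmul_span [PreConformal k V] (x : X → V) (P Q R : ℕ → Prop)
    (h : ∀ m n, P m → Q n → R (m + n)) (j : ℕ) (a b : V)
    (ha : a ∈ Submodule.span k {v | ∃ u : Mon X, P u.deg ∧ v = monVal k x u})
    (hb : b ∈ Submodule.span k {v | ∃ u : Mon X, Q u.deg ∧ v = monVal k x u}) :
    nmul k j a b ∈ Submodule.span k {v | ∃ u : Mon X, R u.deg ∧ v = monVal k x u} := by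
  induction ha, hb using Submodule.span_induction₂ with
  | mem_mem a b ha hb =>
    obtain ⟨u, hu, rfl⟩ := ha
    obtain ⟨v, hv, rfl⟩ := hb
    exact Submodule.subset_span ⟨.mul j u v, h _ _ hu hv, rfl⟩
  | zero_left => simp
  | zero_right => simp
  | add_left a b c _ _ _ h₁ h₂ =>
    rw [map_add, LinearMap.add_apply]; exact Submodule.add_mem _ h₁ h₂
  | add_right a b c _ _ _ h₁ h₂ => rw [map_add]; exact Submodule.add_mem _ h₁ h₂
  | smul_left c a b _ _ h =>
    rw [map_smul, LinearMap.smul_apply]; exact Submodule.smul_mem _ _ h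
  | smul_right c a b _ _ h => rw [map_smul]; exact Submodule.smul_mem _ _ h

variable (k)

/-- The component `F_n / F_{n-1}`. -/
abbrev GrPiece [PreConformal k V] (x : X → V) (n : ℕ) : Type _ :=
  ↥(filLE k x n) ⧸ (filLT k x n).submoduleOf (filLE k x n)

/-- The class in `F_n / F_{n-1}`. -/
def grMk [PreConformal k V] (x : X → V) (n : ℕ) : ↥(filLE k x n) →ₗ[k] GrPiece k x n :=
  ((filLT k x n).submoduleOf (filLE k x n)).mkQ

/-- `∂` on `F_n / F_{n-1}`. -/
def grDer [PreConformal k V] (x : X → V) (n : ℕ) : GrPiece k x n →ₗ[k] GrPiece k x n :=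
  Submodule.mapQ _ _ ((der k).restrict fun a ha => der_span x (· ≤ n) a ha)
    fun a ha => der_span x (· < n) a.1 ha

/-- The `j`-product `F_m × F_n → F_{m+n} / F_{m+n-1}`. -/
def grMulAux [PreConformal k V] (x : X → V) (j m n : ℕ) :
    ↥(filLE k x m) →ₗ[k] ↥(filLE k x n) →ₗ[k] GrPiece k x (m + n) :=
  LinearMap.mk₂ k
    (fun a b => grMk k x (m + n) ⟨nmul k j a.1 b.1, nmul_span x (· ≤ m) (· ≤ n) (· ≤ m + n)
      (fun _ _ h₁ h₂ => add_le_add h₁ h₂) j a.1 b.1 a.2 b.2⟩)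
    (fun a a' b => by rw [← map_add]; congr 1; ext; simp)
    (fun c a b => by rw [← map_smul]; congr 1; ext; simp)
    (fun a b b' => by rw [← map_add]; congr 1; ext; simp)
    (fun c a b => by rw [← map_smul]; congr 1; ext; simp)

theorem grMulAux_eq_zero [PreConformal k V] (x : X → V) (j m n : ℕ) (a : filLE k x m)
    (b : filLE k x n) (h : nmul k j a.1 b.1 ∈ filLT k x (m + n)) :
    grMulAux k x j m n a b = 0 :=
  (Submodule.Quotient.mk_eq_zero _).2 h

/-- The `j`-product `F_m / F_{m-1} × F_n / F_{n-1} → F_{m+n} / F_{m+n-1}`. -/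
def grMul [PreConformal k V] (x : X → V) (j m n : ℕ) :
    GrPiece k x m →ₗ[k] GrPiece k x n →ₗ[k] GrPiece k x (m + n) :=
  quotBil (grMulAux k x j m n) _ _
    (fun a ha b => grMulAux_eq_zero k x j m n a b <|
      nmul_span x (· < m) (· ≤ n) (· < m + n)
        (fun _ _ h₁ h₂ => add_lt_add_of_lt_of_le h₁ h₂) j a.1 b.1 ha b.2)
    (fun a b hb => grMulAux_eq_zero k x j m n a b <|
      nmul_span x (· ≤ m) (· < n) (· < m + n)
        (fun _ _ h₁ h₂ => add_lt_add_of_le_of_lt h₁ h₂) j a.1 b.1 a.2 hb)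

/-- The associated graded space `⨁_n F_n / F_{n-1}` of the filtration by degree in the
generators `x`. -/
def Gr [PreConformal k V] (x : X → V) : Type _ := ⨁ n : ℕ, GrPiece k x n

noncomputable instance [PreConformal k V] (x : X → V) : AddCommGroup (Gr k x) :=
  inferInstanceAs (AddCommGroup (⨁ n : ℕ, GrPiece k x n))

noncomputable instance [PreConformal k V] (x : X → V) : Module k (Gr k x) :=
  inferInstanceAs (Module k (⨁ n : ℕ, GrPiece k x n))

/-- The inclusion of the component `F_n / F_{n-1}`. -/
noncomputable def Gr.incl [PreConformal k V] (x : X → V) (n : ℕ) :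
    GrPiece k x n →ₗ[k] Gr k x :=
  (DirectSum.lof k ℕ (GrPiece k x) n : GrPiece k x n →ₗ[k] ⨁ n : ℕ, GrPiece k x n)

/-- The linear map with given restrictions to the components. -/
noncomputable def Gr.lift [PreConformal k V] (x : X → V) {W : Type*} [AddCommGroup W]
    [Module k W] (f : ∀ n, GrPiece k x n →ₗ[k] W) : Gr k x →ₗ[k] W :=
  (DirectSum.toModule k ℕ W f : (⨁ n : ℕ, GrPiece k x n) →ₗ[k] W)

theorem Gr.lift_incl [PreConformal k V] (x : X → V) {W : Type*} [AddCommGroup W]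
    [Module k W] (f : ∀ n, GrPiece k x n →ₗ[k] W) (n : ℕ) (a : GrPiece k x n) :
    Gr.lift k x f (Gr.incl k x n a) = f n a :=
  DirectSum.toModule_lof k n a

noncomputable instance [PreConformal k V] (x : X → V) : PreConformal k (Gr k x) where
  D := Gr.lift k x fun n => Gr.incl k x n ∘ₗ grDer k x n
  mul j := Gr.lift k x fun m =>
    (Gr.lift k x fun n => ((grMul k x j m n).compr₂ (Gr.incl k x (m + n))).flip).flip

/-- The class of `a ∈ F_n`, as a homogeneous element of the associated graded space. -/
noncomputable def Gr.cls [PreConformal k V] (x : X → V) (n : ℕ) (a : filLE k x n) : Gr k x :=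
  Gr.incl k x n (grMk k x n a)

/-- The class of a generator in `F_1 / F_0`. -/
noncomputable def Gr.gen [PreConformal k V] (x : X → V) (i : X) : Gr k x :=
  Gr.cls k x 1 ⟨x i, Submodule.subset_span ⟨.of i, le_rfl, rfl⟩⟩

variable {k}

theorem Gr.der_cls [PreConformal k V] (x : X → V) (n : ℕ) (a : filLE k x n) :
    der k (Gr.cls k x n a) = Gr.cls k x n ⟨der k a.1, der_span x (· ≤ n) a.1 a.2⟩ :=
  Gr.lift_incl k x _ n _

theorem Gr.nmul_cls [PreConformal k V] (x : X → V) (j m n : ℕ) (a : filLE k x m)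
    (b : filLE k x n) : nmul k j (Gr.cls k x m a) (Gr.cls k x n b) =
      Gr.cls k x (m + n) ⟨nmul k j a.1 b.1, nmul_span x (· ≤ m) (· ≤ n) (· ≤ m + n)
        (fun _ _ h₁ h₂ => add_le_add h₁ h₂) j a.1 b.1 a.2 b.2⟩ := by
  refine (LinearMap.congr_fun (Gr.lift_incl k x _ m _) _).trans ?_
  rw [LinearMap.flip_apply]
  refine (LinearMap.congr_fun (Gr.lift_incl k x _ n _) _).trans ?_
  rfl

theorem Gr.span_cls [PreConformal k V] (x : X → V) : Submodule.span k
    (Set.range fun p : Σ n, filLE k x n => Gr.cls k x p.1 p.2) = ⊤ := by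
  rw [eq_top_iff]
  intro a _
  induction a using DirectSum.induction_on with
  | zero => exact Submodule.zero_mem _
  | of n a =>
    obtain ⟨a, rfl⟩ := Submodule.mkQ_surjective _ a
    exact Submodule.subset_span ⟨⟨n, a⟩, rfl⟩
  | add a b ha hb => exact Submodule.add_mem _ (ha trivial) (hb trivial)

theorem Gr.ext_cls [PreConformal k V] (x : X → V) {W : Type*} [AddCommGroup W] [Module k W]
    {f h : Gr k x →ₗ[k] Gr k x →ₗ[k] W}
    (H : ∀ m n (a : filLE k x m) (b : filLE k x n),
      f (Gr.cls k x m a) (Gr.cls k x n b) = h (Gr.cls k x m a) (Gr.cls k x n b)) : f = h := by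
  refine LinearMap.ext_on (Gr.span_cls x) ?_
  rintro _ ⟨⟨m, a⟩, rfl⟩
  refine LinearMap.ext_on (Gr.span_cls x) ?_
  rintro _ ⟨⟨n, b⟩, rfl⟩
  exact H m n a b

noncomputable instance [ConformalAlgebra k V] (x : X → V) : ConformalAlgebra k (Gr k x) where
  D_mul j a b := by
    have : (nmul k j : Gr k x →ₗ[k] Gr k x →ₗ[k] Gr k x) ∘ₗ der k =
        -((j : k) • nmul k (j - 1)) := by
      refine Gr.ext_cls x fun m n a b => ?_
      simp only [LinearMap.comp_apply, LinearMap.neg_apply, LinearMap.smul_apply]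
      rw [Gr.der_cls, Gr.nmul_cls, Gr.nmul_cls]
      simp only [Gr.cls, ← map_smul, ← map_neg]
      congr 2
      exact Subtype.ext (ConformalAlgebra.D_mul j a.1 b.1)
    exact LinearMap.congr_fun (LinearMap.congr_fun this a) b
  mul_D j a b := by
    have : (nmul k j : Gr k x →ₗ[k] Gr k x →ₗ[k] Gr k x).compl₂ (der k) =
        (nmul k j).compr₂ (der k) + (j : k) • nmul k (j - 1) := by
      refine Gr.ext_cls x fun m n a b => ?_
      simp only [LinearMap.compl₂_apply, LinearMap.compr₂_apply, LinearMap.add_apply,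
        LinearMap.smul_apply]
      rw [Gr.der_cls, Gr.nmul_cls, Gr.nmul_cls, Gr.nmul_cls, Gr.der_cls]
      simp only [Gr.cls, ← map_smul, ← map_add]
      congr 2
      exact Subtype.ext (ConformalAlgebra.mul_D j a.1 b.1)
    exact LinearMap.congr_fun (LinearMap.congr_fun this a) b
  locality := local_of_span _ (Gr.span_cls x) (Gr.span_cls x) (by
    rintro _ ⟨⟨m, a⟩, rfl⟩ _ ⟨⟨n, b⟩, rfl⟩
    obtain ⟨N, hN⟩ := ConformalAlgebra.locality (k := k) a.1 b.1
    refine ⟨N, fun j hj => (Gr.nmul_cls x j m n a b).trans ?_⟩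
    have h : (⟨nmul k j a.1 b.1, nmul_span x (· ≤ m) (· ≤ n) (· ≤ m + n)
        (fun _ _ h₁ h₂ => add_le_add h₁ h₂) j a.1 b.1 a.2 b.2⟩ : filLE k x (m + n)) = 0 :=
      Subtype.ext (hN j hj)
    rw [h, Gr.cls, map_zero, map_zero])

end Graded

/-! ### Basic monomials -/

/-- `L_0^{x_1} ⋯ L_0^{x_n} v` for the word `x_1 … x_n`. -/
noncomputable def L0word {k Y : Type*} [Field k] (N : Y → Y → ℕ) (w : List Y) (v : ComConf k N) :
    ComConf k N :=
  w.foldr (fun x v => nmul k 0 (ComConf.gen k N x) v) v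

/-- Data `(x_1 … x_n, s, z)` with `x_1 ≤ … ≤ x_n`. -/
abbrev Index₁ (Y : Type*) [LinearOrder Y] : Type _ :=
  {p : List Y × ℕ × Y // p.1.Pairwise (· ≤ ·)}

/-- Data `(x_1 … x_n, y, z)` with `x_1 ≤ … ≤ x_n ≤ z` and `y < z`. -/
abbrev Index₂ (Y : Type*) [LinearOrder Y] : Type _ :=
  {p : List Y × Y × Y // p.1.Pairwise (· ≤ ·) ∧ (∀ x ∈ p.1, x ≤ p.2.2) ∧ p.2.1 < p.2.2}

/-- The monomials `L_0^{x_1} ⋯ L_0^{x_n} ∂^s z` and `L_0^{x_1} ⋯ L_0^{x_n} L_1^y z`. -/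
noncomputable def basicMonomial (k : Type*) {Y : Type*} [Field k] [LinearOrder Y]
    (N : Y → Y → ℕ) : Index₁ Y ⊕ Index₂ Y → ComConf k N
  | .inl p => L0word N p.1.1 ((der k)^[p.1.2.1] (ComConf.gen k N p.1.2.2))
  | .inr p => L0word N p.1.1 (nmul k 1 (ComConf.gen k N p.1.2.1) (ComConf.gen k N p.1.2.2))

end ConformalAlg

/-! Commutativity of gr U. In an envelope U the commutator of two generators is the image of their
bracket in L. For the generators used here the bracket lies in the span of the generators, so it has
degree at most one and its class in degree two is zero. Hence gr U is generated by the classes of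
the generators, is associative, has locality 2 on them, and is commutative by
`isComm_of_generators`. By the universal property, ComConf maps to gr U (`Gr.exists_comHom`).
Everything then reduces to two facts: the basic monomials span ComConf
(`ComConf.span_basicMonomial`), and their images in gr U are linearly independent
(`Gr.linearIndependent_basicMon`). A linear map that sends a spanning family to an independent one
is injective, and the family itself is then independent. Applied to the abelian Lie algebra with
basis Y, this gives the basis in (1).

Spanning. Left multiplications by generators commute (`Commuting.left_comm`), triple products
i(1)(j(1)l) vanish, and the exchange relation `nmul_zero_nmul_one` moves the largest letter of
L_0…L_0 L_1^y z into the last position.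

Independence. It is proved with linear functionals on U = U(K(g); X, 2). The modes x(m) of the
generators should generate the enveloping algebra of the affine Lie algebra modulo all products of e
with another letter and modulo the locality relations x(m)y(n) − 2x(m−1)y(n+1) + x(m−2)y(n+2) = 0.
The proof works with the dual object `affSpace`: functions on words in the letters x(m) and e that
respect these relations. Letters act on such functions by appending, the resulting formal
distributions satisfy the relations of K(g), and so U maps to formal distributions with operator
coefficients (`exists_fieldHom`). Taking the coefficient −1, applying it to a function f and
evaluating at the empty word is a functional on U (`exists_functional`).

Enough functions exist. A Poincaré–Birkhoff–Witt argument (`pbwFun_rel`) extends any function on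
sorted words so that it satisfies the Lie relations. Locality says that values form an arithmetic
progression when modes move along a line with constant sum; this condition survives reordering, so
it need only be imposed on sorted words (`exists_affSpace`). On words of length N one prescribes a
symbol that is symmetric in the letters and linear in the modes, with value zero on shorter words
(`exists_symbol`). The symbols of distinct basic monomials are separated by suitable coordinates
(`linearIndependent_basicSymbol`). A further function detects e (`exists_central`), which gives the
extra summand ke. For Cur g the functionals are pulled back from K(g) with the zero form. -/

namespace ConformalAlg

/-! ### A Poincaré–Birkhoff–Witt theorem for functions on words -/

section PBW

/-- The number of inversions of a word with respect to the keys of its letters. -/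
def inversions {E I : Type*} [LinearOrder I] (key : E → I) : List E → ℕ
  | [] => 0
  | a :: l => l.countP (fun b => key b < key a) + inversions key l

/-- Letters before the pair see the same multiset to their right, so only the pair itself changes
the count. This is the termination measure for sorting. -/
theorem inversions_swap {E I : Type*} [LinearOrder I] (key : E → I) (u v : List E) {a b : E}
    (h : key b < key a) :
    inversions key (u ++ b :: a :: v) < inversions key (u ++ a :: b :: v) := by
  induction u with
  | nil =>
    simp only [List.nil_append, inversions, List.countP_cons, h, not_lt.2 h.le, decide_true,
      decide_false, if_true, Bool.false_eq_true, if_false]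
    omega
  | cons c u ih =>
    have : (u ++ b :: a :: v).countP (fun d => key d < key c) =
        (u ++ a :: b :: v).countP (fun d => key d < key c) :=
      List.Perm.countP_eq _ (List.Perm.append_left u (List.Perm.swap a b v))
    simp only [List.cons_append, inversions, this]
    omega

theorem exists_descent {E I : Type*} [LinearOrder I] (key : E → I) (l : List E)
    (h : ¬ l.Pairwise fun a b => key a ≤ key b) :
    ∃ u a b v, l = u ++ a :: b :: v ∧ key b < key a := by
  induction l with
  | nil => simp at h
  | cons a l ih =>
    by_cases hl : l.Pairwise fun a b => key a ≤ key b
    · cases l with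
      | nil => simp at h
      | cons b v =>
        refine ⟨[], a, b, v, rfl, ?_⟩
        by_contra hab
        rw [not_lt] at hab
        refine h (List.pairwise_cons.2 ⟨fun c hc => ?_, hl⟩)
        rcases List.mem_cons.1 hc with rfl | hc
        · exact hab
        · exact hab.trans ((List.pairwise_cons.1 hl).1 c hc)
    · obtain ⟨u, a', b', v, rfl, h'⟩ := ih hl
      exact ⟨a :: u, a', b', v, rfl, h'⟩

/-- Induction on the length of a word and on its number of inversions. -/
theorem descent_induction {E I : Type*} [LinearOrder I] (key : E → I) {P : List E → Prop}
    (hs : ∀ l : List E, (l.Pairwise fun a b => key a ≤ key b) → P l)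
    (hd : ∀ u a b v, key b < key a → (∀ l : List E, l.length < u.length + v.length + 2 → P l) →
      P (u ++ b :: a :: v) → P (u ++ a :: b :: v)) (l : List E) : P l := by
  suffices H : ∀ n m, ∀ l : List E, l.length = n → inversions key l = m → P l from H _ _ l rfl rfl
  intro n
  induction n using Nat.strong_induction_on with
  | _ n ihn =>
  intro m
  induction m using Nat.strong_induction_on with
  | _ m ihm =>
  intro l hn hm
  by_cases hl : l.Pairwise fun a b => key a ≤ key b
  · exact hs l hl
  · obtain ⟨u, a, b, v, rfl, hab⟩ := exists_descent key l hl
    simp only [List.length_append, List.length_cons] at hn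
    refine hd u a b v hab (fun l hl => ihn _ (by omega) _ l rfl rfl) ?_
    exact ihm _ (hm ▸ inversions_swap key u v hab) _ (by simp; omega) rfl

variable {k I W : Type*} [Field k] [AddCommGroup W] [Module k W]

/-- The linear extension of a function on words to vectors in one of the slots. -/
noncomputable def slot (f : List I → W) (u v : List I) : (I →₀ k) →ₗ[k] W :=
  Finsupp.linearCombination k fun a => f (u ++ a :: v)

theorem slot_single (f : List I → W) (u v : List I) (a : I) (c : k) :
    slot f u v (Finsupp.single a c) = c • f (u ++ a :: v) :=
  Finsupp.linearCombination_single k c a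

/-- Linear substitutions in two different slots may be carried out in either order. This settles the
case of two disjoint descents in `pbwFun_rel`. -/
theorem slot_comm (f : List I → W) (u m v : List I) (x y : I →₀ k) :
    Finsupp.linearCombination k (fun a => slot f u (m ++ a :: v) x) y =
      Finsupp.linearCombination k (fun a => slot f (u ++ a :: m) v y) x := by
  simp only [slot, Finsupp.linearCombination_apply, Finsupp.smul_sum]
  rw [Finsupp.sum_comm]
  refine Finsupp.sum_congr fun a _ => Finsupp.sum_congr fun b _ => ?_
  rw [smul_comm]
  simp

/-- If a relation holds for basis vectors, it holds for a vector in the first slot. -/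
theorem slot_rel_left {f : List I → W} {br : I → I → (I →₀ k)} {u v : List I} {j : I}
    (h : ∀ i, f (u ++ i :: j :: v) - f (u ++ j :: i :: v) = slot f u v (br i j)) (x : I →₀ k) :
    slot f u (j :: v) x - slot f (u ++ [j]) v x =
      slot f u v (Finsupp.linearCombination k (fun i => br i j) x) := by
  induction x using Finsupp.induction_linear with
  | zero => simp
  | add x y hx hy => rw [map_add, map_add, map_add, map_add, ← hx, ← hy]; abel
  | single i c =>
    rw [slot_single, slot_single, Finsupp.linearCombination_single, map_smul, ← h i, smul_sub]
    simp

variable [LinearOrder I]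

open Classical in
/-- The function on words with values `s` on sorted words that satisfies the relations of the
universal enveloping algebra with structure constants `br`. -/
noncomputable def pbwFun (br : I → I → (I →₀ k)) (s : List I → W) (w : List I) : W :=
  if h : ∃ p : List I × I × I × List I, w = p.1 ++ p.2.1 :: p.2.2.1 :: p.2.2.2 ∧
      p.2.2.1 < p.2.1 then
    pbwFun br s (h.choose.1 ++ h.choose.2.2.1 :: h.choose.2.1 :: h.choose.2.2.2) +
      (br h.choose.2.1 h.choose.2.2.1).sum fun a c =>
        c • pbwFun br s (h.choose.1 ++ a :: h.choose.2.2.2)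
  else s w
termination_by (w.length, inversions id w)
decreasing_by
  · have h1 := h.choose_spec.1
    have h2 := inversions_swap (id : I → I) h.choose.1 h.choose.2.2.2 h.choose_spec.2
    rw [← h1] at h2
    have h3 := congrArg List.length h1
    simp only [List.length_append, List.length_cons] at h3
    rw [Prod.lex_def]
    right
    refine ⟨?_, h2⟩
    simp only [List.length_append, List.length_cons]
    exact h3.symm
  · have h3 := congrArg List.length h.choose_spec.1
    simp only [List.length_append, List.length_cons] at h3
    rw [Prod.lex_def]
    left
    simp only [List.length_append, List.length_cons]
    omega

theorem pbwFun_sorted (br : I → I → (I →₀ k)) (s : List I → W) (w : List I)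
    (h : w.Pairwise (· ≤ ·)) : pbwFun br s w = s w := by
  rw [pbwFun, dif_neg]
  rintro ⟨⟨u, i, j, v⟩, rfl, h2⟩
  rw [List.pairwise_append, List.pairwise_cons] at h
  exact absurd (h.2.1.1 j (by simp)) (not_le.2 h2)

/-- The recursion reduces one descent picked by choice. Only its existence is exposed; independence
of the choice is the content of `pbwFun_rel`. -/
theorem pbwFun_descent (br : I → I → (I →₀ k)) (s : List I → W) (w : List I)
    (h : ∃ u i j v, w = u ++ i :: j :: v ∧ j < i) : ∃ u i j v, w = u ++ i :: j :: v ∧ j < i ∧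
      pbwFun br s w = pbwFun br s (u ++ j :: i :: v) + slot (pbwFun br s) u v (br i j) := by
  have h' : ∃ p : List I × I × I × List I, w = p.1 ++ p.2.1 :: p.2.2.1 :: p.2.2.2 ∧
      p.2.2.1 < p.2.1 := by
    obtain ⟨u, i, j, v, h⟩ := h
    exact ⟨⟨u, i, j, v⟩, h⟩
  refine ⟨h'.choose.1, h'.choose.2.1, h'.choose.2.2.1, h'.choose.2.2.2, h'.choose_spec.1,
    h'.choose_spec.2, ?_⟩
  rw [pbwFun, dif_pos h']
  rfl

/-- This is the diamond lemma for the rewriting rule ij → ji + [i, j]. By induction on length and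
inversions, reducing a word at an arbitrary descent gives the same value as reducing it at the
chosen one. Disjoint descents are handled by commuting the two reductions, overlapping ones by the
Jacobi identity. -/
theorem pbwFun_rel (br : I → I → (I →₀ k)) (s : List I → W) (hself : ∀ i, br i i = 0)
    (hskew : ∀ i j, br i j = -br j i)
    (hjac : ∀ i j l, Finsupp.linearCombination k (fun a => br a l) (br i j) +
      Finsupp.linearCombination k (fun a => br a i) (br j l) +
      Finsupp.linearCombination k (fun a => br a j) (br l i) = 0) (u : List I) (i j : I)
    (v : List I) :
    pbwFun br s (u ++ i :: j :: v) - pbwFun br s (u ++ j :: i :: v) =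
      slot (pbwFun br s) u v (br i j) := by
  set f := pbwFun br s with hf
  -- It suffices to treat descents: equal letters have zero bracket, and ascents follow by
  -- skew-symmetry.
  have full : ∀ n, (∀ u i j v, u.length + v.length + 2 = n → j < i →
      f (u ++ i :: j :: v) - f (u ++ j :: i :: v) = slot f u v (br i j)) →
      ∀ u i j v, u.length + v.length + 2 = n →
      f (u ++ i :: j :: v) - f (u ++ j :: i :: v) = slot f u v (br i j) := by
    intro n h u i j v hn
    rcases lt_trichotomy j i with hij | rfl | hij
    · exact h u i j v hn hij
    · rw [hself, sub_self, map_zero]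
    · rw [hskew, map_neg, ← h u j i v hn hij, neg_sub]
  suffices H : ∀ n m, ∀ u i j v, u.length + v.length + 2 = n →
      inversions id (u ++ i :: j :: v) = m → j < i →
      f (u ++ i :: j :: v) - f (u ++ j :: i :: v) = slot f u v (br i j) from
    full _ (fun u i j v hn hij => H _ _ u i j v hn rfl hij) u i j v rfl
  intro n
  induction n using Nat.strong_induction_on with
  | _ n ihn =>
  have ihn' : ∀ u i j v, u.length + v.length + 2 < n →
      f (u ++ i :: j :: v) - f (u ++ j :: i :: v) = slot f u v (br i j) :=
    fun u i j v h => full _ (fun u' i' j' v' hn hij => ihn _ h _ u' i' j' v' hn rfl hij) u i j v rfl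
  intro m
  induction m using Nat.strong_induction_on with
  | _ m ihm =>
  -- Local confluence: the second descent starts `t.length` places to the right of the first one.
  -- All words met on the way have fewer inversions or fewer letters, so both induction hypotheses
  -- are available.
  have diamond : ∀ u i j v t i' j' v', u.length + v.length + 2 = n →
      inversions id (u ++ i :: j :: v) = m → j < i → j' < i' → i :: j :: v = t ++ i' :: j' :: v' →
      f (u ++ j :: i :: v) + slot f u v (br i j) =
        f ((u ++ t) ++ j' :: i' :: v') + slot f (u ++ t) v' (br i' j') := by
    intro u i j v t i' j' v' hn hm hij hij' ht
    match t, ht with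
    | [], ht =>
      simp only [List.nil_append, List.cons.injEq] at ht
      obtain ⟨rfl, rfl, rfl⟩ := ht
      simp
    -- The descents overlap in three decreasing letters. Both reductions are continued until the
    -- three letters are in increasing order; the bracket corrections then differ by the image of
    -- the Jacobi sum.
    | [a], ht =>
      simp only [List.cons_append, List.nil_append, List.cons.injEq] at ht
      obtain ⟨rfl, rfl, rfl⟩ := ht
      rename_i l
      have hlen : u.length + v'.length + 3 = n := by simp at hn; omega
      have e1 := ihm (inversions id ((u ++ [j]) ++ i :: j' :: v')) (by
        rw [← hm]
        simpa using inversions_swap (id : I → I) u (j' :: v') hij)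
        (u ++ [j]) i j' v' (by simp; omega) rfl (hij'.trans hij)
      have e2 := ihm (inversions id (u ++ j :: j' :: i :: v')) (by
        rw [← hm]
        refine lt_trans ?_ (inversions_swap (id : I → I) u (j' :: v') hij)
        simpa using inversions_swap (id : I → I) (u ++ [j]) v' (hij'.trans hij))
        u j j' (i :: v') (by simp; omega) rfl hij'
      have e3 := ihm (inversions id (u ++ i :: j' :: j :: v')) (by
        rw [← hm]
        simpa using inversions_swap (id : I → I) (u ++ [i]) v' hij')
        u i j' (j :: v') (by simp; omega) rfl (hij'.trans hij)
      have e4 := ihm (inversions id ((u ++ [j']) ++ i :: j :: v')) (by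
        rw [← hm]
        refine lt_trans ?_ (inversions_swap (id : I → I) (u ++ [i]) v' hij'
          |>.trans_eq (by simp))
        simpa using inversions_swap (id : I → I) u (j :: v') (hij'.trans hij))
        (u ++ [j']) i j v' (by simp; omega) rfl hij
      have r1 := slot_rel_left (f := f) (br := br) (u := u) (v := v') (j := j')
        (fun a => ihn' u a j' v' (by omega)) (br i j)
      have r2 := slot_rel_left (f := f) (br := br) (u := u) (v := v') (j := i)
        (fun a => ihn' u a i v' (by omega)) (br j j')
      have r3 := slot_rel_left (f := f) (br := br) (u := u) (v := v') (j := j)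
        (fun a => ihn' u a j v' (by omega)) (br j' i)
      have J := congrArg (slot f u v') (hjac i j j')
      rw [map_add, map_add, ← r1, ← r2, ← r3, map_zero, hskew j' i, map_neg, map_neg] at J
      simp only [List.append_assoc, List.cons_append, List.nil_append] at e1 e2 e3 e4 J ⊢
      rw [sub_eq_iff_eq_add] at e1 e2 e3 e4
      rw [e1, e2, e3, e4, ← sub_eq_zero, ← J]
      abel
    -- The descents are disjoint. The corrections of one reduction are themselves corrected by the
    -- other, and the two double corrections agree by `slot_comm`.
    | a :: b :: t, ht =>
      simp only [List.cons_append, List.cons.injEq] at ht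
      obtain ⟨rfl, rfl, rfl⟩ := ht
      have hlen : u.length + t.length + v'.length + 4 = n := by simp at hn; omega
      have e1 := ihm (inversions id ((u ++ j :: i :: t) ++ i' :: j' :: v')) (by
        rw [← hm]
        simpa using inversions_swap (id : I → I) u (t ++ i' :: j' :: v') hij)
        (u ++ j :: i :: t) i' j' v' (by simp; omega) rfl hij'
      have e2 := ihm (inversions id (u ++ i :: j :: (t ++ j' :: i' :: v'))) (by
        rw [← hm]
        simpa using inversions_swap (id : I → I) (u ++ i :: j :: t) v' hij')
        u i j (t ++ j' :: i' :: v') (by simp; omega) rfl hij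
      have r1 : slot f u (t ++ i' :: j' :: v') (br i j) - slot f u (t ++ j' :: i' :: v') (br i j) =
          Finsupp.linearCombination k (fun a => slot f (u ++ a :: t) v' (br i' j')) (br i j) := by
        simp only [slot, Finsupp.linearCombination_apply, ← Finsupp.sum_sub, ← smul_sub]
        refine Finsupp.sum_congr fun a _ => ?_
        have := ihn' (u ++ a :: t) i' j' v' (by simp; omega)
        simp only [List.append_assoc, List.cons_append, slot,
          Finsupp.linearCombination_apply] at this ⊢
        rw [this]
      have r2 : slot f (u ++ i :: j :: t) v' (br i' j') - slot f (u ++ j :: i :: t) v' (br i' j') =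
          Finsupp.linearCombination k (fun a => slot f u (t ++ a :: v') (br i j)) (br i' j') := by
        simp only [slot, Finsupp.linearCombination_apply, ← Finsupp.sum_sub, ← smul_sub]
        refine Finsupp.sum_congr fun a _ => ?_
        have := ihn' u i j (t ++ a :: v') (by simp; omega)
        simp only [List.append_assoc, List.cons_append, slot,
          Finsupp.linearCombination_apply] at this ⊢
        rw [this]
      rw [slot_comm, ← r1] at r2
      simp only [List.append_assoc, List.cons_append] at e1 e2 r2 ⊢
      rw [sub_eq_iff_eq_add] at e1 e2
      rw [e1, e2, ← sub_eq_zero]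
      rw [← sub_eq_zero] at r2
      rw [← neg_eq_zero, ← r2]
      abel
  intro u i j v hn hm hij
  obtain ⟨u', i', j', v', h1, h2, h3⟩ := pbwFun_descent br s (u ++ i :: j :: v) ⟨u, i, j, v, rfl, hij⟩
  rw [← hf] at h3
  rw [sub_eq_iff_eq_add', h3]
  -- The chosen descent starts to the right or to the left of the given one; `diamond` covers both
  -- after exchanging roles.
  rcases List.append_eq_append_iff.1 h1 with ⟨t, rfl, ht⟩ | ⟨t, rfl, ht⟩
  · exact (diamond u i j v t i' j' v' hn hm hij h2 ht).symm
  · have hl := congrArg List.length h1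
    simp only [List.length_append, List.length_cons] at hl hn
    exact diamond u' i' j' v' t i j v (by omega) (by rw [← h1]; exact hm) h2 hij ht

end PBW

/-! ### Words in the affine Lie algebra -/

section Affine

variable {k g ι W : Type*} [Field k] [LieRing g] [LieAlgebra k g] [AddCommGroup W] [Module k W]
  (B : LinearMap.BilinForm k g) (b : Module.Basis ι k g)

/-- The embedding of `g ⊗ t^n` in the affine Lie algebra, which has the basis `some (i, n)`
(standing for `b_i t^n`) together with the central element `none`. -/
noncomputable def modeEmb (n : ℤ) : g →ₗ[k] (Option (ι × ℤ) →₀ k) :=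
  Finsupp.lmapDomain k k (fun z => some (z, n)) ∘ₗ b.repr.toLinearMap

/-- The structure constants of the affine Lie algebra. -/
noncomputable def affBr : Option (ι × ℤ) → Option (ι × ℤ) → (Option (ι × ℤ) →₀ k)
  | some p, some q => modeEmb b (p.2 + q.2) ⁅b p.1, b q.1⁆ +
      Finsupp.single none (if p.2 + q.2 = 0 then (p.2 : k) * B (b p.1) (b q.1) else 0)
  | some _, none => 0
  | none, _ => 0

theorem affBr_none_right (p : Option (ι × ℤ)) : affBr B b p none = 0 := by
  cases p <;> rfl

theorem affBr_none_left (p : Option (ι × ℤ)) : affBr B b none p = 0 := by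
  cases p <;> rfl

theorem slot_modeEmb (f : List (Option (ι × ℤ)) → W) (u v : List (Option (ι × ℤ))) (n : ℤ)
    (x : g) : slot f u v (modeEmb b n x) =
      (b.repr x).sum fun z c => c • f (u ++ some (z, n) :: v) := by
  simp only [slot, modeEmb, LinearMap.comp_apply, Finsupp.lmapDomain_apply,
    Finsupp.linearCombination_mapDomain]
  rfl

theorem lc_affBr (n : ℤ) (x : g) (q : ι × ℤ) :
    Finsupp.linearCombination k (fun a => affBr B b a (some q)) (modeEmb b n x) =
      modeEmb b (n + q.2) ⁅x, b q.1⁆ +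
        Finsupp.single none (if n + q.2 = 0 then (n : k) * B x (b q.1) else 0) := by
  have h : ∀ y : g, Finsupp.linearCombination k (fun a => affBr B b a (some q)) (modeEmb b n y) =
      (modeEmb b (n + q.2) ∘ₗ (brk k g).flip (b q.1) + Finsupp.lsingle none ∘ₗ
        ((if n + q.2 = 0 then (n : k) else 0) • B.flip (b q.1)) :
        g →ₗ[k] (Option (ι × ℤ) →₀ k)) y := by
    intro y
    refine LinearMap.congr_fun (f := Finsupp.linearCombination k (fun a => affBr B b a (some q)) ∘ₗ
      modeEmb b n) ?_ y
    refine b.ext fun i => ?_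
    have : modeEmb b n (b i) = Finsupp.single (some (i, n)) 1 := by
      simp [modeEmb]
    rw [LinearMap.comp_apply, this, Finsupp.linearCombination_single, one_smul]
    simp only [affBr, LinearMap.add_apply, LinearMap.comp_apply, LinearMap.flip_apply, brk,
      LinearMap.mk₂_apply, LinearMap.smul_apply, Finsupp.lsingle_apply, smul_eq_mul, ite_mul,
      zero_mul, LinearMap.BilinForm.flip_apply]
  rw [h x]
  simp only [LinearMap.add_apply, LinearMap.comp_apply, LinearMap.flip_apply, brk,
      LinearMap.mk₂_apply, LinearMap.smul_apply, Finsupp.lsingle_apply, smul_eq_mul, ite_mul,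
      zero_mul, LinearMap.BilinForm.flip_apply]

theorem lc_zero (x : Option (ι × ℤ) →₀ k) :
    Finsupp.linearCombination k (fun _ => (0 : Option (ι × ℤ) →₀ k)) x = 0 := by
  simp [Finsupp.linearCombination_apply]

theorem lc_affBr_affBr (p q r : ι × ℤ) :
    Finsupp.linearCombination k (fun a => affBr B b a (some r)) (affBr B b (some p) (some q)) =
      modeEmb b (p.2 + q.2 + r.2) ⁅⁅b p.1, b q.1⁆, b r.1⁆ + Finsupp.single none
        (if p.2 + q.2 + r.2 = 0 then ((p.2 + q.2 : ℤ) : k) * B ⁅b p.1, b q.1⁆ (b r.1) else 0) := by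
  conv_lhs => rw [affBr]
  rw [map_add, lc_affBr, Finsupp.linearCombination_single]
  simp [affBr]

theorem affBr_self (p : Option (ι × ℤ)) : affBr B b p p = 0 := by
  cases p with
  | none => rfl
  | some p =>
    simp only [affBr, lie_self, map_zero, zero_add, Finsupp.single_eq_zero, ite_eq_right_iff]
    intro h
    have : p.2 = 0 := by omega
    simp [this]

variable {B}

theorem affBr_skew (hB : ∀ x y, B x y = B y x) (p q : Option (ι × ℤ)) :
    affBr B b p q = -affBr B b q p := by
  cases p <;> cases q <;> simp only [affBr, neg_zero]
  rename_i p q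
  rw [neg_add, ← map_neg, lie_skew, add_comm q.2, ← Finsupp.single_neg, hB (b q.1)]
  congr 2
  split_ifs with h
  · have : p.2 = -q.2 := by omega
    rw [this]
    push_cast
    ring
  · simp

/-- The part in the loop algebra is the Jacobi identity of g. By invariance the three central terms
share the factor ⟨[x, y] | z⟩, and their coefficients add up to twice the total mode, which is zero
whenever a central term occurs. -/
theorem affBr_jacobi (hB : ∀ x y, B x y = B y x) (hB' : ∀ x y z, B ⁅x, y⁆ z = B x ⁅y, z⁆)
    (p q r : Option (ι × ℤ)) :
    Finsupp.linearCombination k (fun a => affBr B b a r) (affBr B b p q) +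
      Finsupp.linearCombination k (fun a => affBr B b a p) (affBr B b q r) +
      Finsupp.linearCombination k (fun a => affBr B b a q) (affBr B b r p) = 0 := by
  rcases p with _ | p
  · simp only [affBr_none_left, affBr_none_right, lc_zero, map_zero, add_zero]
  rcases q with _ | q
  · simp only [affBr_none_left, affBr_none_right, lc_zero, map_zero, add_zero]
  rcases r with _ | r
  · simp only [affBr_none_left, affBr_none_right, lc_zero, map_zero, add_zero]
  rw [lc_affBr_affBr, lc_affBr_affBr, lc_affBr_affBr]
  have e1 : q.2 + r.2 + p.2 = p.2 + q.2 + r.2 := by ring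
  have e2 : r.2 + p.2 + q.2 = p.2 + q.2 + r.2 := by ring
  rw [e1, e2]
  have t1 : B ⁅b q.1, b r.1⁆ (b p.1) = B ⁅b p.1, b q.1⁆ (b r.1) := by rw [hB, ← hB']
  have t2 : B ⁅b r.1, b p.1⁆ (b q.1) = B ⁅b p.1, b q.1⁆ (b r.1) := by
    rw [hB, ← hB', t1]
  have j : ⁅⁅b p.1, b q.1⁆, b r.1⁆ + ⁅⁅b q.1, b r.1⁆, b p.1⁆ + ⁅⁅b r.1, b p.1⁆, b q.1⁆ = 0 := by
    rw [← lie_skew ⁅b p.1, b q.1⁆, ← lie_skew ⁅b q.1, b r.1⁆, ← lie_skew ⁅b r.1, b p.1⁆,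
      ← neg_add, ← neg_add, neg_eq_zero, ← lie_jacobi (b p.1) (b q.1) (b r.1)]
    abel
  have hs : ∀ a₁ a₂ a₃ c₁ c₂ c₃ : Option (ι × ℤ) →₀ k,
      a₁ + c₁ + (a₂ + c₂) + (a₃ + c₃) = (a₁ + a₂ + a₃) + (c₁ + c₂ + c₃) := by intros; abel
  rw [hs, ← map_add, ← map_add, j, map_zero, zero_add, ← Finsupp.single_add, ← Finsupp.single_add,
    t1, t2]
  split_ifs with h
  · have : ((p.2 + q.2 + r.2 : ℤ) : k) = 0 := by rw [h]; simp
    rw [← add_mul, ← add_mul, Finsupp.single_eq_zero]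
    push_cast at this ⊢
    linear_combination 2 * B ⁅b p.1, b q.1⁆ (b r.1) * this
  · simp

variable (B) (W)

/-- Functions on words that satisfy the relations of the affine Lie algebra, the locality
relations, and that vanish on nontrivial multiples of the central element. -/
def affSpace : Submodule k (List (Option (ι × ℤ)) → W) where
  carrier := {f |
    (∀ u p q v, f (u ++ p :: q :: v) - f (u ++ q :: p :: v) = slot f u v (affBr B b p q)) ∧
    (∀ u x y (m n : ℤ) v, f (u ++ some (x, m) :: some (y, n) :: v) +
        f (u ++ some (x, m - 2) :: some (y, n + 2) :: v) =
      f (u ++ some (x, m - 1) :: some (y, n + 1) :: v) +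
        f (u ++ some (x, m - 1) :: some (y, n + 1) :: v)) ∧
    ∀ u v, u ++ v ≠ [] → f (u ++ none :: v) = 0}
  add_mem' := by
    rintro f f' ⟨h1, h2, h3⟩ ⟨h1', h2', h3'⟩
    refine ⟨fun u p q v => ?_, fun u x y m n v => ?_, fun u v h => ?_⟩
    · have : slot (f + f') u v (affBr B b p q) =
          slot f u v (affBr B b p q) + slot f' u v (affBr B b p q) := by
        simp [slot, Finsupp.linearCombination_apply, Finsupp.sum_add]
      rw [this, ← h1, ← h1']
      simp only [Pi.add_apply]
      abel
    · simp only [Pi.add_apply]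
      rw [add_add_add_comm, h2, h2']
      abel
    · simp [h3 u v h, h3' u v h]
  zero_mem' := by
    refine ⟨fun u p q v => ?_, fun u x y m n v => ?_, fun u v h => ?_⟩ <;>
      simp [slot, Finsupp.linearCombination_apply]
  smul_mem' := by
    rintro c f ⟨h1, h2, h3⟩
    refine ⟨fun u p q v => ?_, fun u x y m n v => ?_, fun u v h => ?_⟩
    · have : slot (c • f) u v (affBr B b p q) = c • slot f u v (affBr B b p q) := by
        simp [slot, Finsupp.linearCombination_apply, Finsupp.smul_sum, smul_comm c]
      rw [this, ← h1, smul_sub]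
      rfl
    · simp only [Pi.smul_apply]
      rw [← smul_add, h2, smul_add]
    · simp [h3 u v h]

variable {B W}

/-- The sequence `F 0, F 1, F 2` is an arithmetic progression. -/
def IsProg (F : ℤ → W) : Prop := F 0 + F 2 = F 1 + F 1

theorem IsProg.add {F G : ℤ → W} (hF : IsProg F) (hG : IsProg G) : IsProg (fun h => F h + G h) := by
  unfold IsProg at *
  rw [add_add_add_comm, hF, hG, add_add_add_comm]

theorem IsProg.finsupp_sum {α : Type*} (x : α →₀ k) {F : α → ℤ → W} (hF : ∀ a, IsProg (F a)) :
    IsProg (fun h => x.sum fun a c => c • F a h) := by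
  unfold IsProg at *
  simp only [← Finsupp.sum_add, ← smul_add, hF]

/-- A word whose modes depend linearly on a parameter. -/
def lineWord (l : List (ι × ℤ × ℤ)) (h : ℤ) : List (ι × ℤ) :=
  l.map fun e => (e.1, e.2.1 + h * e.2.2)

theorem lineWord_append (l l' : List (ι × ℤ × ℤ)) (h : ℤ) :
    lineWord (l ++ l') h = lineWord l h ++ lineWord l' h :=
  List.map_append

theorem lineWord_cons (e : ι × ℤ × ℤ) (l : List (ι × ℤ × ℤ)) (h : ℤ) :
    lineWord (e :: l) h = (e.1, e.2.1 + h * e.2.2) :: lineWord l h :=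
  rfl

/-- With opposite slopes the total mode does not depend on h, so the condition is constant and the
coefficient is affine in h. This is the central term produced by exchanging two letters on a line.
-/
theorem isProg_single (e : W) (m d n : ℤ) (c : k) :
    IsProg (fun h : ℤ => (if m + h * d + (n + h * -d) = 0 then ((m + h * d : ℤ) : k) * c
      else 0) • e) := by
  unfold IsProg
  have : ∀ h : ℤ, m + h * d + (n + h * -d) = m + n := fun h => by ring
  simp only [this]
  split_ifs
  · rw [← add_smul, ← add_smul]
    congr 1
    push_cast
    ring
  · simp

/-- Existence of functions in `affSpace` with prescribed values. -/
theorem exists_affSpace [LinearOrder ι] (hB : ∀ x y, B x y = B y x)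
    (hB' : ∀ x y z, B ⁅x, y⁆ z = B x ⁅y, z⁆) (s : List (ι × ℤ) → W) (e : W)
    (hswap : ∀ u x (m m' : ℤ) v, s (u ++ (x, m) :: (x, m') :: v) - s (u ++ (x, m') :: (x, m) :: v) =
      if u = [] ∧ v = [] then (if m + m' = 0 then (m : k) * B (b x) (b x) else 0) • e else 0)
    (hline : ∀ l : List (ι × ℤ × ℤ), (l.Pairwise fun p q => p.1 ≤ q.1) →
      (l.map fun p => p.2.2).sum = 0 → IsProg fun h => s (lineWord l h)) :
    ∃ f ∈ affSpace W B b, f [none] = e ∧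
      ∀ l : List (ι × ℤ), (l.Pairwise fun p q => p.1 ≤ q.1) → f (l.map some) = s l := by
  classical
  -- The central letter is the largest one; the others are ordered by basis vector first and by mode
  -- second.
  let _ : LinearOrder (Option (ι × ℤ)) := inferInstanceAs (LinearOrder (WithTop (ι ×ₗ ℤ)))
  -- Any product of the central letter with another letter has to vanish, so only the one-letter
  -- central word gets a value.
  set s' : List (Option (ι × ℤ)) → W := fun w =>
    if none ∈ w then (if w = [none] then e else 0) else s w.reduceOption with hs'
  set f := pbwFun (affBr B b) s' with hf
  have rel : ∀ u p q v, f (u ++ p :: q :: v) - f (u ++ q :: p :: v) =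
      slot f u v (affBr B b p q) :=
    pbwFun_rel _ _ (affBr_self B b) (affBr_skew b hB) (affBr_jacobi b hB hB')
  have fe : f [none] = e := by
    rw [hf, pbwFun_sorted _ _ _ (by simp)]
    simp [hs']
  -- Sorting preserves this: a bracket that involves the central letter is zero, and any other
  -- bracket leaves the central letter in place next to at least one more letter.
  have fnone : ∀ w : List (Option (ι × ℤ)), none ∈ w → w ≠ [none] → f w = 0 := by
    intro w
    refine descent_induction (fun p : Option (ι × ℤ) => p)
      (P := fun w => none ∈ w → w ≠ [none] → f w = 0) ?_ ?_ w
    · intro w hw h1 h2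
      rw [hf, pbwFun_sorted _ _ _ hw]
      simp [hs', h1, h2]
    · intro u p q v _ ih ih' h1 _
      rw [← sub_add_cancel (f (u ++ p :: q :: v)) (f (u ++ q :: p :: v)), rel,
        ih' (by simp at h1 ⊢; tauto) (by
          intro h; have := congrArg List.length h; simp at this; omega), add_zero]
      rcases p with _ | p
      · simp [affBr]
      rcases q with _ | q
      · simp [affBr]
      rw [slot, Finsupp.linearCombination_apply]
      refine Finset.sum_eq_zero fun a _ => ?_
      simp only [List.mem_append, List.mem_cons, reduceCtorEq, false_or] at h1
      dsimp only
      rw [ih _ (by simp; omega) (by simp; tauto), smul_zero]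
      intro h
      rcases u with _ | ⟨c, u⟩
      · rcases v with _ | ⟨c, v⟩
        · simp at h1
        · simpa using congrArg List.length h
      · simpa using congrArg List.length h
  have brslot : ∀ (u v : List (ι × ℤ)) (p q : ι × ℤ),
      slot f (u.map some) (v.map some) (affBr B b (some p) (some q)) =
      ((b.repr ⁅b p.1, b q.1⁆).sum fun z c => c • f ((u ++ (z, p.2 + q.2) :: v).map some)) +
      if u = [] ∧ v = [] then
        (if p.2 + q.2 = 0 then (p.2 : k) * B (b p.1) (b q.1) else 0) • e else 0 := by
    intro u v p q
    rw [affBr, map_add, slot_modeEmb, slot_single]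
    congr 1
    · simp
    · by_cases h1 : u = [] ∧ v = []
      · obtain ⟨rfl, rfl⟩ := h1
        simp [fe]
      · rw [fnone _ (by simp), smul_zero, if_neg h1]
        intro h
        refine h1 ?_
        rcases u with _ | ⟨c, u⟩
        · rcases v with _ | ⟨c, v⟩
          · simp
          · simp at h
        · simp at h
  -- The recursion prescribes values only where the modes of equal letters are sorted too. A descent
  -- inside a word sorted by letters is between equal letters, where the bracket leaves just the
  -- central term; `hswap` says that `s` changes by the same amount.
  have fs : ∀ l : List (ι × ℤ), (l.Pairwise fun p q => p.1 ≤ q.1) → f (l.map some) = s l := by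
    intro l
    refine descent_induction (fun p : ι × ℤ => toLex p)
      (P := fun l => (l.Pairwise fun p q => p.1 ≤ q.1) → f (l.map some) = s l) ?_ ?_ l
    · intro l hl _
      rw [hf, pbwFun_sorted]
      · simp only [hs', List.mem_map, reduceCtorEq, and_false, exists_false, if_false]
        congr 1
        induction l with
        | nil => rfl
        | cons a l ih =>
          rw [List.map_cons, List.reduceOption_cons_of_some]
          rename_i h
          rw [ih (List.pairwise_cons.1 hl).2 (List.pairwise_cons.1 h).2]
      · rw [List.pairwise_map]
        exact hl.imp fun h => WithTop.coe_le_coe.2 h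
    · rintro u ⟨x, m⟩ ⟨y, n⟩ v hlt _ ih hl
      have hl' := hl
      rw [List.pairwise_append, List.pairwise_cons, List.pairwise_cons] at hl'
      have hxy : x ≤ y := hl'.2.1.1 (y, n) (by simp)
      have hyx : y ≤ x := Prod.Lex.monotone_fst _ _ hlt.le
      obtain rfl := le_antisymm hxy hyx
      have := ih (by
        simp only [List.pairwise_append, List.pairwise_cons, List.mem_cons] at hl ⊢
        obtain ⟨h1, ⟨h2, h3, h4⟩, h5⟩ := hl
        refine ⟨h1, ⟨?_, ?_, h4⟩, ?_⟩
        · rintro a (rfl | ha)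
          · exact le_rfl
          · exact h3 a ha
        · intro a ha
          exact h2 a (Or.inr ha)
        · rintro a ha c (rfl | rfl | hc)
          · exact h5 a ha (x, m) (Or.inl rfl)
          · exact h5 a ha (x, m) (Or.inl rfl)
          · exact h5 a ha _ (Or.inr (Or.inr hc)))
      have h1 := rel (u.map some) (some (x, m)) (some (x, n)) (v.map some)
      rw [brslot, lie_self, map_zero, Finsupp.sum_zero_index, zero_add, ← hswap u x m n v] at h1
      simp only [List.map_append, List.map_cons] at this ⊢
      rw [this] at h1
      exact sub_left_injective h1
  -- The progression property passes from sorted to arbitrary lines. Only the letters are sorted,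
  -- and each carries its base mode and slope along. A bracket merges two letters and adds their
  -- slopes, so the slopes still sum to zero; a central term contributes only for two-letter words.
  have line : ∀ l : List (ι × ℤ × ℤ), (l.map fun p => p.2.2).sum = 0 →
      IsProg fun h => f ((lineWord l h).map some) := by
    intro l
    refine descent_induction (fun p : ι × ℤ × ℤ => p.1)
      (P := fun l => (l.map fun p => p.2.2).sum = 0 →
        IsProg fun h => f ((lineWord l h).map some)) ?_ ?_ l
    · intro l hl h0
      have : ∀ h, f ((lineWord l h).map some) = s (lineWord l h) := by
        intro h
        refine fs _ ?_
        rw [lineWord, List.pairwise_map]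
        exact hl
      simp only [this]
      exact hline l hl h0
    · rintro u ⟨x, m, d⟩ ⟨y, n, d'⟩ v - ih ih' h0
      have key : ∀ h, f ((lineWord (u ++ (x, m, d) :: (y, n, d') :: v) h).map some) =
          f ((lineWord (u ++ (y, n, d') :: (x, m, d) :: v) h).map some) +
          (((b.repr ⁅b x, b y⁆).sum fun z c =>
            c • f ((lineWord (u ++ (z, m + n, d + d') :: v) h).map some)) +
          if u = [] ∧ v = [] then (if m + h * d + (n + h * d') = 0 then
            ((m + h * d : ℤ) : k) * B (b x) (b y) else 0) • e else 0) := by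
        intro h
        have h1 := rel ((lineWord u h).map some) (some (x, m + h * d)) (some (y, n + h * d'))
          ((lineWord v h).map some)
        rw [brslot, sub_eq_iff_eq_add'] at h1
        have e1 : ∀ w : List (ι × ℤ × ℤ), lineWord w h = [] ↔ w = [] := fun w => List.map_eq_nil_iff
        have e2 : m + n + h * (d + d') = m + h * d + (n + h * d') := by ring
        simp only [e1] at h1
        simp only [lineWord_append, lineWord_cons, List.map_append, List.map_cons, e2] at h1 ⊢
        exact h1
      simp only [key]
      simp only [List.map_append, List.map_cons, List.sum_append, List.sum_cons] at h0
      refine (ih' ?_).add ((IsProg.finsupp_sum _ fun z => ih _ ?_ ?_).add ?_)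
      · simp only [List.map_append, List.map_cons, List.sum_append, List.sum_cons]
        omega
      · simp only [List.length_append, List.length_cons]
        omega
      · simp only [List.map_append, List.map_cons, List.sum_append, List.sum_cons]
        omega
      · by_cases huv : u = [] ∧ v = []
        · obtain ⟨rfl, rfl⟩ := huv
          have : d' = -d := by simp at h0; omega
          subst this
          simp only [and_self, if_true]
          exact isProg_single e m d n _
        · simp [huv, IsProg]
  refine ⟨f, ⟨rel, fun u x y m n v => ?_, fun u v huv => ?_⟩, fe, fs⟩
  · by_cases hn : none ∈ u ++ v
    · have : ∀ p q : ι × ℤ, f (u ++ some p :: some q :: v) = 0 := fun p q =>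
        fnone _ (by simp at hn ⊢; exact hn) (fun h => by
          have := congrArg List.length h; simp at this; omega)
      simp [this]
    -- The surrounding words are lines of slope zero. Slopes −1 and 1 on the two letters in between
    -- turn `line` into the locality relation.
    · have hw : ∀ w : List (Option (ι × ℤ)), none ∉ w → ∃ l : List (ι × ℤ × ℤ),
          (l.map fun p => p.2.2).sum = 0 ∧ ∀ h, (lineWord l h).map some = w := by
        intro w
        induction w with
        | nil => exact fun _ => ⟨[], by simp, fun h => rfl⟩
        | cons a w ih =>
          intro ha
          rw [List.mem_cons, not_or] at ha
          obtain ⟨l, h1, h2⟩ := ih ha.2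
          obtain ⟨⟨x, m⟩, rfl⟩ := Option.ne_none_iff_exists'.1 (Ne.symm ha.1)
          refine ⟨(x, m, 0) :: l, by simpa using h1, fun h => ?_⟩
          rw [lineWord_cons, List.map_cons, h2]
          simp
      rw [List.mem_append, not_or] at hn
      obtain ⟨lu, h1, h2⟩ := hw u hn.1
      obtain ⟨lv, h3, h4⟩ := hw v hn.2
      have := line (lu ++ (x, m, -1) :: (y, n, 1) :: lv) (by simp [h1, h3])
      simp only [IsProg, lineWord_append, lineWord_cons, List.map_append, List.map_cons, h2,
        h4] at this
      convert this using 4 <;> simp <;> ring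
  · refine fnone _ (by simp) fun h => huv ?_
    rcases u with _ | ⟨c, u⟩
    · rcases v with _ | ⟨c, v⟩
      · simp
      · simpa using congrArg List.length h
    · simpa using congrArg List.length h

end Affine

/-! ### Top-degree symbols of words, and a function that detects the central element -/

section Symbols

variable {k g ι : Type*} [Field k] [LieRing g] [LieAlgebra k g]
  {B : LinearMap.BilinForm k g} (b : Module.Basis ι k g)

variable (k) in
/-- The sum of the modes, each multiplied by the class of the word with its letter marked. -/
noncomputable def wordSymbol (l : List (ι × ℤ)) : Multiset ι × ι × ℤ →₀ k :=
  (l.map fun p => (p.2 : k) •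
    Finsupp.single ((l.map Prod.fst : Multiset ι), p.1, (l.map Prod.snd).sum) 1).sum

/-- Symmetry makes the symbol compatible with the Lie relations once shorter words are sent to zero.
-/
theorem wordSymbol_perm {l l' : List (ι × ℤ)} (h : l.Perm l') :
    wordSymbol k l = wordSymbol k l' := by
  unfold wordSymbol
  have h1 : ((l.map Prod.fst : List ι) : Multiset ι) = (l'.map Prod.fst : List ι) :=
    Multiset.coe_eq_coe.2 (h.map _)
  rw [h1, (h.map Prod.snd).sum_eq]
  exact (h.map _).sum_eq

theorem isProg_sum {W : Type*} [AddCommGroup W] [Module k W] (v : ι → W)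
    (l : List (ι × ℤ × ℤ)) :
    IsProg fun h => (l.map fun e => ((e.2.1 + h * e.2.2 : ℤ) : k) • v e.1).sum := by
  induction l with
  | nil => simp [IsProg]
  | cons e l ih =>
    simp only [List.map_cons, List.sum_cons]
    refine IsProg.add ?_ ih
    unfold IsProg
    rw [← add_smul, ← add_smul]
    congr 1
    push_cast
    ring

theorem sum_lineWord (l : List (ι × ℤ × ℤ)) (h : ℤ) :
    ((lineWord l h).map Prod.snd).sum =
      (l.map fun e => e.2.1).sum + h * (l.map fun e => e.2.2).sum := by
  induction l with
  | nil => simp [lineWord]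
  | cons e l ih =>
    rw [lineWord_cons, List.map_cons, List.sum_cons, ih]
    simp
    ring

/-- There is a function in `affSpace` that vanishes on words with less than `N` letters and
computes the symbol of words with `N` letters. -/
theorem exists_symbol (hB : ∀ x y, B x y = B y x) (hB' : ∀ x y z, B ⁅x, y⁆ z = B x ⁅y, z⁆)
    (N : ℕ) : ∃ f ∈ affSpace (Multiset ι × ι × ℤ →₀ k) B b, (∀ w, w.length < N → f w = 0) ∧
      ∀ l : List (ι × ℤ), l.length = N → f (l.map some) = wordSymbol k l := by
  classical
  let _ : LinearOrder ι := linearOrderOfSTO WellOrderingRel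
  obtain ⟨f, hf, he, hs⟩ := exists_affSpace (W := Multiset ι × ι × ℤ →₀ k) b hB hB'
    (fun l => if l.length = N then wordSymbol k l else 0) 0 (by
      intro u x m m' v
      have : (u ++ (x, m) :: (x, m') :: v).Perm (u ++ (x, m') :: (x, m) :: v) :=
        List.Perm.append_left u (List.Perm.swap _ _ v)
      simp only [this.length_eq, wordSymbol_perm this, sub_self, smul_zero, ite_self]) (by
      intro l _ h0
      have hlen : ∀ h, (lineWord l h).length = l.length := fun h => List.length_map _
      simp only [hlen]
      split_ifs with hN
      -- Along a line with slopes summing to zero the total mode is constant, so the basis vectors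
      -- are fixed and only their coefficients vary, affinely in h.
      · have : ∀ h, wordSymbol k (lineWord l h) = (l.map fun e => ((e.2.1 + h * e.2.2 : ℤ) : k) •
            Finsupp.single ((l.map Prod.fst : Multiset ι), e.1, (l.map fun e => e.2.1).sum)
              (1 : k)).sum := by
          intro h
          rw [wordSymbol, sum_lineWord, h0]
          simp [lineWord, Function.comp_def]
        simp only [this]
        have key := isProg_sum (k := k) (fun i => Finsupp.single ((l.map Prod.fst : Multiset ι), i,
          (l.map fun e => e.2.1).sum) (1 : k)) l
        exact key
      · simp [IsProg])
  obtain ⟨h1, h2, h3⟩ := id hf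
  have fnone : ∀ u v, f (u ++ none :: v) = 0 := by
    intro u v
    by_cases huv : u ++ v = []
    · obtain ⟨rfl, rfl⟩ := List.append_eq_nil_iff.1 huv
      exact he
    · exact h3 u v huv
  -- Letters may be exchanged freely when all words shorter by one letter are killed; the central
  -- contribution is zero because f vanishes on every word with the central letter.
  have step : ∀ (u v : List (ι × ℤ)) (p q : ι × ℤ),
      (∀ a, f ((u ++ a :: v).map some) = 0) →
      f ((u ++ p :: q :: v).map some) = f ((u ++ q :: p :: v).map some) := by
    intro u v p q h
    simp only [List.map_append, List.map_cons] at h ⊢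
    rw [← sub_eq_zero, h1, slot, Finsupp.linearCombination_apply]
    refine Finset.sum_eq_zero fun a _ => ?_
    dsimp only
    rcases a with _ | a
    · rw [fnone, smul_zero]
    · rw [h, smul_zero]
  have short : ∀ l : List (ι × ℤ), l.length < N → f (l.map some) = 0 := by
    refine descent_induction (fun p : ι × ℤ => p.1) ?_ ?_
    · intro l hl hN
      rw [hs l hl, if_neg hN.ne]
    · intro u p q v _ ih ih' hN
      simp only [List.length_append, List.length_cons] at hN ih'
      rw [step u v p q fun a => ih _ (by simp; omega) (by simp; omega)]
      exact ih' (by omega)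
  refine ⟨f, hf, fun w hw => ?_, ?_⟩
  · by_cases hn : none ∈ w
    · obtain ⟨u, v, rfl⟩ := List.append_of_mem hn
      exact fnone u v
    · have : ∃ l : List (ι × ℤ), l.map some = w := by
        change w ∈ Set.range (List.map some)
        rw [Set.range_list_map]
        intro x hx
        cases x with
        | none => exact absurd hx hn
        | some p => exact ⟨p, rfl⟩
      obtain ⟨l, rfl⟩ := this
      exact short l (by simpa using hw)
  · refine descent_induction (fun p : ι × ℤ => p.1) ?_ ?_
    · intro l hl hN
      rw [hs l hl, if_pos hN]
    · intro u p q v _ ih ih' hN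
      simp only [List.length_append, List.length_cons] at hN ih'
      rw [step u v p q fun a => short _ (by simp; omega), ih' (by omega)]
      exact wordSymbol_perm (List.Perm.append_left u (List.Perm.swap _ _ v))

/-- There is a function in `affSpace` that detects the central element. -/
theorem exists_central [CharZero k] (hB : ∀ x y, B x y = B y x)
    (hB' : ∀ x y z, B ⁅x, y⁆ z = B x ⁅y, z⁆) :
    ∃ f ∈ affSpace k B b, f [none] = 1 ∧ ∀ p, f [some p] = 0 := by
  classical
  let _ : LinearOrder ι := linearOrderOfSTO WellOrderingRel
  obtain ⟨f, hf, he, hs⟩ := exists_affSpace (W := k) b hB hB'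
    -- The value on two-letter words is half the central cocycle: it is antisymmetric in the two
    -- modes when they sum to zero, so exchanging equal letters changes the value by the full
    -- central term. It is linear in the first mode, as locality demands.
    (fun l => match l with
      | [p, q] => (if p.2 + q.2 = 0 then (p.2 : k) * B (b p.1) (b q.1) else 0) • (1 / 2 : k)
      | _ => 0) 1 (by
      intro u x m m' v
      by_cases huv : u = [] ∧ v = []
      · obtain ⟨rfl, rfl⟩ := huv
        simp only [List.nil_append, and_self, if_true, add_comm m' m]
        split_ifs with h
        · have : m' = -m := by omega
          subst this
          simp only [smul_eq_mul]
          push_cast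
          ring
        · simp
      · rw [if_neg huv]
        rcases u with _ | ⟨c, _ | ⟨c', u⟩⟩
        · rcases v with _ | ⟨c, v⟩
          · simp at huv
          · simp
        · rcases v with _ | ⟨c, v⟩ <;> simp
        · rcases u with _ | ⟨c, u⟩ <;> simp) (by
      intro l _ h0
      match l, h0 with
      | [], _ => simp [lineWord, IsProg]
      | [_], _ => simp [lineWord, IsProg]
      | [(x, m, d), (y, n, d')], h0 =>
        have : d' = -d := by simp at h0; omega
        subst this
        exact isProg_single (1 / 2 : k) m d n (B (b x) (b y))
      | _ :: _ :: _ :: _, _ => simp [lineWord, IsProg])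
  exact ⟨f, hf, he, fun p => hs [p] (by simp)⟩

end Symbols

/-! ### Formal distributions with values in an associative algebra -/

section Fields

variable {k A : Type*} [Field k]

/-- The linear functional on polynomials in three variables with given values on monomials. -/
noncomputable def polyEval [AddCommGroup A] [Module k A] (v : ℕ → ℕ → ℕ → A) :
    MvPolynomial (Fin 3) k →ₗ[k] A :=
  (MvPolynomial.basisMonomials (Fin 3) k).constr k fun e => v (e 0) (e 1) (e 2)

theorem polyEval_mon [AddCommGroup A] [Module k A] (v : ℕ → ℕ → ℕ → A) (i j l : ℕ) :
    polyEval (k := k) v (MvPolynomial.X 0 ^ i * MvPolynomial.X 1 ^ j * MvPolynomial.X 2 ^ l) =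
      v i j l := by
  have : (MvPolynomial.X 0 ^ i * MvPolynomial.X 1 ^ j * MvPolynomial.X 2 ^ l :
      MvPolynomial (Fin 3) k) = MvPolynomial.basisMonomials (Fin 3) k
        (Finsupp.single 0 i + Finsupp.single 1 j + Finsupp.single 2 l) := by
    simp [MvPolynomial.X_pow_eq_monomial, MvPolynomial.monomial_mul]
  rw [this, polyEval, Module.Basis.constr_basis]
  simp

theorem sub_pow_smul {R : Type*} [CommRing R] [Algebra k R] (x y : R) (n : ℕ) :
    (x - y) ^ n = ∑ s ∈ Finset.range (n + 1), ((-1 : k) ^ s * (n.choose s : k)) •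
      (x ^ (n - s) * y ^ s) := by
  rw [sub_eq_add_neg, add_comm, add_pow]
  refine Finset.sum_congr rfl fun s _ => ?_
  rw [Algebra.smul_def, neg_pow]
  simp only [map_mul, map_pow, map_neg, map_one, map_natCast]
  ring

/-- Formal distributions `a(z) = ∑ a(m) z^(-m-1)`. -/
def Fields (A : Type*) : Type _ := ℤ → A

variable [Ring A] [Algebra k A]

instance : AddCommGroup (Fields A) := inferInstanceAs (AddCommGroup (ℤ → A))

instance : Module k (Fields A) := inferInstanceAs (Module k (ℤ → A))

variable (k) in
/-- The coefficient of a formal distribution. -/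
def mode (m : ℤ) : Fields A →ₗ[k] A := LinearMap.proj m

theorem fields_ext {a b : Fields A} (h : ∀ m, mode k m a = mode k m b) : a = b :=
  funext h

/-- `D` is d/dz, and the n-product is the residue in w of (w − z)^n a(w) b(z), without a commutator.
Arbitrary distributions are not local, so this is not a conformal algebra. -/
noncomputable instance : PreConformal k (Fields A) where
  D := LinearMap.pi fun m => -((m : k) • mode k (m - 1))
  mul n := LinearMap.mk₂ k (fun a b m => ∑ s ∈ Finset.range (n + 1),
      ((-1 : k) ^ s * (n.choose s : k)) • (mode k ((n - s : ℕ) : ℤ) a * mode k (m + s) b))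
    (fun a a' b => funext fun m => by
      simp only [map_add, add_mul, smul_add, Finset.sum_add_distrib]
      rfl)
    (fun c a b => funext fun m => by
      simp only [map_smul, smul_mul_assoc, smul_comm _ c, ← Finset.smul_sum]
      rfl)
    (fun a b b' => funext fun m => by
      simp only [map_add, mul_add, smul_add, Finset.sum_add_distrib]
      rfl)
    (fun c a b => funext fun m => by
      simp only [map_smul, mul_smul_comm, smul_comm _ c, ← Finset.smul_sum]
      rfl)

theorem mode_der (a : Fields A) (m : ℤ) :
    mode k m (der k a) = -((m : k) • mode k (m - 1) a) :=
  rfl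

theorem mode_nmul (n : ℕ) (a b : Fields A) (m : ℤ) :
    mode k m (nmul k n a b) = ∑ s ∈ Finset.range (n + 1),
      ((-1 : k) ^ s * (n.choose s : k)) • (mode k ((n - s : ℕ) : ℤ) a * mode k (m + s) b) :=
  rfl

theorem Fields.der_nmul (n : ℕ) (a b : Fields A) :
    nmul k n (der k a) b = -((n : k) • nmul k (n - 1) a b) := by
  refine fields_ext (k := k) fun m => ?_
  rw [map_neg, map_smul, mode_nmul, mode_nmul]
  rcases n with _ | n
  · simp [mode_der]
  rw [Finset.sum_range_succ]
  simp only [mode_der, Nat.sub_self, Nat.cast_zero, Int.cast_zero, zero_smul, neg_zero, zero_mul,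
    smul_zero, add_zero, Nat.add_sub_cancel, Finset.smul_sum, ← Finset.sum_neg_distrib]
  refine Finset.sum_congr rfl fun s hs => ?_
  rw [Finset.mem_range] at hs
  have h1 : ((n + 1 - s : ℕ) : ℤ) - 1 = ((n - s : ℕ) : ℤ) := by omega
  have h2 := congrArg (Nat.cast (R := k)) (Nat.choose_mul_succ_eq n s)
  rw [h1, neg_mul, smul_neg, smul_mul_assoc, smul_smul, smul_smul]
  congr 2
  push_cast at h2 ⊢
  linear_combination (-1) ^ s * (-h2)

theorem Fields.nmul_der (n : ℕ) (a b : Fields A) :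
    nmul k n a (der k b) = der k (nmul k n a b) + (n : k) • nmul k (n - 1) a b := by
  refine fields_ext (k := k) fun m => ?_
  rw [map_add, map_smul, mode_nmul, mode_der, mode_nmul, mode_nmul, ← sub_eq_iff_eq_add',
    sub_neg_eq_add, Finset.smul_sum, ← Finset.sum_add_distrib]
  rcases n with _ | n
  · simp [mode_der]
  rw [Finset.sum_range_succ', Nat.add_sub_cancel, Finset.smul_sum]
  simp only [mode_der]
  have h0 : ((-1 : k) ^ 0 * ((n + 1).choose 0 : k)) • (mode k ((n + 1 - 0 : ℕ) : ℤ) a *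
      -(((m + (0 : ℕ) : ℤ) : k) • mode k (m + (0 : ℕ) - 1) b)) + (m : k) •
      ((-1 : k) ^ 0 * ((n + 1).choose 0 : k)) • (mode k ((n + 1 - 0 : ℕ) : ℤ) a *
      mode k (m - 1 + (0 : ℕ)) b) = 0 := by
    simp
  rw [h0, add_zero]
  refine Finset.sum_congr rfl fun s hs => ?_
  have h1 : n + 1 - (s + 1) = n - s := by omega
  have h2 : m + (s + 1 : ℕ) - 1 = m + s := by push_cast; ring
  have h3 : m - 1 + (s + 1 : ℕ) = m + s := by push_cast; ring
  have h4 := congrArg (Nat.cast (R := k)) (Nat.add_one_mul_choose_eq n s)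
  rw [h1, h2, h3, mul_neg, mul_smul_comm, smul_neg, smul_smul, smul_smul, smul_smul, ← neg_smul,
    ← add_smul]
  congr 1
  push_cast at h4 ⊢
  linear_combination (-1) ^ s * (-h4)

/-- Coefficients are encoded by polynomials: x^i y^j z^l stands for a(i) b(j) c(m+l), and an
n-product becomes an n-th power of a difference of variables. Associativity is the binomial
expansion of (x − y)^n with x − y = (x − z) − (y − z). -/
theorem Fields.isAssoc : IsAssoc k (Fields A) := by
  intro n p a b c
  refine fields_ext (k := k) fun m => ?_
  set φ := polyEval (k := k) fun i j l => mode k (i : ℤ) a * mode k (j : ℤ) b * mode k (m + l) c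
    with hφ
  set x : MvPolynomial (Fin 3) k := MvPolynomial.X 0 with hx
  set y : MvPolynomial (Fin 3) k := MvPolynomial.X 1 with hy
  set z : MvPolynomial (Fin 3) k := MvPolynomial.X 2 with hz
  have mon : ∀ i j l : ℕ, φ (x ^ i * y ^ j * z ^ l) =
      mode k (i : ℤ) a * mode k (j : ℤ) b * mode k (m + l) c := polyEval_mon _
  have h1 : mode k m (nmul k p (nmul k n a b) c) = φ ((y - z) ^ p * (x - y) ^ n) := by
    rw [sub_pow_smul (k := k) y z p, sub_pow_smul (k := k) x y n, Finset.sum_mul_sum, map_sum,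
      mode_nmul]
    refine Finset.sum_congr rfl fun t _ => ?_
    rw [mode_nmul, Finset.sum_mul, Finset.smul_sum, map_sum]
    refine Finset.sum_congr rfl fun s _ => ?_
    have : y ^ (p - t) * z ^ t * (x ^ (n - s) * y ^ s) = x ^ (n - s) * y ^ (p - t + s) * z ^ t := by
      rw [pow_add]; ring
    rw [smul_mul_smul_comm, this, map_smul, mon, smul_mul_assoc, smul_smul, Nat.cast_add]
  have h2 : ∀ q r, mode k m (nmul k q a (nmul k r b c)) = φ ((x - z) ^ q * (y - z) ^ r) := by
    intro q r
    rw [sub_pow_smul (k := k) x z q, sub_pow_smul (k := k) y z r, Finset.sum_mul_sum, map_sum,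
      mode_nmul]
    refine Finset.sum_congr rfl fun t _ => ?_
    rw [mode_nmul, Finset.mul_sum, Finset.smul_sum, map_sum]
    refine Finset.sum_congr rfl fun s _ => ?_
    have : x ^ (q - t) * z ^ t * (y ^ (r - s) * z ^ s) = x ^ (q - t) * y ^ (r - s) * z ^ (t + s) := by
      rw [pow_add]; ring
    rw [smul_mul_smul_comm, this, map_smul, mon, mul_smul_comm, smul_smul, Nat.cast_add, add_assoc,
      mul_assoc (mode k ((q - t : ℕ) : ℤ) a)]
  rw [h1, map_sum]
  simp only [map_smul, h2]
  have : x - y = (x - z) - (y - z) := by ring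
  rw [this, sub_pow_smul (k := k) (x - z) (y - z) n, Finset.mul_sum, map_sum]
  refine Finset.sum_congr rfl fun s _ => ?_
  rw [mul_smul_comm, map_smul]
  congr 2
  rw [pow_add]
  ring

end Fields

/-! ### Commutators -/

section Commutators

variable {k V : Type*} [Field k] [AddCommGroup V] [Module k V]

theorem iter_der [PreConformal k V] (s : ℕ) (v : V) : (der k)^[s] v = (der k ^ s) v := by
  rw [Module.End.pow_apply]

theorem rmul_eq_sum [PreConformal k V] (n M : ℕ) (a b : V)
    (h : ∀ j, n + M ≤ j → nmul k j b a = 0) : rmul k n a b =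
      ∑ s ∈ Finset.range M, ((-1 : k) ^ (n + s) * ((Nat.factorial s : k))⁻¹) •
        (der k ^ s) (nmul k (n + s) b a) := by
  simp only [rmul, iter_der]
  refine finsum_eq_sum_of_support_subset _ fun s hs => ?_
  rw [Finset.coe_range, Set.mem_Iio]
  by_contra hlt
  exact hs (by dsimp only; rw [h _ (by omega), map_zero, smul_zero])

/-- Locality 2 leaves at most the summands s = 0 and s = 1. This and the next two lemmas let all
commutators of generators be handled without infinite sums. -/
theorem comm_zero_of_local [PreConformal k V] {a b : V} (h : ∀ j, 2 ≤ j → nmul k j b a = 0) :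
    comm k 0 a b = nmul k 0 a b - nmul k 0 b a + der k (nmul k 1 b a) := by
  rw [comm, rmul_eq_sum 0 2 a b (by simpa using h)]
  simp [Finset.sum_range_succ]
  abel

theorem comm_one_of_local [PreConformal k V] {a b : V} (h : ∀ j, 2 ≤ j → nmul k j b a = 0) :
    comm k 1 a b = nmul k 1 a b + nmul k 1 b a := by
  rw [comm, rmul_eq_sum 1 1 a b (by simpa using h)]
  simp

theorem comm_of_local [PreConformal k V] {a b : V} (h : ∀ j, 2 ≤ j → nmul k j b a = 0) {n : ℕ}
    (hn : 2 ≤ n) : comm k n a b = nmul k n a b := by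
  rw [comm, rmul_eq_sum n 0 a b fun j hj => h j (by omega)]
  simp

variable [ConformalAlgebra k V]

theorem der_nmul (n : ℕ) (a b : V) : nmul k n (der k a) b = -((n : k) • nmul k (n - 1) a b) :=
  ConformalAlgebra.D_mul n a b

theorem nmul_der (n : ℕ) (a b : V) :
    nmul k n a (der k b) = der k (nmul k n a b) + (n : k) • nmul k (n - 1) a b :=
  ConformalAlgebra.mul_D n a b

theorem exists_local (a b : V) : ∃ M, ∀ j, M ≤ j → nmul k j a b = 0 :=
  ConformalAlgebra.locality a b

variable [CharZero k]

theorem factorial_inv (s : ℕ) : ((s + 1 : ℕ) : k) * ((Nat.factorial (s + 1) : k))⁻¹ =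
    ((Nat.factorial s : k))⁻¹ := by
  rw [Nat.factorial_succ]
  have h1 : ((s + 1 : ℕ) : k) ≠ 0 := Nat.cast_ne_zero.2 (Nat.succ_ne_zero s)
  have h2 : (Nat.factorial s : k) ≠ 0 := Nat.cast_ne_zero.2 (Nat.factorial_ne_zero s)
  push_cast at h1 ⊢
  field_simp

/-- The commutator products inherit sesquilinearity: once locality has truncated both sums at the
same place, their discrepancy telescopes. -/
theorem comm_der_left (n : ℕ) (a b : V) :
    comm k n (der k a) b = -((n : k) • comm k (n - 1) a b) := by
  obtain ⟨M, hM⟩ := exists_local (k := k) b a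
  have key : rmul k n (der k a) b = -((n : k) • rmul k (n - 1) a b) := by
    rw [rmul_eq_sum n (M + 1) (der k a) b (fun j hj => by
        rw [nmul_der, hM j (by omega), hM (j - 1) (by omega)]; simp),
      rmul_eq_sum (n - 1) (M + 1) a b (fun j hj => hM j (by omega)), Finset.smul_sum,
      ← Finset.sum_neg_distrib, ← sub_eq_zero, ← Finset.sum_sub_distrib]
    -- The factor s/s! replaces 1/(s−1)! and makes `T 0` vanish; `T (M + 1)` contains the product
    -- with index n + M and vanishes by locality.
    let T : ℕ → V := fun s => ((-1 : k) ^ (n + s) * ((s : k) * ((Nat.factorial s : k))⁻¹)) •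
      (der k ^ s) (nmul k (n + s - 1) b a)
    have : ∀ s ∈ Finset.range (M + 1), ((-1 : k) ^ (n + s) * ((Nat.factorial s : k))⁻¹) •
        (der k ^ s) (nmul k (n + s) b (der k a)) - -((n : k) • ((-1 : k) ^ (n - 1 + s) *
          ((Nat.factorial s : k))⁻¹) • (der k ^ s) (nmul k (n - 1 + s) b a)) = T s - T (s + 1) := by
      intro s _
      have e1 : n + (s + 1) - 1 = n + s := by omega
      simp only [T, factorial_inv, e1]
      rw [nmul_der, map_add, map_smul, pow_succ (der k) s, Module.End.mul_apply]
      rcases n with _ | n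
      · simp only [Nat.cast_zero, zero_add, smul_add, smul_smul]
        rw [pow_succ (-1 : k) s]
        module
      · have e2 : n + 1 - 1 + s = n + s := by omega
        have e3 : n + 1 + s - 1 = n + s := by omega
        simp only [e2, e3, smul_add, smul_smul]
        rw [show n + 1 + (s + 1) = n + s + 1 + 1 by omega, show n + 1 + s = n + s + 1 by omega]
        simp only [pow_succ]
        push_cast
        module
    rw [Finset.sum_congr rfl this, Finset.sum_range_sub']
    simp only [T, Nat.cast_zero, zero_mul, mul_zero, zero_smul, zero_sub, neg_eq_zero]
    rw [hM _ (by omega), map_zero, smul_zero]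
  rw [comm, comm, key, der_nmul]
  module

theorem comm_der_right (n : ℕ) (a b : V) :
    comm k n a (der k b) = der k (comm k n a b) + (n : k) • comm k (n - 1) a b := by
  obtain ⟨M, hM⟩ := exists_local (k := k) b a
  have key : rmul k n a (der k b) = der k (rmul k n a b) + (n : k) • rmul k (n - 1) a b := by
    rw [rmul_eq_sum n (M + 1) a (der k b) (fun j hj => by
        rw [der_nmul, hM (j - 1) (by omega)]; simp),
      rmul_eq_sum n (M + 1) a b (fun j hj => hM j (by omega)),
      rmul_eq_sum (n - 1) (M + 1) a b (fun j hj => hM j (by omega)), Finset.smul_sum,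
      map_sum, ← Finset.sum_add_distrib, ← sub_eq_zero, ← Finset.sum_sub_distrib]
    let T : ℕ → V := fun s => ((-1 : k) ^ (n + s) * ((s : k) * ((Nat.factorial s : k))⁻¹)) •
      (der k ^ s) (nmul k (n + s - 1) b a)
    have : ∀ s ∈ Finset.range (M + 1), ((-1 : k) ^ (n + s) * ((Nat.factorial s : k))⁻¹) •
        (der k ^ s) (nmul k (n + s) (der k b) a) - (der k (((-1 : k) ^ (n + s) *
          ((Nat.factorial s : k))⁻¹) • (der k ^ s) (nmul k (n + s) b a)) +
          (n : k) • ((-1 : k) ^ (n - 1 + s) *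
          ((Nat.factorial s : k))⁻¹) • (der k ^ s) (nmul k (n - 1 + s) b a)) =
          T (s + 1) - T s := by
      intro s _
      have e1 : n + (s + 1) - 1 = n + s := by omega
      simp only [T, factorial_inv, e1]
      rw [der_nmul, map_neg, map_smul, map_smul, pow_succ' (der k) s, Module.End.mul_apply]
      rcases n with _ | n
      · simp only [Nat.cast_zero, zero_add, smul_neg, smul_smul]
        rw [pow_succ (-1 : k) s]
        module
      · have e2 : n + 1 - 1 + s = n + s := by omega
        have e3 : n + 1 + s - 1 = n + s := by omega
        simp only [e2, e3, smul_neg, smul_smul]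
        rw [show n + 1 + (s + 1) = n + s + 1 + 1 by omega, show n + 1 + s = n + s + 1 by omega]
        simp only [pow_succ]
        push_cast
        module
    rw [Finset.sum_congr rfl this, Finset.sum_range_sub]
    simp only [T, Nat.cast_zero, zero_mul, mul_zero, zero_smul, sub_zero]
    rw [hM _ (by omega), map_zero, smul_zero]
  simp only [comm]
  rw [key, nmul_der, map_sub]
  module

/-- Sesquilinearity gives 0 = (∂e)(n+1)a = −(n+1) e(n)a, and n + 1 is invertible. Hence torsion
elements such as e multiply trivially in every conformal algebra. -/
theorem nmul_eq_zero_of_der_left {e : V} (he : der k e = 0) (n : ℕ) (a : V) :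
    nmul k n e a = 0 := by
  have h := der_nmul (k := k) (n + 1) e a
  rw [he, map_zero, LinearMap.zero_apply, Nat.add_sub_cancel, eq_comm, neg_eq_zero] at h
  exact (smul_eq_zero.1 h).resolve_left (Nat.cast_ne_zero.2 (Nat.succ_ne_zero n))

/-- Here sesquilinearity expresses a(n)e through ∂(a(n+1)e), so vanishing is propagated downwards
from the large indices provided by locality. -/
theorem nmul_eq_zero_of_der_right {e : V} (he : der k e = 0) (n : ℕ) (a : V) :
    nmul k n a e = 0 := by
  obtain ⟨M, hM⟩ := exists_local (k := k) a e
  have step : ∀ n, nmul k (n + 1) a e = 0 → nmul k n a e = 0 := by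
    intro n hn
    have h := nmul_der (k := k) (n + 1) a e
    rw [he, map_zero, hn, map_zero, zero_add, Nat.add_sub_cancel, eq_comm] at h
    exact (smul_eq_zero.1 h).resolve_left (Nat.cast_ne_zero.2 (Nat.succ_ne_zero n))
  have : ∀ j n, M ≤ n + j → nmul k n a e = 0 := by
    intro j
    induction j with
    | zero => exact fun n hn => hM n hn
    | succ j ih => exact fun n hn => step n (ih (n + 1) (by omega))
  exact this M n (by omega)

theorem comm_eq_zero_of_der_left {e : V} (he : der k e = 0) (n : ℕ) (a : V) :
    comm k n e a = 0 := by
  rw [comm, rmul_eq_sum n 0 e a fun j _ => nmul_eq_zero_of_der_right he j a,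
    nmul_eq_zero_of_der_left he]
  simp

theorem comm_eq_zero_of_der_right {e : V} (he : der k e = 0) (n : ℕ) (a : V) :
    comm k n a e = 0 := by
  rw [comm, rmul_eq_sum n 0 a e fun j _ => nmul_eq_zero_of_der_left he j a,
    nmul_eq_zero_of_der_right he]
  simp

end Commutators

/-! ### Homomorphisms from Kac–Moody conformal algebras to commutator algebras -/

section KMHom

variable {k g : Type*} [Field k] [LieRing g] [LieAlgebra k g] (B : LinearMap.BilinForm k g)

namespace KM

/-- The element `∂^i a` of `K(g)`. -/
noncomputable def cur (i : ℕ) (a : g) : KM B := ((Cur.mk i a, 0) : Cur g × k)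

/-- The element `e` of `K(g)`. -/
noncomputable def e : KM B := ((0, 1) : Cur g × k)

theorem der_cur (i : ℕ) (a : g) : der k (cur B i a) = cur B (i + 1) a :=
  Prod.ext (Cur.der_mk i a) rfl

theorem der_e : der k (e B) = 0 :=
  Prod.ext (map_zero (der k : Cur g →ₗ[k] Cur g)) rfl

theorem nmul_cur_zero (a c : g) : nmul k 0 (cur B 0 a) (cur B 0 c) = cur B 0 ⁅a, c⁆ := by
  refine Prod.ext ((Cur.nmul_mk 0 0 0 a c).trans ?_) ((form_mk B 0 0 0 a c).trans ?_)
  · simp [cur]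
  · simp [cur]

theorem nmul_cur_one (a c : g) : nmul k 1 (cur B 0 a) (cur B 0 c) = B a c • e B := by
  refine Prod.ext ((Cur.nmul_mk 1 0 0 a c).trans ?_) ((form_mk B 1 0 0 a c).trans ?_)
  · change _ = B a c • (0 : Cur g)
    simp
  · change _ = B a c * 1
    simp

theorem nmul_cur_of_le {n : ℕ} (hn : 2 ≤ n) (a c : g) :
    nmul k n (cur B 0 a) (cur B 0 c) = 0 := by
  refine Prod.ext ((Cur.nmul_mk n 0 0 a c).trans ?_) ((form_mk B n 0 0 a c).trans ?_)
  · rw [Nat.choose_eq_zero_of_lt (by omega)]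
    simp
    rfl
  · rw [if_neg (by omega)]
    rfl

theorem span_cur_e : Submodule.span k
    (Set.range (fun p : ℕ × g => cur B p.1 p.2) ∪ {e B}) = ⊤ := by
  rw [eq_top_iff]
  have hf : ∀ f : Cur g, (show KM B from ((f, 0) : Cur g × k)) ∈ Submodule.span k
      (Set.range (fun p : ℕ × g => cur B p.1 p.2) ∪ {e B}) := by
    intro f
    induction f using Finsupp.induction_linear with
    | zero => exact Submodule.zero_mem _
    | add f h hf hh =>
      have : (show KM B from ((f + h, 0) : Cur g × k)) =
          (show KM B from ((f, 0) : Cur g × k)) + (show KM B from ((h, 0) : Cur g × k)) :=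
        Prod.ext rfl (add_zero (0 : k)).symm
      exact this ▸ Submodule.add_mem _ hf hh
    | single i a => exact Submodule.subset_span (Or.inl ⟨(i, a), rfl⟩)
  rintro ⟨f, s⟩ -
  have : (show KM B from ((f, s) : Cur g × k)) =
      (show KM B from ((f, 0) : Cur g × k)) + s • e B :=
    Prod.ext (show f = f + s • (0 : Cur g) by simp) (show s = 0 + s • (1 : k) by simp)
  have h := Submodule.add_mem _ (hf f)
    (Submodule.smul_mem _ s (Submodule.subset_span (Or.inr (Set.mem_singleton (e B)))))
  rw [← this] at h
  exact h

variable {B}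

/-- A linear map from `g` and an element `e` that satisfy the relations of `K(g)` with respect to
the commutator products extend to `K(g)`. -/
theorem exists_hom [CharZero k] {V : Type*} [AddCommGroup V] [Module k V] [ConformalAlgebra k V]
    (x : g →ₗ[k] V) (v : V) (hv : der k v = 0) (h0 : ∀ a c, comm k 0 (x a) (x c) = x ⁅a, c⁆)
    (h1 : ∀ a c, comm k 1 (x a) (x c) = B a c • v)
    (h2 : ∀ a c n, 2 ≤ n → comm k n (x a) (x c) = 0) :
    ∃ ρ : KM B →ₗ[k] V, (∀ a, ρ (cur B 0 a) = x a) ∧ ρ (e B) = v ∧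
      (∀ a, ρ (der k a) = der k (ρ a)) ∧ ∀ n a c, ρ (nmul k n a c) = comm k n (ρ a) (ρ c) := by
  let ρ : KM B →ₗ[k] V := (LinearMap.coprod
    (Finsupp.lsum k fun i => (der k ^ i) ∘ₗ x : (ℕ →₀ g) →ₗ[k] V)
    (LinearMap.toSpanSingleton k V v) : (ℕ →₀ g) × k →ₗ[k] V)
  have ρcur : ∀ i a, ρ (cur B i a) = (der k ^ i) (x a) := by
    intro i a
    change (Finsupp.lsum k fun i => (der k ^ i) ∘ₗ x : (ℕ →₀ g) →ₗ[k] V) (Finsupp.single i a) +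
      (0 : k) • v = _
    rw [Finsupp.lsum_single, zero_smul, add_zero]
    rfl
  have ρe : ρ (e B) = v := by
    change (Finsupp.lsum k fun i => (der k ^ i) ∘ₗ x : (ℕ →₀ g) →ₗ[k] V) 0 + (1 : k) • v = _
    rw [map_zero, one_smul, zero_add]
  have ρder : ∀ a, ρ (der k a) = der k (ρ a) := by
    intro a
    refine LinearMap.congr_fun (f := ρ ∘ₗ der k) (g := der k ∘ₗ ρ) ?_ a
    refine LinearMap.ext_on (span_cur_e B) ?_
    rintro _ (⟨⟨i, a⟩, rfl⟩ | rfl)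
    · simp only [LinearMap.comp_apply]
      rw [der_cur, ρcur, ρcur, pow_succ', Module.End.mul_apply]
    · simp only [LinearMap.comp_apply]
      rw [der_e, map_zero, ρe, hv]
  have base : ∀ n a c, ρ (nmul k n (cur B 0 a) (cur B 0 c)) = comm k n (x a) (x c) := by
    intro n a c
    match n with
    | 0 => rw [nmul_cur_zero, h0, ρcur, pow_zero, Module.End.one_apply]
    | 1 => rw [nmul_cur_one, h1, map_smul, ρe]
    | n + 2 => rw [nmul_cur_of_le B (by omega), h2 _ _ _ (by omega), map_zero]
  -- The relations for g extend to all ∂^i a and ∂^j c because both sides obey the same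
  -- sesquilinearity rules.
  have right : ∀ j n a c, ρ (nmul k n (cur B 0 a) (cur B j c)) =
      comm k n (x a) ((der k ^ j) (x c)) := by
    intro j
    induction j with
    | zero => exact base
    | succ j ih =>
      intro n a c
      rw [← der_cur, nmul_der, map_add, map_smul, ρder, ih, ih, pow_succ', Module.End.mul_apply,
        comm_der_right]
  have both : ∀ i j n a c, ρ (nmul k n (cur B i a) (cur B j c)) =
      comm k n ((der k ^ i) (x a)) ((der k ^ j) (x c)) := by
    intro i j
    induction i with
    | zero => exact right j
    | succ i ih =>
      intro n a c
      rw [← der_cur, der_nmul, map_neg, map_smul, ih, pow_succ', Module.End.mul_apply,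
        comm_der_left]
  refine ⟨ρ, fun a => (ρcur 0 a).trans rfl, ρe, ρder, fun n a c => ?_⟩
  have : (nmul k n).compr₂ ρ = (commBil k n).compl₁₂ ρ ρ := by
    refine LinearMap.ext_on (span_cur_e B) ?_
    rintro _ (⟨⟨i, a⟩, rfl⟩ | rfl)
    · refine LinearMap.ext_on (span_cur_e B) ?_
      rintro _ (⟨⟨j, c⟩, rfl⟩ | rfl)
      · change ρ (nmul k n (cur B i a) (cur B j c)) = comm k n (ρ (cur B i a)) (ρ (cur B j c))
        rw [both, ρcur, ρcur]
      · change ρ (nmul k n (cur B i a) (e B)) = comm k n (ρ (cur B i a)) (ρ (e B))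
        rw [nmul_eq_zero_of_der_right (der_e B), ρe, comm_eq_zero_of_der_right hv, map_zero]
    · refine LinearMap.ext fun c => ?_
      change ρ (nmul k n (e B) c) = comm k n (ρ (e B)) (ρ c)
      rw [nmul_eq_zero_of_der_left (der_e B), ρe, comm_eq_zero_of_der_left hv, map_zero]
  exact LinearMap.congr_fun (LinearMap.congr_fun this a) c

end KM

end KMHom

/-! ### A model of the universal envelope -/

section Model

variable {k g ι : Type*} (W : Type*) [Field k] [LieRing g] [LieAlgebra k g] [AddCommGroup W]
  [Module k W] (B : LinearMap.BilinForm k g) (b : Module.Basis ι k g)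

/-- The action of a letter on functions on words. -/
def letterOp (p : Option (ι × ℤ)) : Module.End k (affSpace W B b) where
  toFun f := ⟨fun u => f.1 (u ++ [p]), by
    obtain ⟨h1, h2, h3⟩ := f.2
    refine ⟨fun u q r v => ?_, fun u x y m n v => ?_, fun u v _ => ?_⟩
    · simpa [slot] using h1 u q r (v ++ [p])
    · simpa using h2 u x y m n (v ++ [p])
    · simpa using h3 u (v ++ [p]) (by simp)⟩
  map_add' _ _ := rfl
  map_smul' _ _ := rfl

theorem letterOp_apply (p : Option (ι × ℤ)) (f : affSpace W B b) (u : List (Option (ι × ℤ))) :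
    (letterOp W B b p f).1 u = f.1 (u ++ [p]) :=
  rfl

/-- Operators append letters on the right, so the product pq tests a function on words ending in p,
q. The Lie relations that define `affSpace`, at the end of a word, become relations between
operators. -/
theorem letterOp_comm (p q : Option (ι × ℤ)) :
    letterOp W B b p * letterOp W B b q - letterOp W B b q * letterOp W B b p =
      Finsupp.linearCombination k (letterOp W B b) (affBr B b p q) := by
  refine LinearMap.ext fun f => Subtype.ext (funext fun u => ?_)
  have h : ∀ x : Option (ι × ℤ) →₀ k,
      (Finsupp.linearCombination k (letterOp W B b) x f).1 u = slot f.1 u [] x := by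
    intro x
    induction x using Finsupp.induction_linear with
    | zero => simp
    | add x y hx hy =>
      rw [map_add, map_add, LinearMap.add_apply, ← hx, ← hy]
      rfl
    | single p c => rw [slot_single, Finsupp.linearCombination_single]; rfl
  rw [h, ← f.2.1 u p q []]
  change f.1 (u ++ [p] ++ [q]) - f.1 (u ++ [q] ++ [p]) = _
  simp

theorem letterOp_local (x y : ι) (m n : ℤ) :
    letterOp W B b (some (x, m)) * letterOp W B b (some (y, n)) +
        letterOp W B b (some (x, m - 2)) * letterOp W B b (some (y, n + 2)) =
      letterOp W B b (some (x, m - 1)) * letterOp W B b (some (y, n + 1)) +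
        letterOp W B b (some (x, m - 1)) * letterOp W B b (some (y, n + 1)) := by
  refine LinearMap.ext fun f => Subtype.ext (funext fun u => ?_)
  have := f.2.2.1 u x y m n []
  change f.1 (u ++ [_] ++ [_]) + f.1 (u ++ [_] ++ [_]) =
    f.1 (u ++ [_] ++ [_]) + f.1 (u ++ [_] ++ [_])
  simpa using this

theorem letterOp_mul_none (p : Option (ι × ℤ)) :
    letterOp W B b p * letterOp W B b none = 0 := by
  refine LinearMap.ext fun f => Subtype.ext (funext fun u => ?_)
  change f.1 (u ++ [_] ++ [_]) = 0
  simpa using f.2.2.2 (u ++ [p]) [] (by simp)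

/-- The formal distributions that correspond to the generators of `K(g)`. -/
noncomputable def genField : Option ι → Fields (Module.End k (affSpace W B b))
  | some i => fun m => letterOp W B b (some (i, m))
  | none => fun m => if m = -1 then letterOp W B b none else 0

theorem mode_genField_some (i : ι) (m : ℤ) :
    mode k m (genField W B b (some i)) = letterOp W B b (some (i, m)) :=
  rfl

theorem mode_genField_none (m : ℤ) :
    mode k m (genField W B b none) = if m = -1 then letterOp W B b none else 0 :=
  rfl

/-- Vanishing second differences make the first difference constant in both directions. This turns
the locality relations into explicit affine formulas in the modes. -/
theorem arith_prog {M : Type*} [AddCommGroup M] [Module k M] (a : ℤ → M)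
    (h : ∀ i, a i + a (i - 2) = a (i - 1) + a (i - 1)) (i : ℤ) :
    a i = a 0 + (i : k) • (a 1 - a 0) := by
  have h1 : ∀ i, a i - a (i - 1) = a 1 - a 0 := by
    intro i
    have step : ∀ j, a (j + 1) - a j = a j - a (j - 1) := by
      intro j
      have := h (j + 1)
      rw [show j + 1 - 2 = j - 1 by ring, show j + 1 - 1 = j by ring] at this
      rw [sub_eq_sub_iff_add_eq_add, this]
    induction i using Int.induction_on with
    | zero =>
      have := step 0
      rw [zero_add] at this
      exact this.symm
    | succ i ih => rw [add_sub_cancel_right, step, ih]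
    | pred i ih =>
      rw [← ih]
      have := step (-i - 1)
      rw [sub_add_cancel] at this
      exact this.symm
  induction i using Int.induction_on with
  | zero => simp
  | succ i ih =>
    have := h1 (i + 1)
    rw [add_sub_cancel_right, sub_eq_iff_eq_add, ih] at this
    rw [this]
    push_cast
    module
  | pred i ih =>
    have : a (-i - 1) = a (-i) - (a 1 - a 0) := by rw [← h1 (-i)]; abel
    rw [this, ih]
    push_cast
    module

/-- A coefficient of the n-product is an n-th difference of products of two letters with constant
total mode. These products are affine in the mode, and differences of order at least two kill affine
sequences. -/
theorem genField_local (i j : Option ι) (n : ℕ) (hn : 2 ≤ n) :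
    nmul k n (genField W B b i) (genField W B b j) = 0 := by
  refine fields_ext (k := k) fun m => ?_
  rw [mode_nmul, map_zero]
  -- The field of e has only the mode −1, whereas the left factor of an n-product enters with
  -- nonnegative modes.
  rcases i with _ | x
  · refine Finset.sum_eq_zero fun s _ => ?_
    rw [mode_genField_none, if_neg (by omega), zero_mul, smul_zero]
  rcases j with _ | y
  · refine Finset.sum_eq_zero fun s _ => ?_
    rw [mode_genField_none, mode_genField_some]
    split_ifs
    · rw [letterOp_mul_none, smul_zero]
    · rw [mul_zero, smul_zero]
  have key := arith_prog (k := k) (fun i : ℤ => letterOp W B b (some (x, n - i)) *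
    letterOp W B b (some (y, m + i))) (fun i => by
      have := letterOp_local W B b x y (n - i + 2) (m + i - 2)
      ring_nf at this ⊢
      rw [← this]
      abel)
  have : ∀ s ∈ Finset.range (n + 1), ((-1 : k) ^ s * (n.choose s : k)) •
      (mode k ((n - s : ℕ) : ℤ) (genField W B b (some x)) *
        mode k (m + s) (genField W B b (some y))) =
      ((-1 : k) ^ s * (n.choose s : k)) • (letterOp W B b (some (x, n - 0)) *
        letterOp W B b (some (y, m + 0))) + ((-1 : k) ^ s * (n.choose s : k) * s) •
      (letterOp W B b (some (x, n - 1)) * letterOp W B b (some (y, m + 1)) -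
        letterOp W B b (some (x, n - 0)) * letterOp W B b (some (y, m + 0))) := by
    intro s hs
    rw [Finset.mem_range] at hs
    have h1 : ((n - s : ℕ) : ℤ) = n - s := by omega
    rw [mode_genField_some, mode_genField_some, h1, key s, smul_add, smul_smul]
    simp
  rw [Finset.sum_congr rfl this, Finset.sum_add_distrib, ← Finset.sum_smul, ← Finset.sum_smul]
  have e1 : ∀ n : ℕ, n ≠ 0 → ∑ s ∈ Finset.range (n + 1), ((-1 : k) ^ s * (n.choose s : k)) = 0 := by
    intro n hn
    have := congrArg (Int.cast (R := k)) (Int.alternating_sum_range_choose_of_ne hn)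
    push_cast at this
    exact this
  have e2 : ∑ s ∈ Finset.range (n + 1), ((-1 : k) ^ s * (n.choose s : k) * s) = 0 := by
    obtain ⟨n, rfl⟩ : ∃ l, n = l + 1 := ⟨n - 1, by omega⟩
    rw [Finset.sum_range_succ']
    have : ∀ s ∈ Finset.range (n + 1), ((-1 : k) ^ (s + 1) * ((n + 1).choose (s + 1) : k) *
        (s + 1 : ℕ)) = -((n : k) + 1) * ((-1) ^ s * (n.choose s : k)) := by
      intro s _
      have h4 := congrArg (Nat.cast (R := k)) (Nat.add_one_mul_choose_eq n s)
      push_cast at h4 ⊢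
      linear_combination (-1) ^ s * h4
    rw [Finset.sum_congr rfl this, ← Finset.mul_sum, e1 n (by omega)]
    simp
  rw [e1 n (by omega), e2, zero_smul, zero_smul, add_zero]

end Model

/-! ### The relations of K(g) in the model and the homomorphism from the envelope -/

section ModelHom

variable {k g ι : Type*} (W : Type*) [Field k] [LieRing g] [LieAlgebra k g] [AddCommGroup W]
  [Module k W] (B : LinearMap.BilinForm k g) (b : Module.Basis ι k g)

/-- The coefficients of the formal distribution of an element of `g`. -/
noncomputable def vecMode (m : ℤ) (a : g) : Module.End k (affSpace W B b) :=
  Finsupp.linearCombination k (letterOp W B b) (modeEmb b m a)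

theorem letterOp_swap (i j : ι) (p q : ℤ) :
    letterOp W B b (some (j, q)) * letterOp W B b (some (i, p)) =
      letterOp W B b (some (i, p)) * letterOp W B b (some (j, q)) -
      (vecMode W B b (p + q) ⁅b i, b j⁆ +
        (if p + q = 0 then (p : k) * B (b i) (b j) else 0) • letterOp W B b none) := by
  have h := letterOp_comm W B b (some (i, p)) (some (j, q))
  rw [affBr, map_add, Finsupp.linearCombination_single] at h
  refine (sub_sub_cancel _ _).symm.trans (congrArg _ h)

theorem letterOp_prog (i j : ι) (N p : ℤ) :
    letterOp W B b (some (i, p)) * letterOp W B b (some (j, N - p)) =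
      letterOp W B b (some (i, 0)) * letterOp W B b (some (j, N)) +
      (p : k) • (letterOp W B b (some (i, 1)) * letterOp W B b (some (j, N - 1)) -
        letterOp W B b (some (i, 0)) * letterOp W B b (some (j, N))) := by
  have := arith_prog (k := k) (fun p : ℤ => letterOp W B b (some (i, p)) *
    letterOp W B b (some (j, N - p))) (fun p => by
      have := letterOp_local W B b i j p (N - p)
      ring_nf at this ⊢
      exact this) p
  simpa using this

/-- Every product is rewritten with i in front by `letterOp_swap` and then expressed through two
fixed products by `letterOp_prog`. The products cancel and one bracket term remains. -/
theorem genField_comm_zero (i j : ι) (m : ℤ) :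
    mode k m (nmul k 0 (genField W B b (some i)) (genField W B b (some j)) -
      nmul k 0 (genField W B b (some j)) (genField W B b (some i)) +
      der k (nmul k 1 (genField W B b (some j)) (genField W B b (some i)))) =
    vecMode W B b m ⁅b i, b j⁆ := by
  have h1 := letterOp_prog W B b i j m m
  have h2 := letterOp_prog W B b i j m (m - 1)
  rw [sub_self] at h1
  rw [sub_sub_cancel] at h2
  rw [map_add, map_sub, mode_der, mode_nmul, mode_nmul, mode_nmul]
  simp only [mode_genField_some, Finset.sum_range_succ, Finset.sum_range_zero]
  simp only [Nat.cast_zero, add_zero, Nat.sub_zero, Nat.choose_self, pow_zero, Nat.cast_one,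
    mul_one, one_smul, zero_add, Nat.choose_zero_right, pow_one, Nat.sub_self, sub_add_cancel]
  rw [letterOp_swap W B b i j m 0, letterOp_swap W B b i j (m - 1) 1, h1, h2, add_zero,
    sub_add_cancel]
  by_cases hm : m = 0
  · subst hm
    simp only [Int.cast_zero, zero_smul, zero_mul, ite_self]
    abel
  · simp only [hm, if_false]
    push_cast
    module

/-- As before, but now the two bracket terms cancel as well, and the central terms contribute (m +
1) − m = 1 times the form, only for m = −1. -/
theorem genField_comm_one (i j : ι) (m : ℤ) :
    mode k m (nmul k 1 (genField W B b (some i)) (genField W B b (some j)) +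
      nmul k 1 (genField W B b (some j)) (genField W B b (some i))) =
    B (b i) (b j) • mode k m (genField W B b none) := by
  have h1 := letterOp_prog W B b i j (m + 1) m
  have h2 := letterOp_prog W B b i j (m + 1) (m + 1)
  rw [add_sub_cancel_left] at h1
  rw [sub_self] at h2
  rw [add_sub_cancel_right] at h1 h2
  rw [map_add, mode_nmul, mode_nmul, mode_genField_none]
  simp only [mode_genField_some, Finset.sum_range_succ, Finset.sum_range_zero]
  simp only [Nat.cast_zero, add_zero, Nat.sub_zero, Nat.choose_self, pow_zero, Nat.cast_one,
    mul_one, one_smul, zero_add, Nat.choose_zero_right, pow_one, Nat.sub_self]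
  rw [letterOp_swap W B b i j m 1, letterOp_swap W B b i j (m + 1) 0, h1, h2, add_zero]
  by_cases hm : m = -1
  · subst hm
    simp
    module
  · have : m + 1 ≠ 0 := by omega
    simp only [hm, this, if_false]
    push_cast
    module

/-- The free associative conformal algebra maps to every space with `n`-products that satisfies
the laws and in which the images of the generators are local. -/
theorem AssConf.exists_hom {X V : Type*} [AddCommGroup V] [Module k V] [PreConformal k V]
    (h1 : ∀ (n : ℕ) (a b : V), nmul k n (der k a) b = -((n : k) • nmul k (n - 1) a b))
    (h2 : ∀ (n : ℕ) (a b : V),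
      nmul k n a (der k b) = der k (nmul k n a b) + (n : k) • nmul k (n - 1) a b)
    (h3 : IsAssoc k V) (N : X → X → ℕ) (f : X → V)
    (hf : ∀ x y n, N x y ≤ n → nmul k n (f x) (f y) = 0) :
    ∃ F : AssConf k N →ₗ[k] V, IsConfHom k F ∧ ∀ x, F (AssConf.gen k N x) = f x := by
  have hE := FreeMag.hom_eval (k := k) f
  have hx : ∀ x, FreeMag.eval k (der k) (fun n a b => nmul k n a b) f (FreeMag.of k x) = f x :=
    fun x => FreeMag.eval_single _ _ _ _
  obtain ⟨F, ⟨hF, hF'⟩, -⟩ := ConfQuot.existsUnique_lift {a : FreeMag k X | AssRel k N a} hE (by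
    intro s hs
    cases hs with
    | D_mul n a b =>
      rw [map_add, map_smul, hE.map_nmul, hE.map_nmul, hE.map_der, h1, neg_add_cancel]
    | mul_D n a b =>
      rw [map_sub, map_add, map_smul, hE.map_nmul, hE.map_der, hE.map_nmul, hE.map_der,
        hE.map_nmul, h2, sub_self]
    | assoc n m a b c =>
      rw [map_sub, map_sum, sub_eq_zero]
      simp only [map_smul, hE.map_nmul]
      exact h3 n m _ _ _
    | loc x y n h => rw [hE.map_nmul, hx, hx, hf x y n h])
  exact ⟨F, hF, fun x => (hF' _).trans (hx x)⟩

/-- The universal property of the envelope needs a target with locality, which formal distributions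
lack. The way around is V, the image of the free associative conformal algebra: it inherits locality
from the free algebra and embeds in the formal distributions, so the relations of K(g) can be
checked in V by comparing coefficients. -/
theorem exists_fieldHom [CharZero k] :
    ∃ F : UEnv k (KM.genFamily B b) (fun _ _ => 2) →ₗ[k]
        Fields (Module.End k (affSpace W B b)),
      IsConfHom k F ∧ ∀ i, F (UEnv.gen k (KM.genFamily B b) _ i) = genField W B b i := by
  obtain ⟨F, hF, hFg⟩ := AssConf.exists_hom (k := k) Fields.der_nmul Fields.nmul_der Fields.isAssoc
    (fun _ _ => 2) (genField W B b) (genField_local W B b)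
  obtain ⟨F', ⟨hF', hFF'⟩, -⟩ := ConfQuot.existsUnique_lift (k := k)
    {a : AssConf k fun _ _ : Option ι => 2 | F a = 0} hF fun s hs => hs
  set V := ConfQuot k {a : AssConf k fun _ _ : Option ι => 2 | F a = 0} with hV
  -- Injectivity holds by construction, since V is the quotient by everything that F kills.
  have hinj : ∀ v w : V, (∀ m, mode k m (F' v) = mode k m (F' w)) → v = w := by
    intro v w h
    obtain ⟨v, rfl⟩ := ConfQuot.mk_surjective _ v
    obtain ⟨w, rfl⟩ := ConfQuot.mk_surjective _ w
    rw [← sub_eq_zero, ← map_sub]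
    refine ConfQuot.mk_eq_zero ?_
    change F (v - w) = 0
    rw [map_sub, sub_eq_zero, ← hFF', ← hFF']
    exact fields_ext h
  let y : Option ι → V := fun i => ConfQuot.mk _ (AssConf.gen k _ i)
  have hy : ∀ i, F' (y i) = genField W B b i := fun i => (hFF' _).trans (hFg i)
  have hloc : ∀ i j n, 2 ≤ n → nmul k n (y i) (y j) = 0 := by
    intro i j n hn
    refine hinj _ _ fun m => ?_
    rw [hF'.map_nmul, hy, hy, genField_local W B b i j n hn, map_zero, map_zero, map_zero]
  let x : g →ₗ[k] V := b.constr k fun i => y (some i)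
  have hxb : ∀ i, x (b i) = y (some i) := fun i => b.constr_basis k _ i
  have hxm : ∀ a m, mode k m (F' (x a)) = vecMode W B b m a := by
    intro a m
    refine LinearMap.congr_fun (f := mode k m ∘ₗ F' ∘ₗ x)
      (g := Finsupp.linearCombination k (letterOp W B b) ∘ₗ modeEmb b m) ?_ a
    refine b.ext fun i => ?_
    simp only [LinearMap.comp_apply]
    rw [hxb, hy, mode_genField_some]
    simp [modeEmb]
  have bil : ∀ (n : ℕ) (β : g →ₗ[k] g →ₗ[k] V),
      (∀ i j, comm k n (y (some i)) (y (some j)) = β (b i) (b j)) →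
      ∀ a c, comm k n (x a) (x c) = β a c := by
    intro n β h a c
    refine LinearMap.congr_fun (LinearMap.congr_fun (f := (commBil k n).compl₁₂ x x) (g := β)
      (b.ext fun i => b.ext fun j => ?_) a) c
    change comm k n (x (b i)) (x (b j)) = _
    rw [hxb, hxb, h]
  obtain ⟨ρ, ρ0, ρe, ρd, ρn⟩ := KM.exists_hom (B := B) x (y none)
    -- The derivative of the field of e could be nonzero only in mode 0, where the factor m removes
    -- it.
    (hinj _ _ fun m => by
      rw [hF'.map_der, hy, mode_der, mode_genField_none, map_zero, map_zero, neg_eq_zero]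
      by_cases h : m = 0
      · simp [h]
      · rw [if_neg (by omega), smul_zero])
    (bil 0 ((brk k g).compr₂ x) fun i j => by
      change _ = x ⁅b i, b j⁆
      refine hinj _ _ fun m => ?_
      rw [hxm, comm_zero_of_local (hloc _ _), map_add, map_sub, hF'.map_der, hF'.map_nmul,
        hF'.map_nmul, hF'.map_nmul, hy, hy, genField_comm_zero])
    (bil 1 (B.compr₂ (LinearMap.toSpanSingleton k V (y none))) fun i j => by
      change _ = B (b i) (b j) • y none
      refine hinj _ _ fun m => ?_
      rw [map_smul, map_smul, comm_one_of_local (hloc _ _), map_add, hF'.map_nmul,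
        hF'.map_nmul, hy, hy, hy, genField_comm_one])
    (fun a c n hn => bil n 0 (fun i j => by
      rw [comm_of_local (hloc _ _) hn, hloc _ _ n hn]
      rfl) a c)
  have ρg : ∀ i, ρ (KM.genFamily B b i) = y i := by
    intro i
    cases i with
    | none => exact ρe
    | some i => exact (ρ0 (b i)).trans (hxb i)
  obtain ⟨G, ⟨hG, hGg⟩, -⟩ := UEnv.existsUnique_lift (k := k)
    (ConfQuot.assoc _ (AssConf.isAssoc _) : IsAssoc k V) (KM.genFamily B b) (fun _ _ => 2) ρ ρd ρn
    (fun i j n hn => by rw [ρg, ρg]; exact hloc i j n hn)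
  refine ⟨F' ∘ₗ G, ⟨fun a => ?_, fun n a c => ?_⟩, fun i => ?_⟩
  · rw [LinearMap.comp_apply, hG.map_der, hF'.map_der]
    rfl
  · rw [LinearMap.comp_apply, hG.map_nmul, hF'.map_nmul]
    rfl
  · rw [LinearMap.comp_apply, hGg, ρg, hy]

end ModelHom

/-! ### Monomials -/

section Monomials

variable {k X Y V W : Type*} [Field k] [AddCommGroup V] [Module k V] [AddCommGroup W] [Module k W]

/-- The monomial `L_0^{x_1} ⋯ L_0^{x_n} t`. -/
def wordMon (w : List X) (t : Mon X) : Mon X := w.foldr (fun x t => .mul 0 (.of x) t) t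

theorem deg_wordMon (w : List X) (t : Mon X) : (wordMon w t).deg = w.length + t.deg := by
  induction w with
  | nil => simp [wordMon]
  | cons x w ih =>
    change 1 + (wordMon w t).deg = _
    rw [ih, List.length_cons]
    omega

theorem deg_iterate_d (s : ℕ) (t : Mon X) : (Mon.d^[s] t).deg = t.deg := by
  induction s generalizing t with
  | zero => rfl
  | succ s ih => rw [Function.iterate_succ_apply, ih, Mon.deg]

theorem deg_pos (t : Mon X) : 0 < t.deg := by
  induction t with
  | of x => exact Nat.one_pos
  | d t ih => exact ih
  | mul n t u iht ihu => exact Nat.add_pos_left iht _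

theorem monVal_wordMon [PreConformal k V] (x : X → V) (w : List X) (t : Mon X) :
    monVal k x (wordMon w t) = w.foldr (fun i v => nmul k 0 (x i) v) (monVal k x t) := by
  induction w with
  | nil => rfl
  | cons i w ih => exact congrArg (nmul k 0 (x i)) ih

theorem monVal_iterate_d [PreConformal k V] (x : X → V) (s : ℕ) (t : Mon X) :
    monVal k x (Mon.d^[s] t) = (der k)^[s] (monVal k x t) := by
  induction s generalizing t with
  | zero => rfl
  | succ s ih => rw [Function.iterate_succ_apply, ih, Function.iterate_succ_apply]; rfl

theorem map_monVal [PreConformal k V] [PreConformal k W] {F : V →ₗ[k] W} (hF : IsConfHom k F)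
    (x : X → V) (t : Mon X) : F (monVal k x t) = monVal k (fun i => F (x i)) t := by
  induction t with
  | of i => rfl
  | d t ih => exact (hF.map_der _).trans (congrArg (der k) ih)
  | mul n t u iht ihu =>
    exact (hF.map_nmul n _ _).trans (congrArg₂ (fun a c => nmul k n a c) iht ihu)

/-- The monomial with renamed letters. -/
def Mon.map (h : X → Y) (t : Mon X) : Mon Y := t.eval Mon.d Mon.mul fun i => Mon.of (h i)

theorem deg_map (h : X → Y) (t : Mon X) : (t.map h).deg = t.deg := by
  induction t with
  | of i => rfl
  | d t ih => exact ih
  | mul n t u iht ihu => exact congrArg₂ (· + ·) iht ihu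

theorem monVal_map [PreConformal k V] (x : Y → V) (h : X → Y) (t : Mon X) :
    monVal k x (t.map h) = monVal k (fun i => x (h i)) t := by
  induction t with
  | of i => rfl
  | d t ih => exact congrArg (der k) ih
  | mul n t u iht ihu => exact congrArg₂ (fun a c => nmul k n a c) iht ihu

end Monomials

/-! ### Symbols of monomials -/

section Symbols

variable {k g ι : Type*} {W : Type*} [Field k] [LieRing g] [LieAlgebra k g] [AddCommGroup W]
  [Module k W] {B : LinearMap.BilinForm k g} {b : Module.Basis ι k g}

theorem prod_letterOp (l : List (Option (ι × ℤ))) (f : affSpace W B b)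
    (u : List (Option (ι × ℤ))) :
    (((l.map (letterOp W B b)).prod) f).1 u = f.1 (u ++ l) := by
  induction l generalizing u with
  | nil => simp
  | cons p l ih =>
    rw [List.map_cons, List.prod_cons, Module.End.mul_apply, letterOp_apply, ih]
    simp

/-- A combination of n-fold products of letters evaluates f at words that are exactly n letters
longer. -/
theorem apply_eq_zero_of_mem_pow {n : ℕ} {T : Module.End k (affSpace W B b)}
    (hT : T ∈ Submodule.span k (Set.range (letterOp W B b)) ^ n) {f : affSpace W B b}
    {u : List (Option (ι × ℤ))} (hf : ∀ w, w.length = u.length + n → f.1 w = 0) :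
    (T f).1 u = 0 := by
  induction n generalizing T u with
  | zero =>
    rw [pow_zero, Submodule.mem_one] at hT
    obtain ⟨c, rfl⟩ := hT
    rw [Module.algebraMap_end_apply]
    change c • f.1 u = 0
    rw [hf u rfl, smul_zero]
  | succ n ih =>
    rw [pow_succ'] at hT
    induction hT using Submodule.mul_induction_on' with
    | mem_mul_mem A hA C hC =>
      rw [Module.End.mul_apply]
      induction hA using Submodule.span_induction with
      | mem A hA =>
        obtain ⟨p, rfl⟩ := hA
        rw [letterOp_apply]
        refine ih hC fun w hw => hf w ?_
        simp only [List.length_append, List.length_singleton] at hw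
        omega
      | zero => rfl
      | add A A' _ _ h h' =>
        change (A (C f)).1 u + (A' (C f)).1 u = 0
        rw [h, h', add_zero]
      | smul c A _ h =>
        change c • (A (C f)).1 u = 0
        rw [h, smul_zero]
    | add A _ C _ h h' =>
      change (A f).1 u + (C f).1 u = 0
      rw [h, h', add_zero]

theorem mode_iterate_der {A : Type*} [Ring A] [Algebra k A] (s : ℕ) (a : Fields A) :
    mode k (-1) ((der k)^[s] a) = (Nat.factorial s : k) • mode k (-1 - s) a := by
  induction s generalizing a with
  | zero => simp
  | succ s ih =>
    rw [Function.iterate_succ_apply, ih, mode_der, Nat.factorial_succ, ← neg_smul, smul_smul]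
    congr 1
    · push_cast
      ring
    · congr 2
      push_cast
      ring

/-- Modes of products are combinations of products of modes, and ∂ only rescales and shifts modes.
So the degree of a monomial is the number of letters in its coefficients, which links the filtration
to word length. -/
theorem mode_mem_pow {X A V : Type*} [Ring A] [Algebra k A] [AddCommGroup V] [Module k V]
    [PreConformal k V] {x : X → V} {F : V →ₗ[k] Fields A} (hF : IsConfHom k F)
    {S : Submodule k A} (hx : ∀ i m, mode k m (F (x i)) ∈ S) (t : Mon X) (m : ℤ) :
    mode k m (F (monVal k x t)) ∈ S ^ t.deg := by
  induction t generalizing m with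
  | of i => exact (pow_one S).symm ▸ hx i m
  | d t ih =>
    change mode k m (F (der k (monVal k x t))) ∈ S ^ t.deg
    rw [hF.map_der, mode_der]
    exact Submodule.neg_mem _ (Submodule.smul_mem _ _ (ih (m - 1)))
  | mul n t u iht ihu =>
    change mode k m (F (nmul k n (monVal k x t) (monVal k x u))) ∈ S ^ (t.deg + u.deg)
    rw [hF.map_nmul, mode_nmul, pow_add]
    exact Submodule.sum_mem _ fun s _ =>
      Submodule.smul_mem _ _ (Submodule.mul_mem_mul (iht _) (ihu _))

theorem mode_genField_mem (i : Option ι) (m : ℤ) : mode k m (genField W B b i) ∈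
    Submodule.span k (Set.range (letterOp W B b)) := by
  cases i with
  | some i => exact Submodule.subset_span ⟨_, rfl⟩
  | none =>
    rw [mode_genField_none]
    split_ifs
    · exact Submodule.subset_span ⟨_, rfl⟩
    · exact Submodule.zero_mem _

variable {V : Type*} [AddCommGroup V] [Module k V] [PreConformal k V] {x : Option ι → V}
  {F : V →ₗ[k] Fields (Module.End k (affSpace W B b))}

theorem mode_wordMon (hF : IsConfHom k F) (hx : ∀ i, F (x i) = genField W B b i) (w : List ι)
    (t : Mon ι) (m : ℤ) : mode k m (F (monVal k (fun i => x (some i)) (wordMon w t))) =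
      ((w.map fun i => some (i, (0 : ℤ))).map (letterOp W B b)).prod *
        mode k m (F (monVal k (fun i => x (some i)) t)) := by
  induction w with
  | nil => rw [List.map_nil, List.map_nil, List.prod_nil, one_mul]; rfl
  | cons i w ih =>
    change mode k m (F (nmul k 0 (x (some i)) (monVal k _ (wordMon w t)))) = _
    rw [hF.map_nmul, mode_nmul, Finset.sum_range_one, Nat.cast_zero, add_zero, ih, hx,
      List.map_cons, List.map_cons, List.prod_cons, mul_assoc]
    simp [mode_genField_some]

theorem mode_iterate_d (hF : IsConfHom k F) (hx : ∀ i, F (x i) = genField W B b i) (s : ℕ)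
    (z : ι) : mode k (-1) (F (monVal k (fun i => x (some i)) (Mon.d^[s] (.of z)))) =
      (Nat.factorial s : k) • letterOp W B b (some (z, -1 - s)) := by
  rw [map_monVal hF, monVal_iterate_d, mode_iterate_der]
  change _ • mode k _ (F (x (some z))) = _
  rw [hx, mode_genField_some]

theorem mode_mul_one (hF : IsConfHom k F) (hx : ∀ i, F (x i) = genField W B b i) (y z : ι) :
    mode k (-1) (F (monVal k (fun i => x (some i)) (.mul 1 (.of y) (.of z)))) =
      letterOp W B b (some (y, 1)) * letterOp W B b (some (z, -1)) -
        letterOp W B b (some (y, 0)) * letterOp W B b (some (z, 0)) := by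
  change mode k _ (F (nmul k 1 (x (some y)) (x (some z)))) = _
  rw [hF.map_nmul, hx, hx, mode_nmul]
  simp only [Finset.sum_range_succ, Finset.sum_range_zero, mode_genField_some]
  simp
  module

/-- Letters in mode 0 contribute to the multiset only. These are the letters that come from the
operators L_0. -/
theorem wordSymbol_zero_append (w : List ι) (l : List (ι × ℤ)) :
    wordSymbol k ((w.map fun i => (i, (0 : ℤ))) ++ l) = (l.map fun p => (p.2 : k) •
      Finsupp.single (((w ++ l.map Prod.fst : List ι) : Multiset ι), p.1, (l.map Prod.snd).sum)
        (1 : k)).sum := by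
  have h0 : ∀ w : List ι, (w.map fun _ => (0 : ℤ)).sum = 0 := fun w => by simp
  have h1 : ∀ (w : List ι) (f : ι → Multiset ι × ι × ℤ →₀ k),
      (w.map fun i => ((0 : ℤ) : k) • f i).sum = 0 := fun w f => by simp
  rw [wordSymbol]
  simp only [List.map_append, List.map_map, List.sum_append, Function.comp_def]
  rw [h0, h1, zero_add]
  simp

/-- Every function in `affSpace` defines a linear function on the envelope of `K(g)`. -/
theorem exists_functional [CharZero k] (f : affSpace W B b) :
    ∃ σ : UEnv k (KM.genFamily B b) (fun _ _ => 2) →ₗ[k] W,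
      σ (UEnv.gen k _ _ none) = f.1 [none] ∧
      (∀ t, (∀ w, w.length = Mon.deg t → f.1 w = 0) → σ (monVal k (UEnv.gen k _ _) t) = 0) ∧
      (∀ w s z, σ (monVal k (fun i => UEnv.gen k (KM.genFamily B b) _ (some i))
          (wordMon w (Mon.d^[s] (.of z)))) =
        (Nat.factorial s : k) • f.1 (((w.map fun i => (i, (0 : ℤ))) ++ [(z, -1 - (s : ℤ))]).map
          some)) ∧
      ∀ w y z, σ (monVal k (fun i => UEnv.gen k (KM.genFamily B b) _ (some i))
          (wordMon w (.mul 1 (.of y) (.of z)))) =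
        f.1 (((w.map fun i => (i, (0 : ℤ))) ++ [(y, 1), (z, -1)]).map some) -
          f.1 (((w.map fun i => (i, (0 : ℤ))) ++ [(y, 0), (z, 0)]).map some) := by
  obtain ⟨F, hF, hx⟩ := exists_fieldHom W B b
  -- A product of letters, applied to f and evaluated at the empty word, returns f of the
  -- corresponding word. The coefficient −1 is used because it turns ∂^s z into s! z(−1−s), so that
  -- different powers of ∂ are told apart.
  let ev : Module.End k (affSpace W B b) →ₗ[k] W :=
    { toFun := fun T => (T f).1 []
      map_add' := fun _ _ => rfl
      map_smul' := fun _ _ => rfl }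
  have evl : ∀ l : List (Option (ι × ℤ)), ev (l.map (letterOp W B b)).prod = f.1 l := fun l =>
    prod_letterOp l f []
  refine ⟨ev ∘ₗ mode k (-1) ∘ₗ F, ?_, fun t ht => ?_, fun w s z => ?_, fun w y z => ?_⟩
  · change ev (mode k (-1) (F _)) = _
    rw [hx, mode_genField_none, if_pos rfl]
    rfl
  · exact apply_eq_zero_of_mem_pow
      (mode_mem_pow hF (fun i m => by rw [hx]; exact mode_genField_mem i m) t _) fun w hw => ht w (by simpa using hw)
  · change ev (mode k (-1) (F _)) = _
    have h1 : ((w.map fun i => some (i, (0 : ℤ))).map (letterOp W B b)).prod *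
        letterOp W B b (some (z, -1 - (s : ℤ))) =
        ((((w.map fun i => (i, (0 : ℤ))) ++ [(z, -1 - (s : ℤ))]).map some).map
          (letterOp W B b)).prod := by
      simp [Function.comp_def]
    rw [mode_wordMon hF hx, mode_iterate_d hF hx, mul_smul_comm, map_smul, h1, evl]
  · change ev (mode k (-1) (F _)) = _
    have h1 : ∀ p q : ι × ℤ, ((w.map fun i => some (i, (0 : ℤ))).map (letterOp W B b)).prod *
          (letterOp W B b (some p) * letterOp W B b (some q)) =
        ((((w.map fun i => (i, (0 : ℤ))) ++ [p, q]).map some).map (letterOp W B b)).prod := by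
      intro p q
      simp [Function.comp_def]
    have h2 : ∀ A C D : Module.End k (affSpace W B b), ev (A * (C - D)) = ev (A * C) - ev (A * D) :=
      fun A C D => (congrArg ev (mul_sub A C D)).trans (map_sub ev _ _)
    rw [mode_wordMon hF hx, mode_mul_one hF hx, h2, h1, h1, evl, evl]

/-- Linear functions on the envelope of `K(g)` that vanish in low degree and separate the symbols
of the basic monomials. -/
theorem exists_symbolFamily [CharZero k] (hB : ∀ x y, B x y = B y x)
    (hB' : ∀ x y z, B ⁅x, y⁆ z = B x ⁅y, z⁆) :
    ∃ σ : ℕ → UEnv k (KM.genFamily B b) (fun _ _ => 2) →ₗ[k] (Multiset ι × ι × ℤ →₀ k),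
      (∀ N t, Mon.deg t < N → σ N (monVal k (UEnv.gen k _ _) t) = 0) ∧
      (∀ w s z, σ (w.length + 1) (monVal k (fun i => UEnv.gen k (KM.genFamily B b) _ (some i))
          (wordMon w (Mon.d^[s] (.of z)))) = -(Nat.factorial (s + 1) : k) •
            Finsupp.single (((w ++ [z] : List ι) : Multiset ι), z, -1 - (s : ℤ)) 1) ∧
      ∀ w y z, σ (w.length + 2) (monVal k (fun i => UEnv.gen k (KM.genFamily B b) _ (some i))
          (wordMon w (.mul 1 (.of y) (.of z)))) =
        Finsupp.single (((w ++ [y, z] : List ι) : Multiset ι), y, 0) 1 -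
          Finsupp.single (((w ++ [y, z] : List ι) : Multiset ι), z, 0) 1 := by
  choose f hf hf0 hfs using exists_symbol (k := k) b hB hB'
  choose σ _ hσ hσ1 hσ2 using fun N => exists_functional ⟨f N, hf N⟩
  refine ⟨σ, fun N t ht => hσ N t fun w hw => hf0 N w (hw.trans_lt ht), fun w s z => ?_,
    fun w y z => ?_⟩
  · rw [hσ1]
    change _ • f _ _ = _
    -- The only nonzero mode is −1 − s, and s! (−1 − s) = −(s + 1)!.
    rw [hfs _ _ (by simp), wordSymbol_zero_append, Nat.factorial_succ]
    simp only [List.map_cons, List.map_nil, List.sum_cons, List.sum_nil, add_zero, smul_smul]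
    congr 1
    push_cast
    ring
  -- All modes of the subtracted word are zero, so its symbol vanishes; the modes 1 and −1 of the
  -- other word give the two coefficients.
  · rw [hσ2]
    change f _ _ - f _ _ = _
    rw [hfs _ _ (by simp), hfs _ _ (by simp), wordSymbol_zero_append, wordSymbol_zero_append]
    simp [sub_eq_add_neg]

/-- The linear function on the envelope of `K(g)` that detects the central element. -/
theorem exists_centralFunctional [CharZero k] (hB : ∀ x y, B x y = B y x)
    (hB' : ∀ x y z, B ⁅x, y⁆ z = B x ⁅y, z⁆) :
    ∃ τ : UEnv k (KM.genFamily B b) (fun _ _ => 2) →ₗ[k] k,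
      τ (UEnv.gen k _ _ none) = 1 ∧
      ∀ s z, τ (monVal k (fun i => UEnv.gen k (KM.genFamily B b) _ (some i))
        (Mon.d^[s] (.of z))) = 0 := by
  obtain ⟨f, hf, hf1, hf0⟩ := exists_central (k := k) b hB hB'
  obtain ⟨τ, hτ, -, hτ1, -⟩ := exists_functional ⟨f, hf⟩
  refine ⟨τ, hτ.trans hf1, fun s z => (hτ1 [] s z).trans ?_⟩
  exact (congrArg _ (hf0 _)).trans (smul_zero _)

end Symbols

/-! ### Commuting elements of associative conformal algebras -/

section Commuting

variable {k V : Type*} [Field k] [AddCommGroup V] [Module k V] [ConformalAlgebra k V]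

/-- Elements whose commutators all vanish. -/
def Commuting (k : Type*) {V : Type*} [Field k] [AddCommGroup V] [Module k V]
    [ConformalAlgebra k V] (a b : V) : Prop :=
  ∀ n, comm k n a b = 0

theorem Commuting.nmul_eq {a b : V} (h : Commuting k a b) (n M : ℕ)
    (hM : ∀ j, n + M ≤ j → nmul k j b a = 0) : nmul k n a b =
      ∑ s ∈ Finset.range M, ((-1 : k) ^ (n + s) * ((Nat.factorial s : k))⁻¹) •
        (der k ^ s) (nmul k (n + s) b a) := by
  rw [← rmul_eq_sum n M a b hM]
  exact sub_eq_zero.1 (h n)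

variable [CharZero k]

theorem inv_factorial_mul (s t : ℕ) : ((Nat.factorial s : k))⁻¹ * ((Nat.factorial t : k))⁻¹ =
    ((Nat.factorial (s + t) : k))⁻¹ * ((s + t).choose s : k) := by
  have h := congrArg (Nat.cast (R := k)) (Nat.add_choose_mul_factorial_mul_factorial s t)
  have h1 : (Nat.factorial s : k) ≠ 0 := Nat.cast_ne_zero.2 (Nat.factorial_ne_zero s)
  have h2 : (Nat.factorial t : k) ≠ 0 := Nat.cast_ne_zero.2 (Nat.factorial_ne_zero t)
  have h3 : (Nat.factorial (s + t) : k) ≠ 0 := Nat.cast_ne_zero.2 (Nat.factorial_ne_zero (s + t))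
  push_cast at h
  rw [Nat.choose_symm_add]
  field_simp
  linear_combination -h

/-- Substituting the formula for a(n)b into {a(n)b} gives a double sum. Its terms of order r in ∂
carry an alternating sum of binomial coefficients, which is zero unless r = 0. -/
theorem Commuting.symm {a b : V} (h : Commuting k a b) : Commuting k b a := by
  intro n
  obtain ⟨M₁, h₁⟩ := exists_local (k := k) a b
  obtain ⟨M₂, h₂⟩ := exists_local (k := k) b a
  set M := M₁ + M₂ + 1 with hM
  rw [comm, rmul_eq_sum n M b a (fun j hj => h₁ j (by omega)), sub_eq_zero, eq_comm]
  have h3 : ∀ s ∈ Finset.range M, ((-1 : k) ^ (n + s) * ((Nat.factorial s : k))⁻¹) •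
      (der k ^ s) (nmul k (n + s) a b) = ∑ t ∈ Finset.range (M - s),
        ((-1 : k) ^ t * (((Nat.factorial (s + t) : k))⁻¹ * ((s + t).choose s : k))) •
          (der k ^ (s + t)) (nmul k (n + (s + t)) b a) := by
    intro s hs
    rw [Finset.mem_range] at hs
    rw [h.nmul_eq (n + s) (M - s) (fun j hj => h₂ j (by omega)), map_sum, Finset.smul_sum]
    refine Finset.sum_congr rfl fun t _ => ?_
    rw [map_smul, smul_smul, ← Module.End.mul_apply, ← pow_add, add_assoc, ← inv_factorial_mul]
    congr 1
    have : (-1 : k) ^ (n + s) * (-1) ^ (n + (s + t)) = (-1) ^ t := by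
      rw [← pow_add, show n + s + (n + (s + t)) = 2 * (n + s) + t by ring, pow_add, pow_mul]
      simp
    linear_combination ((Nat.factorial s : k))⁻¹ * ((Nat.factorial t : k))⁻¹ * this
  rw [Finset.sum_congr rfl h3, ← Finset.sum_range_diag_flip M fun s t =>
    ((-1 : k) ^ t * (((Nat.factorial (s + t) : k))⁻¹ * ((s + t).choose s : k))) •
          (der k ^ (s + t)) (nmul k (n + (s + t)) b a), Finset.sum_eq_single 0]
  · simp
  · intro r _ hr
    have h4 : ∀ s ∈ Finset.range (r + 1), ((-1 : k) ^ (r - s) *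
        (((Nat.factorial (s + (r - s)) : k))⁻¹ * ((s + (r - s)).choose s : k))) •
          (der k ^ (s + (r - s))) (nmul k (n + (s + (r - s))) b a) =
        ((-1 : k) ^ r * ((Nat.factorial r : k))⁻¹ * ((-1) ^ s * (r.choose s : k))) •
          (der k ^ r) (nmul k (n + r) b a) := by
      intro s hs
      rw [Finset.mem_range] at hs
      rw [show s + (r - s) = r by omega]
      congr 1
      have : (-1 : k) ^ r * (-1) ^ s = (-1) ^ (r - s) := by
        rw [← pow_add, show r + s = (r - s) + 2 * s by omega, pow_add, pow_mul]
        simp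
      rw [← this]
      ring
    have h5 := congrArg (Int.cast (R := k)) (Int.alternating_sum_range_choose_of_ne hr)
    push_cast at h5
    rw [Finset.sum_congr rfl h4, ← Finset.sum_smul, ← Finset.mul_sum, h5, mul_zero, zero_smul]
  · intro h
    exact absurd (Finset.mem_range.2 (by omega)) h

theorem nmul_iterate_der_left (s m : ℕ) (a c : V) : nmul k m ((der k ^ s) a) c =
    ((-1 : k) ^ s * (m.descFactorial s : k)) • nmul k (m - s) a c := by
  induction s generalizing m with
  | zero => simp
  | succ s ih =>
    rw [pow_succ', Module.End.mul_apply, der_nmul, ih, smul_smul, ← neg_smul]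
    rcases m with _ | m
    · simp
    · rw [Nat.succ_descFactorial_succ, Nat.add_sub_cancel, Nat.add_sub_add_right]
      congr 1
      push_cast
      ring

/-- Left multiplications by commuting elements commute. -/
theorem Commuting.left_comm (hV : IsAssoc k V) {a b : V} (h : Commuting k a b) (n m : ℕ) (c : V) :
    nmul k n a (nmul k m b c) = nmul k m b (nmul k n a c) := by
  -- Under φ and ψ the monomial x^i y^j stands for a(i)(b(j)c) and b(j)(a(i)c). By associativity (x
  -- − y)^n y^m and (y − x)^n x^m then stand for (a(n)b)(m)c and (b(n)a)(m)c.
  set φ := polyEval (k := k) fun i j _ => nmul k i a (nmul k j b c) with hφ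
  set ψ := polyEval (k := k) fun i j _ => nmul k j b (nmul k i a c) with hψ
  set x : MvPolynomial (Fin 3) k := MvPolynomial.X 0 with hx
  set y : MvPolynomial (Fin 3) k := MvPolynomial.X 1 with hy
  have φm : ∀ i j : ℕ, φ (x ^ i * y ^ j) = nmul k i a (nmul k j b c) := fun i j => by
    simpa using polyEval_mon (k := k) (fun i j _ => nmul k i a (nmul k j b c)) i j 0
  have ψm : ∀ i j : ℕ, ψ (x ^ i * y ^ j) = nmul k j b (nmul k i a c) := fun i j => by
    simpa using polyEval_mon (k := k) (fun i j _ => nmul k j b (nmul k i a c)) i j 0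
  have φa : ∀ n m : ℕ, φ ((x - y) ^ n * y ^ m) = nmul k m (nmul k n a b) c := by
    intro n m
    rw [hV, sub_pow_smul (k := k), Finset.sum_mul, map_sum]
    refine Finset.sum_congr rfl fun s _ => ?_
    rw [smul_mul_assoc, map_smul, mul_assoc, ← pow_add, φm, add_comm s m]
  have ψa : ∀ n m : ℕ, ψ ((y - x) ^ n * x ^ m) = nmul k m (nmul k n b a) c := by
    intro n m
    rw [hV, sub_pow_smul (k := k), Finset.sum_mul, map_sum]
    refine Finset.sum_congr rfl fun s _ => ?_
    rw [smul_mul_assoc, map_smul, mul_assoc, ← pow_add, mul_comm (y ^ _), ψm, add_comm s m]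
  -- Commutation of a and b matches the expansion of y^m = ((y − x) + x)^m: the derivatives act on
  -- the left factor and produce the binomial coefficients.
  have key : ∀ n m : ℕ, φ ((x - y) ^ n * y ^ m) = ψ ((x - y) ^ n * y ^ m) := by
    intro n m
    obtain ⟨M, hM⟩ := exists_local (k := k) b a
    have e1 : (x - y) ^ n * y ^ m = ∑ s ∈ Finset.range (m + 1), ((-1 : k) ^ n * (m.choose s : k)) •
        ((y - x) ^ (n + s) * x ^ (m - s)) := by
      have : y ^ m = ((y - x) + x) ^ m := by ring
      rw [this, add_pow, Finset.mul_sum]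
      refine Finset.sum_congr rfl fun s _ => ?_
      rw [← neg_sub y x, neg_pow, Algebra.smul_def]
      simp only [map_mul, map_pow, map_neg, map_one, map_natCast]
      ring
    rw [φa, h.nmul_eq n (M + (m + 1)) (fun j hj => hM j (by omega)), map_sum, LinearMap.sum_apply,
      e1, map_sum]
    have e2 : ∀ s, nmul k m (((-1 : k) ^ (n + s) * ((Nat.factorial s : k))⁻¹) •
        (der k ^ s) (nmul k (n + s) b a)) c = ψ (((-1 : k) ^ n * (m.choose s : k)) •
        ((y - x) ^ (n + s) * x ^ (m - s))) := by
      intro s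
      rw [map_smul, LinearMap.smul_apply, nmul_iterate_der_left, map_smul, ψa, smul_smul]
      congr 1
      have h1 : (Nat.factorial s : k) ≠ 0 := Nat.cast_ne_zero.2 (Nat.factorial_ne_zero s)
      rw [Nat.descFactorial_eq_factorial_mul_choose, pow_add]
      have h2 : (-1 : k) ^ s * (-1) ^ s = 1 := by rw [← mul_pow]; simp
      push_cast
      field_simp
      linear_combination (m.choose s : k) * h2
    rw [Finset.sum_congr rfl fun s _ => e2 s]
    refine (Finset.sum_subset (Finset.range_mono (by omega)) fun s _ hs => ?_).symm
    rw [Finset.mem_range, not_lt] at hs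
    rw [Nat.choose_eq_zero_of_lt (by omega)]
    simp
  -- Powers of x − y times powers of y span all monomials, so `key` shows that φ and ψ agree on
  -- them.
  have e3 : x ^ n * y ^ m = ∑ s ∈ Finset.range (n + 1), (n.choose s : k) •
      ((x - y) ^ s * y ^ (n - s + m)) := by
    have : x ^ n = ((x - y) + y) ^ n := by ring
    rw [this, add_pow, Finset.sum_mul]
    refine Finset.sum_congr rfl fun s _ => ?_
    rw [Algebra.smul_def, map_natCast]
    ring
  rw [← φm, ← ψm, e3, map_sum, map_sum]
  simp only [map_smul, key]

/-- On sequences m ↦ b(m)v, applying ∂ to v acts as D + K, where D is the termwise derivative and K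
is the weighted shift. These commute, so the binomial theorem applies. -/
theorem nmul_iterate_der_right (b v : V) (m t : ℕ) :
    nmul k m b ((der k ^ t) v) = ∑ s ∈ Finset.range (t + 1),
      ((t.choose s : k) * (m.descFactorial (t - s) : k)) •
        (der k ^ s) (nmul k (m - (t - s)) b v) := by
  let D : Module.End k (ℕ → V) := (der k).compLeft ℕ
  let K : Module.End k (ℕ → V) := LinearMap.pi fun m => (m : k) • LinearMap.proj (m - 1)
  let L : V →ₗ[k] ℕ → V := LinearMap.pi fun m => nmul k m b
  have hL : ∀ t v, L ((der k ^ t) v) = ((D + K) ^ t) (L v) := by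
    intro t
    induction t with
    | zero => intro v; rfl
    | succ t ih =>
      intro v
      rw [pow_succ, Module.End.mul_apply, ih, pow_succ, Module.End.mul_apply]
      exact congrArg _ (funext fun m => nmul_der m b v)
  have hDK : Commute D K := by
    refine LinearMap.ext fun w => funext fun m => ?_
    exact map_smul (der k) (m : k) (w (m - 1))
  have hK : ∀ j w m, (K ^ j) w m = (m.descFactorial j : k) • w (m - j) := by
    intro j
    induction j with
    | zero => intro w m; simp
    | succ j ih =>
      intro w m
      rw [pow_succ', Module.End.mul_apply]
      change (m : k) • (K ^ j) w (m - 1) = _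
      rw [ih, smul_smul]
      rcases m with _ | m
      · simp
      · rw [Nat.succ_descFactorial_succ, Nat.add_sub_cancel, Nat.add_sub_add_right]
        push_cast
        rfl
  have hD : ∀ s w m, (D ^ s) w m = (der k ^ s) (w m) := by
    intro s
    induction s with
    | zero => intro w m; rfl
    | succ s ih =>
      intro w m
      rw [pow_succ, Module.End.mul_apply, ih, pow_succ, Module.End.mul_apply]
      rfl
  have h := congrFun (hL t v) m
  rw [hDK.add_pow, LinearMap.sum_apply, Finset.sum_apply] at h
  refine h.trans (Finset.sum_congr rfl fun s _ => ?_)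
  rw [(Nat.cast_commute (t.choose s) (D ^ s * K ^ (t - s))).eq.symm, ← nsmul_eq_mul,
    ← Nat.cast_smul_eq_nsmul k]
  change (t.choose s : k) • (D ^ s) ((K ^ (t - s)) (L v)) m = _
  rw [hD, hK, map_smul, smul_smul]
  rfl

/-- An element that commutes with two elements commutes with their products. -/
theorem Commuting.nmul_right (hV : IsAssoc k V) {a b c : V} (hb : Commuting k a b)
    (hc : Commuting k a c) (m : ℕ) : Commuting k a (nmul k m b c) := by
  intro n
  obtain ⟨M₀, hM₀⟩ := exists_local (k := k) c a
  set M := M₀ + m + 1 with hM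
  have hz : ∀ j, M₀ ≤ j → nmul k j (nmul k m b c) a = 0 := fun j hj => by
    rw [hV]
    refine Finset.sum_eq_zero fun s _ => ?_
    rw [hM₀ _ (by omega), map_zero, smul_zero]
  rw [comm, rmul_eq_sum n M _ _ (fun j hj => hz j (by omega)), sub_eq_zero, hb.left_comm hV,
    hc.nmul_eq n M (fun j hj => hM₀ j (by omega)), map_sum]
  -- Both sides are sums of the same terms over s + j < M, one arranged by diagonals and the other
  -- by rows.
  let G : ℕ → ℕ → V := fun s j => ((-1 : k) ^ (n + s + j) * ((Nat.factorial s : k))⁻¹ *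
    (m.choose j : k)) • (der k ^ s) (nmul k (m - j) b (nmul k (n + s + j) c a))
  have h1 : ∀ t ∈ Finset.range M, nmul k m b (((-1 : k) ^ (n + t) *
      ((Nat.factorial t : k))⁻¹) • (der k ^ t) (nmul k (n + t) c a)) =
      ∑ s ∈ Finset.range (t + 1), G s (t - s) := by
    intro t _
    rw [map_smul, nmul_iterate_der_right, Finset.smul_sum]
    refine Finset.sum_congr rfl fun s hs => ?_
    rw [Finset.mem_range] at hs
    have ht : n + s + (t - s) = n + t := by omega
    simp only [G, ht, smul_smul]
    congr 1
    have h2 := inv_factorial_mul (k := k) s (t - s)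
    have h3 : (Nat.factorial (t - s) : k) ≠ 0 := Nat.cast_ne_zero.2 (Nat.factorial_ne_zero _)
    rw [show s + (t - s) = t by omega] at h2
    rw [Nat.descFactorial_eq_factorial_mul_choose]
    push_cast
    have h4 : ((Nat.factorial s : k))⁻¹ = ((Nat.factorial t : k))⁻¹ * (t.choose s : k) *
        (Nat.factorial (t - s) : k) := by
      rw [← h2]
      field_simp
    rw [h4]
    ring
  have h2 : ∀ s ∈ Finset.range M, ((-1 : k) ^ (n + s) * ((Nat.factorial s : k))⁻¹) •
      (der k ^ s) (nmul k (n + s) (nmul k m b c) a) = ∑ j ∈ Finset.range (M - s), G s j := by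
    intro s _
    rw [hV, map_sum, Finset.smul_sum]
    have h3 : ∀ j ∈ Finset.range (m + 1), ((-1 : k) ^ (n + s) * ((Nat.factorial s : k))⁻¹) •
        (der k ^ s) (((-1 : k) ^ j * (m.choose j : k)) •
          nmul k (m - j) b (nmul k (n + s + j) c a)) = G s j := by
      intro j _
      simp only [G, map_smul, smul_smul]
      congr 1
      ring
    rw [Finset.sum_congr rfl h3]
    -- The ranges j ≤ m and j < M − s differ only in terms that vanish by locality of c and a or
    -- because the binomial coefficient is zero.
    refine Finset.sum_congr_of_eq_on_inter (f := G s) (g := G s) ?_ ?_ fun _ _ _ => rfl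
    · intro j _ hj
      rw [Finset.mem_range, not_lt] at hj
      simp only [G]
      rw [hM₀ _ (by omega), map_zero, map_zero, smul_zero]
    · intro j _ hj
      rw [Finset.mem_range, not_lt] at hj
      simp only [G]
      rw [Nat.choose_eq_zero_of_lt (by omega)]
      simp
  rw [Finset.sum_congr rfl h1, Finset.sum_congr rfl h2, Finset.sum_range_diag_flip]

theorem Commuting.der_right {a b : V} (h : Commuting k a b) : Commuting k a (der k b) := by
  intro n
  rw [comm_der_right, h, h, map_zero, smul_zero, add_zero]

theorem Commuting.monVal {X : Type*} (hV : IsAssoc k V) {x : X → V} {a : V}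
    (h : ∀ i, Commuting k a (x i)) (t : Mon X) : Commuting k a (monVal k x t) := by
  induction t with
  | of i => exact h i
  | d t ih => exact ih.der_right
  | mul n t u iht ihu => exact iht.nmul_right hV ihu n

/-- An associative conformal algebra with commuting generators is commutative. -/
theorem isComm_of_generators {X : Type*} (hV : IsAssoc k V) (x : X → V)
    (hspan : Submodule.span k (Set.range (monVal k x)) = ⊤)
    (h : ∀ i j, Commuting k (x i) (x j)) : IsComm k V := by
  intro n a b
  refine LinearMap.congr_fun (LinearMap.congr_fun (f := commBil k n) (g := 0) ?_ a) b
  refine LinearMap.ext_on hspan ?_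
  rintro _ ⟨t, rfl⟩
  refine LinearMap.ext_on hspan ?_
  rintro _ ⟨u, rfl⟩
  exact Commuting.monVal hV (fun i => (Commuting.monVal hV (fun j => h i j) t).symm) u n

end Commuting

/-! ### Spanning by the basic monomials -/

/-- The monomials whose values are the basic monomials. -/
def basicMon {Y : Type*} [LinearOrder Y] : Index₁ Y ⊕ Index₂ Y → Mon Y
  | .inl p => wordMon p.1.1 (Mon.d^[p.1.2.1] (.of p.1.2.2))
  | .inr p => wordMon p.1.1 (.mul 1 (.of p.1.2.1) (.of p.1.2.2))

theorem monVal_basicMon {k Y : Type*} [Field k] [LinearOrder Y] (N : Y → Y → ℕ)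
    (p : Index₁ Y ⊕ Index₂ Y) :
    monVal k (ComConf.gen k N) (basicMon p) = basicMonomial k N p := by
  rcases p with p | p
  · refine (monVal_wordMon _ _ _).trans ?_
    rw [monVal_iterate_d]
    rfl
  · exact monVal_wordMon _ _ _

section Spanning

variable {k V Y : Type*} [Field k] [AddCommGroup V] [Module k V]
  [ConformalAlgebra k V] (hV : IsAssoc k V) {x : Y → V} (hc : ∀ i j, Commuting k (x i) (x j))
  (hx : ∀ i j n, 2 ≤ n → nmul k n (x i) (x j) = 0)

/-- As a product of endomorphisms the fold is visibly linear in its last argument. -/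
theorem foldr_eq_prod (w : List Y) (v : V) : w.foldr (fun j v => nmul k 0 (x j) v) v =
    (w.map fun j => (nmul k 0 (x j) : Module.End k V)).prod v := by
  induction w with
  | nil => rfl
  | cons j w ih => rw [List.foldr_cons, ih, List.map_cons, List.prod_cons]; rfl

theorem der_foldr (w : List Y) (v : V) :
    der k (w.foldr (fun j v => nmul k 0 (x j) v) v) =
      w.foldr (fun j v => nmul k 0 (x j) v) (der k v) := by
  induction w with
  | nil => rfl
  | cons j w ih =>
    rw [List.foldr_cons, List.foldr_cons, ← ih, nmul_der, Nat.cast_zero, zero_smul, add_zero]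

include hc hx in
theorem nmul_one_antisymm (i j : Y) : nmul k 1 (x i) (x j) = -nmul k 1 (x j) (x i) := by
  have h := hc i j 1
  rw [comm_one_of_local (hx j i)] at h
  exact eq_neg_of_add_eq_zero_left h

include hc hx in
theorem der_nmul_one (i j : Y) :
    der k (nmul k 1 (x j) (x i)) = nmul k 0 (x j) (x i) - nmul k 0 (x i) (x j) := by
  have h := hc i j 0
  rw [comm_zero_of_local (hx j i)] at h
  rw [eq_sub_iff_add_eq, ← sub_eq_zero, ← h]
  abel

/-- The span of all monomials `L_0^{x_1} ⋯ L_0^{x_n} ∂^s z` and `L_0^{x_1} ⋯ L_0^{x_n} L_1^y z`. -/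
def wordSpan (k : Type*) {V Y : Type*} [Field k] [AddCommGroup V] [Module k V]
    [PreConformal k V] (x : Y → V) : Submodule k V :=
  Submodule.span k
    (Set.range (fun p : List Y × ℕ × Y => p.1.foldr (fun j v => nmul k 0 (x j) v)
      ((der k)^[p.2.1] (x p.2.2))) ∪
    Set.range fun p : List Y × Y × Y => p.1.foldr (fun j v => nmul k 0 (x j) v)
      (nmul k 1 (x p.2.1) (x p.2.2)))

theorem foldr_mem_wordSpan (w : List Y) {v : V} (hv : v ∈ wordSpan k x) :
    w.foldr (fun j v => nmul k 0 (x j) v) v ∈ wordSpan k x := by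
  induction w with
  | nil => exact hv
  | cons j w ih =>
    rw [List.foldr_cons]
    revert ih
    generalize List.foldr (fun j v => nmul k 0 (x j) v) v w = u
    intro hu
    induction hu using Submodule.span_induction with
    | mem u hu =>
      rcases hu with ⟨⟨w, s, z⟩, rfl⟩ | ⟨⟨w, y, z⟩, rfl⟩
      · exact Submodule.subset_span (Or.inl ⟨(j :: w, s, z), rfl⟩)
      · exact Submodule.subset_span (Or.inr ⟨(j :: w, y, z), rfl⟩)
    | zero => rw [map_zero]; exact Submodule.zero_mem _
    | add a c _ _ ha hc => rw [map_add]; exact Submodule.add_mem _ ha hc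
    | smul s a _ ha => rw [map_smul]; exact Submodule.smul_mem _ _ ha

theorem iterate_der_mem_wordSpan (s : ℕ) (z : Y) : (der k)^[s] (x z) ∈ wordSpan k x :=
  Submodule.subset_span (Or.inl ⟨([], s, z), rfl⟩)

theorem nmul_one_mem_wordSpan (y z : Y) : nmul k 1 (x y) (x z) ∈ wordSpan k x :=
  Submodule.subset_span (Or.inr ⟨([], y, z), rfl⟩)

theorem nmul_zero_mem_wordSpan (y z : Y) : nmul k 0 (x y) (x z) ∈ wordSpan k x :=
  Submodule.subset_span (Or.inl ⟨([y], 0, z), rfl⟩)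

include hc hx in
theorem der_mem_wordSpan {v : V} (hv : v ∈ wordSpan k x) : der k v ∈ wordSpan k x := by
  induction hv using Submodule.span_induction with
  | mem u hu =>
    rcases hu with ⟨⟨w, s, z⟩, rfl⟩ | ⟨⟨w, y, z⟩, rfl⟩
    · dsimp only
      rw [der_foldr, ← Function.iterate_succ_apply' (der k)]
      exact foldr_mem_wordSpan w (iterate_der_mem_wordSpan _ _)
    · dsimp only
      rw [der_foldr, der_nmul_one hc hx]
      exact foldr_mem_wordSpan w
        (Submodule.sub_mem _ (nmul_zero_mem_wordSpan _ _) (nmul_zero_mem_wordSpan _ _))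
  | zero => rw [map_zero]; exact Submodule.zero_mem _
  | add a c _ _ ha hc => rw [map_add]; exact Submodule.add_mem _ ha hc
  | smul s a _ ha => rw [map_smul]; exact Submodule.smul_mem _ _ ha

variable [CharZero k]

include hV hc in
theorem nmul_foldr (n : ℕ) (i : Y) (w : List Y) (v : V) :
    nmul k n (x i) (w.foldr (fun j v => nmul k 0 (x j) v) v) =
      w.foldr (fun j v => nmul k 0 (x j) v) (nmul k n (x i) v) := by
  induction w with
  | nil => rfl
  | cons j w ih => rw [List.foldr_cons, List.foldr_cons, (hc i j).left_comm hV, ih]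

include hV hc in
theorem foldr_perm {w w' : List Y} (h : w.Perm w') (v : V) :
    w.foldr (fun j v => nmul k 0 (x j) v) v = w'.foldr (fun j v => nmul k 0 (x j) v) v := by
  have : LeftCommutative fun (j : Y) (v : V) => nmul k 0 (x j) v :=
    ⟨fun i j v => (hc i j).left_comm hV 0 0 v⟩
  exact h.foldr_eq v

-- For n = 1, expand (i(2)j)(0)l = 0 by associativity. Locality and commuting left multiplications
-- remove the outer terms and leave −2 i(1)(j(1)l).
include hV hc hx in
theorem nmul_nmul_one_eq_zero {n : ℕ} (hn : 1 ≤ n) (i j l : Y) :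
    nmul k n (x i) (nmul k 1 (x j) (x l)) = 0 := by
  rcases hn.eq_or_lt with rfl | hn
  · have h := hV 2 0 (x i) (x j) (x l)
    rw [hx i j 2 le_rfl, map_zero, LinearMap.zero_apply, Finset.sum_range_succ,
      Finset.sum_range_succ, Finset.sum_range_one, hx j l (0 + 2) (by omega), map_zero, smul_zero,
      add_zero, (hc i j).left_comm hV (2 - 0), hx i l (2 - 0) (by omega), map_zero, smul_zero,
      zero_add] at h
    refine (smul_eq_zero.1 h.symm).resolve_left ?_
    norm_num
  · rw [(hc i j).left_comm hV, hx i l n hn, map_zero]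

-- This is the exchange relation behind spanning. Replace l(0)j by j(0)l − ∂(j(1)l) inside
-- i(1)(l(0)j); in i(1)∂(j(1)l) only i(0)(j(1)l) survives because i(1)(j(1)l) = 0.
include hV hc hx in
theorem nmul_zero_nmul_one (i j l : Y) :
    nmul k 0 (x l) (nmul k 1 (x i) (x j)) =
      nmul k 0 (x j) (nmul k 1 (x i) (x l)) - nmul k 0 (x i) (nmul k 1 (x j) (x l)) := by
  have h0 : nmul k 0 (x l) (x j) = nmul k 0 (x j) (x l) - der k (nmul k 1 (x j) (x l)) := by
    rw [der_nmul_one hc hx l j]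
    abel
  rw [(hc l i).left_comm hV, h0, map_sub, nmul_der, (hc i j).left_comm hV,
    nmul_nmul_one_eq_zero hV hc hx le_rfl, map_zero, zero_add, Nat.cast_one, one_smul]

-- Left multiplication by a generator passes through the operators L_0, so only the tail of the
-- monomial matters. For tails ∂^s z one induces on s.
include hV hc hx in
theorem nmul_generator_mem_wordSpan (n : ℕ) (i : Y) {v : V} (hv : v ∈ wordSpan k x) :
    nmul k n (x i) v ∈ wordSpan k x := by
  induction hv using Submodule.span_induction with
  | mem u hu =>
    rcases hu with ⟨⟨w, s, z⟩, rfl⟩ | ⟨⟨w, y, z⟩, rfl⟩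
    · dsimp only
      rw [nmul_foldr hV hc]
      refine foldr_mem_wordSpan w ?_
      induction s generalizing n with
      | zero =>
        match n with
        | 0 => exact nmul_zero_mem_wordSpan _ _
        | 1 => exact nmul_one_mem_wordSpan _ _
        | n + 2 =>
          rw [Function.iterate_zero_apply, hx i z (n + 2) (by omega)]
          exact Submodule.zero_mem _
      | succ s ih =>
        rw [Function.iterate_succ_apply', nmul_der]
        exact Submodule.add_mem _ (der_mem_wordSpan hc hx (ih n)) (Submodule.smul_mem _ _ (ih _))
    · dsimp only
      rcases n with _ | n
      · exact Submodule.subset_span (Or.inr ⟨(i :: w, y, z), rfl⟩)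
      · rw [nmul_foldr hV hc, nmul_nmul_one_eq_zero hV hc hx (by omega)]
        exact foldr_mem_wordSpan w (Submodule.zero_mem _)
  | zero => rw [map_zero]; exact Submodule.zero_mem _
  | add a c _ _ ha hc => rw [map_add]; exact Submodule.add_mem _ ha hc
  | smul s a _ ha => rw [map_smul]; exact Submodule.smul_mem _ _ ha

include hV hc hx in
theorem nmul_monVal_mem_wordSpan (t : Mon Y) (n : ℕ) {v : V} (hv : v ∈ wordSpan k x) :
    nmul k n (monVal k x t) v ∈ wordSpan k x := by
  induction t generalizing n v with
  | of i => exact nmul_generator_mem_wordSpan hV hc hx n i hv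
  | d t ih =>
    change nmul k n (der k (monVal k x t)) v ∈ _
    rw [der_nmul]
    exact Submodule.neg_mem _ (Submodule.smul_mem _ _ (ih _ hv))
  | mul m t u iht ihu =>
    change nmul k n (nmul k m (monVal k x t) (monVal k x u)) v ∈ _
    rw [hV]
    exact Submodule.sum_mem _ fun s _ => Submodule.smul_mem _ _ (iht _ (ihu _ hv))

include hV hc hx in
theorem monVal_mem_wordSpan (t : Mon Y) : monVal k x t ∈ wordSpan k x := by
  induction t with
  | of i => exact iterate_der_mem_wordSpan 0 i
  | d t ih => exact der_mem_wordSpan hc hx ih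
  | mul n t u iht ihu => exact nmul_monVal_mem_wordSpan hV hc hx t n ihu

variable [LinearOrder Y]

include hV hc in
theorem foldr_iterate_der_mem_span (w : List Y) (s : ℕ) (z : Y) :
    w.foldr (fun j v => nmul k 0 (x j) v) ((der k)^[s] (x z)) ∈
      Submodule.span k (Set.range fun p => monVal k x (basicMon p)) := by
  have hs : (w.insertionSort (· ≤ ·)).Pairwise (· ≤ ·) := List.pairwise_insertionSort _ w
  rw [← foldr_perm hV hc (List.perm_insertionSort (· ≤ ·) w)]
  refine Submodule.subset_span ⟨.inl ⟨(w.insertionSort (· ≤ ·), s, z), hs⟩, ?_⟩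
  refine (monVal_wordMon _ _ _).trans ?_
  rw [monVal_iterate_d]
  rfl

-- Commuting L_0 operators allow the word to be sorted. If y = z, antisymmetry of the 1-product
-- makes the monomial zero.
include hV hc hx in
theorem foldr_nmul_one_mem_span_of_le {w : List Y} {y z : Y} (hw : ∀ u ∈ w, u ≤ z)
    (hy : y ≤ z) : w.foldr (fun j v => nmul k 0 (x j) v) (nmul k 1 (x y) (x z)) ∈
      Submodule.span k (Set.range fun p => monVal k x (basicMon p)) := by
  rcases hy.eq_or_lt with rfl | hy
  · have h := nmul_one_antisymm hc hx y y
    rw [eq_neg_iff_add_eq_zero, ← two_smul k] at h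
    rw [(smul_eq_zero.1 h).resolve_left two_ne_zero, foldr_eq_prod, map_zero]
    exact Submodule.zero_mem _
  have hs : (w.insertionSort (· ≤ ·)).Pairwise (· ≤ ·) := List.pairwise_insertionSort _ w
  rw [← foldr_perm hV hc (List.perm_insertionSort (· ≤ ·) w)]
  refine Submodule.subset_span ⟨.inr ⟨(w.insertionSort (· ≤ ·), y, z), hs, fun u hu => hw u ?_,
    hy⟩, ?_⟩
  · exact (List.perm_insertionSort (· ≤ ·) w).mem_iff.1 hu
  · exact monVal_wordMon _ _ _

include hV hc hx in
theorem foldr_nmul_one_mem_span (w : List Y) (y z : Y) :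
    w.foldr (fun j v => nmul k 0 (x j) v) (nmul k 1 (x y) (x z)) ∈
      Submodule.span k (Set.range fun p => monVal k x (basicMon p)) := by
  wlog hyz : y ≤ z generalizing y z
  · have := this z y (le_of_not_ge hyz)
    rw [nmul_one_antisymm hc hx, foldr_eq_prod, map_neg, ← foldr_eq_prod] at this
    exact (Submodule.neg_mem_iff _).1 this
  by_cases hw : ∀ u ∈ w, u ≤ z
  · exact foldr_nmul_one_mem_span_of_le hV hc hx hw hyz
  push Not at hw
  obtain ⟨a, ha, hza⟩ := hw
  -- Extract the largest letter u, which exceeds z. The exchange relation yields two monomials that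
  -- both end in u, and u dominates all their other letters.
  obtain ⟨u, hu, hmax⟩ := w.toFinset.exists_max_image id ⟨a, List.mem_toFinset.2 ha⟩
  rw [List.mem_toFinset] at hu
  have hle : ∀ c ∈ w.erase u, c ≤ u := fun c hc' =>
    hmax c (List.mem_toFinset.2 (List.mem_of_mem_erase hc'))
  have hzu : z ≤ u := hza.le.trans (hmax a (List.mem_toFinset.2 ha))
  have hcons : ∀ i v, (w.erase u).foldr (fun j v => nmul k 0 (x j) v) (nmul k 0 (x i) v) =
      (i :: w.erase u).foldr (fun j v => nmul k 0 (x j) v) v := fun i v =>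
    (nmul_foldr hV hc 0 i _ v).symm
  rw [foldr_perm hV hc (List.perm_cons_erase hu), List.foldr_cons, nmul_foldr hV hc,
    nmul_zero_nmul_one hV hc hx, foldr_eq_prod, map_sub, ← foldr_eq_prod, ← foldr_eq_prod,
    hcons, hcons]
  refine Submodule.sub_mem _ (foldr_nmul_one_mem_span_of_le hV hc hx ?_ (hyz.trans hzu))
    (foldr_nmul_one_mem_span_of_le hV hc hx ?_ hzu) <;> rw [List.forall_mem_cons]
  · exact ⟨hzu, hle⟩
  · exact ⟨hyz.trans hzu, hle⟩

include hV hc hx in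
theorem span_basicMon (hspan : Submodule.span k (Set.range (monVal k x)) = ⊤) :
    Submodule.span k (Set.range fun p => monVal k x (basicMon p)) = ⊤ := by
  rw [eq_top_iff, ← hspan, Submodule.span_le]
  rintro _ ⟨t, rfl⟩
  refine (Submodule.span_le.2 ?_ : wordSpan k x ≤ _) (monVal_mem_wordSpan hV hc hx t)
  rintro _ (⟨⟨w, s, z⟩, rfl⟩ | ⟨⟨w, y, z⟩, rfl⟩)
  · exact foldr_iterate_der_mem_span hV hc w s z
  · exact foldr_nmul_one_mem_span hV hc hx w y z

end Spanning

/-! ### The associated graded algebra of an associative conformal algebra -/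

section GradedAlgebra

variable {k X V : Type*} [Field k] [AddCommGroup V] [Module k V] {x : X → V}

/-- Transport between equal degrees; it reconciles (i + j) + l with i + (j + l) in associativity. -/
theorem Gr.cls_congr [PreConformal k V] {m n : ℕ} (h : m = n) {a : filLE k x m} {c : filLE k x n}
    (hac : a.1 = c.1) : Gr.cls k x m a = Gr.cls k x n c := by
  subst h
  rw [Subtype.ext hac]

theorem Gr.cls_add [PreConformal k V] (n : ℕ) (a c : filLE k x n) :
    Gr.cls k x n (a + c) = Gr.cls k x n a + Gr.cls k x n c := by
  simp only [Gr.cls, map_add]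

theorem Gr.cls_smul [PreConformal k V] (n : ℕ) (s : k) (a : filLE k x n) :
    Gr.cls k x n (s • a) = s • Gr.cls k x n a := by
  simp only [Gr.cls, map_smul]

theorem Gr.cls_sum [PreConformal k V] {J : Type*} (n : ℕ) (S : Finset J) (a : J → filLE k x n) :
    Gr.cls k x n (∑ j ∈ S, a j) = ∑ j ∈ S, Gr.cls k x n (a j) := by
  simp only [Gr.cls, map_sum]

theorem Gr.cls_eq_zero [PreConformal k V] {n : ℕ} {a : filLE k x n} (h : a.1 ∈ filLT k x n) :
    Gr.cls k x n a = 0 := by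
  have : grMk k x n a = 0 := (Submodule.Quotient.mk_eq_zero _).2 h
  rw [Gr.cls, this, map_zero]

theorem monVal_mem_filLE [PreConformal k V] (t : Mon X) : monVal k x t ∈ filLE k x t.deg :=
  Submodule.subset_span ⟨t, le_rfl, rfl⟩

/-- The class is always taken in the formal degree of the monomial; it is zero when the value
happens to lie lower in the filtration. -/
theorem Gr.monVal_gen [PreConformal k V] (t : Mon X) :
    monVal k (Gr.gen k x) t = Gr.cls k x t.deg ⟨monVal k x t, monVal_mem_filLE t⟩ := by
  induction t with
  | of i => rfl
  | d t ih => exact (congrArg (der k) ih).trans (Gr.der_cls _ _ _)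
  | mul n t u iht ihu =>
    exact (congrArg₂ (fun a c => nmul k n a c) iht ihu).trans (Gr.nmul_cls _ _ _ _ _ _)

theorem Gr.span_monVal_gen [PreConformal k V] :
    Submodule.span k (Set.range (monVal k (Gr.gen k x))) = ⊤ := by
  rw [eq_top_iff, ← Gr.span_cls x, Submodule.span_le]
  rintro _ ⟨⟨n, a, ha⟩, rfl⟩
  change Gr.cls k x n ⟨a, ha⟩ ∈ _
  induction ha using Submodule.span_induction with
  | mem a h =>
    obtain ⟨t, ht, rfl⟩ := h
    rcases ht.eq_or_lt with rfl | ht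
    · rw [← Gr.monVal_gen]
      exact Submodule.subset_span ⟨t, rfl⟩
    · rw [Gr.cls_eq_zero (Submodule.subset_span ⟨t, ht, rfl⟩)]
      exact Submodule.zero_mem _
  | zero =>
    rw [Gr.cls_eq_zero (Submodule.zero_mem _)]
    exact Submodule.zero_mem _
  | add a c ha hc h h' =>
    have := Submodule.add_mem _ h h'
    rwa [← Gr.cls_add] at this
  | smul s a ha h =>
    have := Submodule.smul_mem _ s h
    rwa [← Gr.cls_smul] at this

theorem isAssoc_of_span [PreConformal k V] {S : Set V} (hS : Submodule.span k S = ⊤)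
    (h : ∀ (n m : ℕ), ∀ a ∈ S, ∀ b ∈ S, ∀ c ∈ S, nmul k m (nmul k n a b) c =
      ∑ s ∈ Finset.range (n + 1), ((-1 : k) ^ s * (n.choose s : k)) •
        nmul k (n - s) a (nmul k (m + s) b c)) : IsAssoc k V := by
  intro n m a b c
  have e : ∀ a b : V, nmul k m (nmul k n a b) = ∑ s ∈ Finset.range (n + 1),
      ((-1 : k) ^ s * (n.choose s : k)) • (nmul k (n - s) a ∘ₗ nmul k (m + s) b) := by
    have e1 : ∀ a ∈ S, ∀ b, nmul k m (nmul k n a b) = ∑ s ∈ Finset.range (n + 1),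
        ((-1 : k) ^ s * (n.choose s : k)) • (nmul k (n - s) a ∘ₗ nmul k (m + s) b) := by
      intro a ha b
      refine LinearMap.congr_fun (f := nmul k m ∘ₗ nmul k n a) (g := ∑ s ∈ Finset.range (n + 1),
        ((-1 : k) ^ s * (n.choose s : k)) • (nmul k (m + s)).compr₂ (nmul k (n - s) a))
        (LinearMap.ext_on hS fun b hb => ?_) b |>.trans ?_
      · refine LinearMap.ext_on hS fun c hc => ?_
        simpa [LinearMap.sum_apply] using h n m a ha b hb c hc
      · refine LinearMap.ext fun c => ?_
        simp [LinearMap.sum_apply]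
    intro a b
    refine LinearMap.congr_fun (f := nmul k m ∘ₗ (nmul k n).flip b)
      (g := ∑ s ∈ Finset.range (n + 1), ((-1 : k) ^ s * (n.choose s : k)) •
        ((nmul k (n - s)).compl₂ (nmul k (m + s) b)))
      (LinearMap.ext_on hS fun a ha => ?_) a |>.trans ?_
    · refine LinearMap.ext fun c => ?_
      have := LinearMap.congr_fun (e1 a ha b) c
      simpa [LinearMap.sum_apply] using this
    · refine LinearMap.ext fun c => ?_
      simp [LinearMap.sum_apply]
  have := LinearMap.congr_fun (e a b) c
  simpa [LinearMap.sum_apply] using this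

theorem Gr.isAssoc [PreConformal k V] (hV : IsAssoc k V) : IsAssoc k (Gr k x) := by
  refine isAssoc_of_span (Gr.span_cls x) ?_
  rintro n m _ ⟨⟨i, a⟩, rfl⟩ _ ⟨⟨j, b⟩, rfl⟩ _ ⟨⟨l, c⟩, rfl⟩
  have hmem : ∀ p q, nmul k p a.1 (nmul k q b.1 c.1) ∈ filLE k x (i + j + l) := by
    intro p q
    rw [add_assoc]
    exact nmul_span x (· ≤ i) (· ≤ j + l) (· ≤ i + (j + l)) (fun _ _ => add_le_add) p _ _ a.2
      (nmul_span x (· ≤ j) (· ≤ l) (· ≤ j + l) (fun _ _ => add_le_add) q _ _ b.2 c.2)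
  have h1 : ∀ p q, nmul k p (Gr.cls k x i a) (nmul k q (Gr.cls k x j b) (Gr.cls k x l c)) =
      Gr.cls k x (i + j + l) ⟨_, hmem p q⟩ := by
    intro p q
    rw [Gr.nmul_cls, Gr.nmul_cls]
    exact Gr.cls_congr (add_assoc i j l).symm rfl
  simp only [h1]
  rw [Gr.nmul_cls, Gr.nmul_cls]
  simp only [← Gr.cls_smul]
  rw [← Gr.cls_sum]
  refine Gr.cls_congr rfl ?_
  rw [Submodule.coe_sum]
  exact hV n m a.1 b.1 c.1

theorem Gr.nmul_gen [PreConformal k V] (n : ℕ) (i j : X) :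
    nmul k n (Gr.gen k x i) (Gr.gen k x j) = Gr.cls k x 2 ⟨nmul k n (x i) (x j),
      monVal_mem_filLE (.mul n (.of i) (.of j))⟩ :=
  Gr.nmul_cls _ _ _ _ _ _

theorem Gr.nmul_gen_eq_zero [PreConformal k V] (hx : ∀ i j n, 2 ≤ n → nmul k n (x i) (x j) = 0)
    (i j : X) (n : ℕ) (hn : 2 ≤ n) : nmul k n (Gr.gen k x i) (Gr.gen k x j) = 0 := by
  rw [Gr.nmul_gen]
  refine Gr.cls_eq_zero ?_
  dsimp only
  rw [hx i j n hn]
  exact Submodule.zero_mem _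

variable [ConformalAlgebra k V]

/-- The commutator of two classes is the class, in degree 2, of the commutator, and `hc` puts the
latter in F_1. -/
theorem Gr.commuting_gen (hx : ∀ i j n, 2 ≤ n → nmul k n (x i) (x j) = 0)
    (hc : ∀ i j n, comm k n (x i) (x j) ∈ filLT k x 2) (i j : X) :
    Commuting k (Gr.gen k x i) (Gr.gen k x j) := by
  intro n
  match n with
  | 0 =>
    rw [comm_zero_of_local (Gr.nmul_gen_eq_zero hx j i), Gr.nmul_gen, Gr.nmul_gen, Gr.nmul_gen,
      Gr.der_cls]
    have h : ∀ u v w : filLE k x 2, Gr.cls k x 2 u - Gr.cls k x 2 v + Gr.cls k x 2 w =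
        Gr.cls k x 2 (u - v + w) := by
      intro u v w
      simp only [Gr.cls, map_add, map_sub]
    rw [h]
    refine Gr.cls_eq_zero ?_
    have := hc i j 0
    rwa [comm_zero_of_local (hx j i)] at this
  | 1 =>
    rw [comm_one_of_local (Gr.nmul_gen_eq_zero hx j i), Gr.nmul_gen, Gr.nmul_gen, ← Gr.cls_add]
    refine Gr.cls_eq_zero ?_
    have := hc i j 1
    rwa [comm_one_of_local (hx j i)] at this
  | n + 2 =>
    rw [comm_of_local (Gr.nmul_gen_eq_zero hx j i) (by omega),
      Gr.nmul_gen_eq_zero hx i j _ (by omega)]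

theorem Gr.isComm [CharZero k] (hV : IsAssoc k V)
    (hx : ∀ i j n, 2 ≤ n → nmul k n (x i) (x j) = 0)
    (hc : ∀ i j n, comm k n (x i) (x j) ∈ filLT k x 2) : IsComm k (Gr k x) :=
  isComm_of_generators (Gr.isAssoc hV) (Gr.gen k x) Gr.span_monVal_gen (Gr.commuting_gen hx hc)

end GradedAlgebra

/-! ### Independence of the basic monomials -/

section Independence

variable {k ι : Type*} [Field k]

/-- Each vector owns a coordinate that no other vector uses. -/
theorem linearIndependent_of_coord {I J : Type*} {v : J → I →₀ k} (c : J → I)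
    (h1 : ∀ p, v p (c p) ≠ 0) (h2 : ∀ p q, p ≠ q → v q (c p) = 0) : LinearIndependent k v := by
  rw [linearIndependent_iff']
  intro s a ha p hp
  have h := DFunLike.congr_fun ha (c p)
  rw [Finsupp.finsetSum_apply, Finset.sum_eq_single p] at h
  · exact (mul_eq_zero.1 h).resolve_right (h1 p)
  · intro q _ hq
    rw [Finsupp.smul_apply, h2 p q hq.symm, smul_zero]
  · exact fun h => absurd hp h

variable (k) in
/-- The symbols of the basic monomials. -/
noncomputable def basicSymbol [LinearOrder ι] :
    Index₁ ι ⊕ Index₂ ι → Multiset ι × ι × ℤ →₀ k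
  | .inl p => -(Nat.factorial (p.1.2.1 + 1) : k) •
      Finsupp.single (((p.1.1 ++ [p.1.2.2] : List ι) : Multiset ι), p.1.2.2, -1 - (p.1.2.1 : ℤ)) 1
  | .inr p =>
      Finsupp.single (((p.1.1 ++ [p.1.2.1, p.1.2.2] : List ι) : Multiset ι), p.1.2.1, 0) 1 -
        Finsupp.single (((p.1.1 ++ [p.1.2.1, p.1.2.2] : List ι) : Multiset ι), p.1.2.2, 0) 1

/-- The owned coordinates mark z with mode −1 − s for the first kind and y with mode 0 for the
second; −1 − s is never 0, so the kinds do not interfere. The multiset determines the remaining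
letters because the word is sorted. -/
theorem linearIndependent_basicSymbol [CharZero k] [LinearOrder ι] :
    LinearIndependent k (basicSymbol k (ι := ι)) := by
  refine linearIndependent_of_coord (Sum.elim
    (fun p : Index₁ ι => (((p.1.1 ++ [p.1.2.2] : List ι) : Multiset ι), p.1.2.2,
      -1 - (p.1.2.1 : ℤ)))
    (fun p : Index₂ ι => (((p.1.1 ++ [p.1.2.1, p.1.2.2] : List ι) : Multiset ι), p.1.2.1, 0)))
    ?_ ?_
  · rintro (⟨⟨w, s, z⟩, hw⟩ | ⟨⟨w, y, z⟩, hw, hz, hyz⟩)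
    · simp only [basicSymbol, Sum.elim_inl, Finsupp.smul_apply, Finsupp.single_eq_same, smul_eq_mul,
        mul_one]
      exact neg_ne_zero.2 (Nat.cast_ne_zero.2 (Nat.factorial_ne_zero _))
    · simp only [basicSymbol, Sum.elim_inr, Finsupp.sub_apply, Finsupp.single_eq_same]
      rw [Finsupp.single_eq_of_ne, sub_zero]
      · exact one_ne_zero
      · intro h
        exact hyz.ne (congrArg (fun q => q.2.1) h)
  · rintro (⟨⟨w, s, z⟩, hw⟩ | ⟨⟨w, y, z⟩, hw, hz, hyz⟩)
      (⟨⟨w', s', z'⟩, hw'⟩ | ⟨⟨w', y', z'⟩, hw', hz', hyz'⟩) hne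
    · simp only [basicSymbol, Sum.elim_inl, Finsupp.smul_apply]
      rw [Finsupp.single_eq_of_ne, smul_zero]
      intro h
      simp only [Prod.mk.injEq, Multiset.coe_eq_coe] at h
      obtain ⟨h1, rfl, h2⟩ := h
      obtain rfl : s = s' := by omega
      obtain rfl := ((List.perm_append_right_iff _).1 h1).eq_of_pairwise' hw hw'
      exact hne rfl
    · simp only [basicSymbol, Sum.elim_inl, Finsupp.sub_apply]
      rw [Finsupp.single_eq_of_ne, Finsupp.single_eq_of_ne, sub_zero]
      all_goals
        intro h
        have h : -1 - (s : ℤ) = 0 := congrArg (fun q => q.2.2) h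
        omega
    · simp only [basicSymbol, Sum.elim_inr, Finsupp.smul_apply]
      rw [Finsupp.single_eq_of_ne, smul_zero]
      intro h
      have h : 0 = -1 - (s' : ℤ) := congrArg (fun q => q.2.2) h
      omega
    · simp only [basicSymbol, Sum.elim_inr, Finsupp.sub_apply]
      -- For the second kind z is the maximum of the multiset, hence determined by it. Since y < z,
      -- the coordinate that marks y cannot be the one that marks z' in the other symbol.
      have hzz : (w ++ [y, z]).Perm (w' ++ [y', z']) → z = z' := by
        intro h
        have h1 : z ∈ w' ++ [y', z'] := h.mem_iff.1 (by simp)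
        have h2 : z' ∈ w ++ [y, z] := h.mem_iff.2 (by simp)
        simp only [List.mem_append, List.mem_cons, List.not_mem_nil, or_false] at h1 h2
        refine le_antisymm ?_ ?_
        · rcases h1 with h | h | h
          · exact hz' z h
          · exact h ▸ hyz'.le
          · exact h.le
        · rcases h2 with h | h | h
          · exact hz z' h
          · exact h ▸ hyz.le
          · exact h.le
      rw [Finsupp.single_eq_of_ne, Finsupp.single_eq_of_ne, sub_zero]
      · intro h
        simp only [Prod.mk.injEq, Multiset.coe_eq_coe] at h
        have h1 := hzz h.1
        exact hyz.ne (h.2.1.trans h1.symm)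
      · intro h
        simp only [Prod.mk.injEq, Multiset.coe_eq_coe] at h
        obtain ⟨h1, rfl, -⟩ := h
        obtain rfl := hzz h1
        obtain rfl := ((List.perm_append_right_iff _).1 h1).eq_of_pairwise' hw hw'
        exact hne rfl

variable {V W X : Type*} [AddCommGroup V] [Module k V] [PreConformal k V] [AddCommGroup W]
  [Module k W] {x : X → V}

/-- Linear functions that vanish in low degree define a linear function on the associated graded
space. -/
theorem Gr.exists_functional (σ : ℕ → V →ₗ[k] W)
    (hσ : ∀ N t, Mon.deg t < N → σ N (monVal k x t) = 0) :
    ∃ Θ : Gr k x →ₗ[k] W, ∀ N a, Θ (Gr.cls k x N a) = σ N a.1 := by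
  have h : ∀ N, (filLT k x N).submoduleOf (filLE k x N) ≤
      LinearMap.ker (σ N ∘ₗ (filLE k x N).subtype) := by
    intro N a ha
    have h1 : filLT k x N ≤ LinearMap.ker (σ N) := by
      refine Submodule.span_le.2 ?_
      rintro _ ⟨t, ht, rfl⟩
      exact hσ N t ht
    exact h1 ha
  exact ⟨Gr.lift k x fun N => Submodule.liftQ _ (σ N ∘ₗ (filLE k x N).subtype) (h N),
    fun N a => Gr.lift_incl k x _ N _⟩

theorem Gr.monVal_gen_map (h : ι → X) (t : Mon ι) :
    monVal k (fun i => Gr.gen k x (h i)) t =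
      Gr.cls k x t.deg ⟨monVal k (fun i => x (h i)) t, by
        rw [← monVal_map, ← deg_map h]; exact monVal_mem_filLE _⟩ := by
  rw [← monVal_map, Gr.monVal_gen]
  exact Gr.cls_congr (deg_map h t) (monVal_map x h t)

/-- If linear functions on an algebra separate the symbols of the basic monomials, then the basic
monomials in the associated graded algebra are linearly independent. -/
theorem Gr.linearIndependent_basicMon [CharZero k] [LinearOrder ι] (h : ι → X)
    (σ : ℕ → V →ₗ[k] (Multiset ι × ι × ℤ →₀ k))
    (hσ : ∀ N t, Mon.deg t < N → σ N (monVal k x t) = 0)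
    (h1 : ∀ w s z, σ (w.length + 1) (monVal k (fun i => x (h i))
      (wordMon w (Mon.d^[s] (.of z)))) = -(Nat.factorial (s + 1) : k) •
        Finsupp.single (((w ++ [z] : List ι) : Multiset ι), z, -1 - (s : ℤ)) 1)
    (h2 : ∀ w y z, σ (w.length + 2) (monVal k (fun i => x (h i))
      (wordMon w (.mul 1 (.of y) (.of z)))) =
        Finsupp.single (((w ++ [y, z] : List ι) : Multiset ι), y, 0) 1 -
          Finsupp.single (((w ++ [y, z] : List ι) : Multiset ι), z, 0) 1) :
    LinearIndependent k fun p : Index₁ ι ⊕ Index₂ ι =>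
      monVal k (fun i => Gr.gen k x (h i)) (basicMon p) := by
  obtain ⟨Θ, hΘ⟩ := Gr.exists_functional σ hσ
  suffices e : (Θ ∘ fun p => monVal k (fun i => Gr.gen k x (h i)) (basicMon p)) =
      basicSymbol k by
    have h0 := linearIndependent_basicSymbol (k := k) (ι := ι)
    rw [← e] at h0
    exact LinearIndependent.of_comp Θ h0
  funext p
  rw [Function.comp_apply, Gr.monVal_gen_map, hΘ]
  rcases p with p | p
  · change σ (Mon.deg (wordMon _ _)) _ = _
    rw [deg_wordMon, deg_iterate_d]
    exact h1 _ _ _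
  · change σ (Mon.deg (wordMon _ _)) _ = _
    rw [deg_wordMon]
    exact h2 _ _ _

end Independence

/-! ### Comparison with the free commutative conformal algebra -/

section Comparison

variable {k ι X V W : Type*} [Field k] [AddCommGroup V] [Module k V] [AddCommGroup W]
  [Module k W]

theorem ComConf.span_monVal (N : ι → ι → ℕ) :
    Submodule.span k (Set.range (monVal k (ComConf.gen k N))) = ⊤ := by
  have h : Set.range (monVal k (ComConf.gen k N)) =
      ConfQuot.mk _ '' Set.range (AssConf.mon k N) := by
    rw [← Set.range_comp]
    exact congrArg Set.range (funext fun t => (map_monVal (ConfQuot.mk_hom _) _ t).symm)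
  rw [h, ← Submodule.map_span, AssConf.span_mon, Submodule.map_top, LinearMap.range_eq_top]
  exact ConfQuot.mk_surjective _

theorem ComConf.gen_local (N : ι → ι → ℕ) (i j : ι) (n : ℕ) (h : N i j ≤ n) :
    nmul k n (ComConf.gen k N i) (ComConf.gen k N j) = 0 :=
  (congrArg (ConfQuot.mk _) (AssConf.gen_local N i j n h)).trans (map_zero _)

theorem ComConf.span_basicMonomial [CharZero k] [LinearOrder ι] :
    Submodule.span k (Set.range (basicMonomial k fun _ _ : ι => 2)) = ⊤ := by
  have h := span_basicMon (k := k) (x := ComConf.gen k fun _ _ : ι => 2) (ComConf.isAssoc _)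
    (fun i j n => ComConf.isComm _ n _ _) (fun i j n hn => ComConf.gen_local _ i j n hn)
    (ComConf.span_monVal _)
  simpa only [monVal_basicMon] using h

/-- A relation among the images must be trivial, and every vector of the source is a combination of
the spanning family. -/
theorem injective_of_linearIndependent_comp {J : Type*} {v : J → V}
    (hv : Submodule.span k (Set.range v) = ⊤) {f : V →ₗ[k] W}
    (hf : LinearIndependent k fun j => f (v j)) : Function.Injective f := by
  rw [injective_iff_map_eq_zero]
  intro a ha
  have : a ∈ LinearMap.range (Finsupp.linearCombination k v) := by
    rw [Finsupp.range_linearCombination, hv]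
    trivial
  obtain ⟨l, rfl⟩ := this
  rw [Finsupp.apply_linearCombination] at ha
  rw [linearIndependent_iff.1 hf l ha, map_zero]

theorem exists_confEquiv [PreConformal k V] [PreConformal k W] {f : W →ₗ[k] V}
    (hf : IsConfHom k f) (hb : Function.Bijective f) :
    ∃ φ : ConfEquiv k V W, ∀ w, φ.toLinearEquiv (f w) = w := by
  let e : W ≃ₗ[k] V := LinearEquiv.ofBijective f hb
  refine ⟨⟨e.symm, fun a => ?_, fun n a c => ?_⟩, fun w => e.symm_apply_apply w⟩
  · change e.symm (der k a) = der k (e.symm a)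
    rw [LinearEquiv.symm_apply_eq]
    refine Eq.trans ?_ (hf.map_der _).symm
    exact congrArg (der k) (e.apply_symm_apply a).symm
  · change e.symm (nmul k n a c) = nmul k n (e.symm a) (e.symm c)
    rw [LinearEquiv.symm_apply_eq]
    refine Eq.trans ?_ (hf.map_nmul _ _ _).symm
    exact congrArg₂ (fun a c => nmul k n a c) (e.apply_symm_apply a).symm
      (e.apply_symm_apply c).symm

theorem surjective_of_generators [PreConformal k V] [PreConformal k W] {f : W →ₗ[k] V}
    (hf : IsConfHom k f) {x : X → V} (hx : Submodule.span k (Set.range (monVal k x)) = ⊤)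
    (h : ∀ i, ∃ w, f w = x i) : Function.Surjective f := by
  choose w hw using h
  rw [← LinearMap.range_eq_top, eq_top_iff, ← hx, Submodule.span_le]
  rintro _ ⟨t, rfl⟩
  exact ⟨monVal k w t, by rw [map_monVal hf]; simp only [hw]⟩

variable [ConformalAlgebra k V] {x : X → V}

/-- The universal property of ComConf applies because the graded algebra is associative and
commutative with locality 2 on the classes of the generators. -/
theorem Gr.exists_comHom [CharZero k] (hV : IsAssoc k V)
    (hx : ∀ i j n, 2 ≤ n → nmul k n (x i) (x j) = 0)
    (hc : ∀ i j n, comm k n (x i) (x j) ∈ filLT k x 2) (h : ι → X) :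
    ∃ F : ComConf k (fun _ _ : ι => 2) →ₗ[k] Gr k x,
      IsConfHom k F ∧ ∀ i, F (ComConf.gen k _ i) = Gr.gen k x (h i) := by
  obtain ⟨F, hF, -⟩ := ComConf.existsUnique_lift (V := Gr k x) (Gr.isAssoc hV)
    (Gr.isComm hV hx hc) (fun _ _ => 2) (fun i => Gr.gen k x (h i))
    (fun i j n hn => Gr.nmul_gen_eq_zero hx (h i) (h j) n hn)
  exact ⟨F, hF⟩

end Comparison

/-! ### Envelopes of current and Kac–Moody conformal algebras -/

section Envelopes

variable {k X L : Type*} [Field k] [AddCommGroup L] [Module k L] [PreConformal k L]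

theorem UEnv.gen_local (x : X → L) (N : X → X → ℕ) (i j : X) (n : ℕ) (h : N i j ≤ n) :
    nmul k n (UEnv.gen k x N i) (UEnv.gen k x N j) = 0 :=
  (congrArg (ConfQuot.mk _) (AssConf.gen_local N i j n h)).trans (map_zero _)

/-- The commutator is the image of the bracket in L, which by `h` is a combination of generators and
hence has degree one. -/
theorem UEnv.comm_gen_mem (x : X → L) (N : X → X → ℕ)
    (hx : Function.Surjective (FreeMag.eval k (der k) (fun n a b => nmul k n a b) x))
    (h : ∀ i j n, nmul k n (x i) (x j) ∈ Submodule.span k (Set.range x)) (i j : X) (n : ℕ) :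
    comm k n (UEnv.gen k x N i) (UEnv.gen k x N j) ∈ filLT k (UEnv.gen k x N) 2 := by
  obtain ⟨ρ, ρg, -, ρn⟩ := UEnv.exists_map x N hx
  rw [← ρg, ← ρg, ← ρn]
  have : Submodule.span k (Set.range x) ≤ (filLT k (UEnv.gen k x N) 2).comap ρ := by
    refine Submodule.span_le.2 ?_
    rintro _ ⟨i, rfl⟩
    exact Submodule.subset_span ⟨.of i, Nat.one_lt_two, ρg i⟩
  exact this (h i j n)

theorem surjective_eval_of_span {x : X → L} {S : Set L} (hS : Submodule.span k S = ⊤)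
    (h : ∀ a ∈ S, ∃ s, ∃ c ∈ Submodule.span k (Set.range x), a = (der k)^[s] c) :
    Function.Surjective (FreeMag.eval k (der k) (fun n a b => nmul k n a b) x) := by
  set ev := FreeMag.eval k (der k) (fun n a b => nmul k n a b) x with hev
  have h0 : Submodule.span k (Set.range x) ≤ LinearMap.range ev := by
    refine Submodule.span_le.2 ?_
    rintro _ ⟨i, rfl⟩
    exact ⟨FreeMag.of k i, FreeMag.eval_single _ _ _ _⟩
  rw [← LinearMap.range_eq_top, eq_top_iff, ← hS, Submodule.span_le]
  intro a ha
  obtain ⟨s, c, hc, rfl⟩ := h a ha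
  clear ha
  induction s with
  | zero => exact h0 hc
  | succ s ih =>
    obtain ⟨u, hu⟩ := ih
    exact ⟨der k u, by rw [Function.iterate_succ_apply', (FreeMag.hom_eval x).map_der, ← hu]⟩

end Envelopes

/-! ### Generation of Cur g and K(g), and the map between their envelopes -/

section LieEnvelopes

variable {k g ι : Type*} [Field k] [LieRing g] [LieAlgebra k g]

theorem Cur.mk_zero_mem_span (b : Module.Basis ι k g) (a : g) :
    (Cur.mk 0 a : Cur g) ∈ Submodule.span k (Set.range fun i => (Cur.mk 0 (b i) : Cur g)) := by
  let J : g →ₗ[k] Cur g := (Finsupp.lsingle 0 : g →ₗ[k] ℕ →₀ g)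
  have h : Submodule.span k (Set.range b) ≤
      (Submodule.span k (Set.range fun i => (Cur.mk 0 (b i) : Cur g))).comap J := by
    refine Submodule.span_le.2 ?_
    rintro _ ⟨i, rfl⟩
    exact Submodule.subset_span ⟨i, rfl⟩
  exact h (b.mem_span a)

theorem Cur.iterate_der_mk (s : ℕ) (a : g) : (der k)^[s] (Cur.mk 0 a : Cur g) = Cur.mk s a := by
  induction s with
  | zero => rfl
  | succ s ih => rw [Function.iterate_succ_apply', ih, Cur.der_mk]

theorem Cur.surjective_eval (b : Module.Basis ι k g) : Function.Surjective
    (FreeMag.eval k (der k) (fun n a b => nmul k n a b) fun i => (Cur.mk 0 (b i) : Cur g)) := by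
  refine surjective_eval_of_span Cur.span_mk ?_
  rintro _ ⟨⟨s, a⟩, rfl⟩
  exact ⟨s, _, Cur.mk_zero_mem_span b a, (Cur.iterate_der_mk s a).symm⟩

theorem Cur.nmul_mem_span (b : Module.Basis ι k g) (i j : ι) (n : ℕ) :
    nmul k n (Cur.mk 0 (b i) : Cur g) (Cur.mk 0 (b j)) ∈
      Submodule.span k (Set.range fun i => (Cur.mk 0 (b i) : Cur g)) := by
  rw [Cur.nmul_mk, if_pos (Nat.zero_le n)]
  rw [show 0 + 0 - n = 0 by omega]
  exact Submodule.smul_mem _ _ (Cur.mk_zero_mem_span b _)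

variable (B : LinearMap.BilinForm k g)

theorem KM.cur_mem_span (b : Module.Basis ι k g) (a : g) :
    KM.cur B 0 a ∈ Submodule.span k (Set.range (KM.genFamily B b)) := by
  let J : g →ₗ[k] KM B :=
    (LinearMap.inl k (ℕ →₀ g) k ∘ₗ Finsupp.lsingle 0 : g →ₗ[k] (ℕ →₀ g) × k)
  have h : Submodule.span k (Set.range b) ≤
      (Submodule.span k (Set.range (KM.genFamily B b))).comap J := by
    refine Submodule.span_le.2 ?_
    rintro _ ⟨i, rfl⟩
    exact Submodule.subset_span ⟨some i, rfl⟩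
  exact h (b.mem_span a)

theorem KM.e_mem_span (b : Module.Basis ι k g) :
    KM.e B ∈ Submodule.span k (Set.range (KM.genFamily B b)) :=
  Submodule.subset_span ⟨none, rfl⟩

theorem KM.iterate_der_cur (s : ℕ) (a : g) : (der k)^[s] (KM.cur B 0 a) = KM.cur B s a := by
  induction s with
  | zero => rfl
  | succ s ih => rw [Function.iterate_succ_apply', ih, KM.der_cur]

theorem KM.surjective_eval (b : Module.Basis ι k g) : Function.Surjective
    (FreeMag.eval k (der k) (fun n a b => nmul k n a b) (KM.genFamily B b)) := by
  refine surjective_eval_of_span (KM.span_cur_e B) ?_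
  rintro _ (⟨⟨s, a⟩, rfl⟩ | rfl)
  · exact ⟨s, _, KM.cur_mem_span B b a, (KM.iterate_der_cur B s a).symm⟩
  · exact ⟨0, _, KM.e_mem_span B b, rfl⟩

theorem KM.nmul_mem_span [CharZero k] (b : Module.Basis ι k g) (i j : Option ι) (n : ℕ) :
    nmul k n (KM.genFamily B b i) (KM.genFamily B b j) ∈
      Submodule.span k (Set.range (KM.genFamily B b)) := by
  have h0 : der k (KM.genFamily B b none) = 0 := KM.der_e B
  rcases i with _ | i
  · rw [nmul_eq_zero_of_der_left h0]
    exact Submodule.zero_mem _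
  rcases j with _ | j
  · rw [nmul_eq_zero_of_der_right h0]
    exact Submodule.zero_mem _
  change nmul k n (KM.cur B 0 (b i)) (KM.cur B 0 (b j)) ∈ _
  match n with
  | 0 => rw [KM.nmul_cur_zero]; exact KM.cur_mem_span B b _
  | 1 => rw [KM.nmul_cur_one]; exact Submodule.smul_mem _ _ (KM.e_mem_span B b)
  | n + 2 => rw [KM.nmul_cur_of_le B (by omega)]; exact Submodule.zero_mem _

theorem KM.der_gen_none (b : Module.Basis ι k g) (N : Option ι → Option ι → ℕ) :
    der k (UEnv.gen k (KM.genFamily B b) N none) = 0 := by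
  obtain ⟨ρ, ρg, ρd, -⟩ := UEnv.exists_map (KM.genFamily B b) N (KM.surjective_eval B b)
  rw [← ρg, ← ρd]
  exact (congrArg ρ (KM.der_e B)).trans (map_zero ρ)

/-- The envelope of `Cur g` maps to the envelope of `K(g)` with the zero form. -/
theorem exists_curHom (b : Module.Basis ι k g) :
    ∃ F : UEnv k (fun i : ι => (Cur.mk 0 (b i) : Cur g)) (fun _ _ => 2) →ₗ[k]
        UEnv k (KM.genFamily (0 : LinearMap.BilinForm k g) b) (fun _ _ => 2),
      IsConfHom k F ∧ ∀ i, F (UEnv.gen k _ _ i) = UEnv.gen k _ _ (some i) := by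
  obtain ⟨ρ, ρg, ρd, ρn⟩ := UEnv.exists_map (KM.genFamily (0 : LinearMap.BilinForm k g) b)
    (fun _ _ => 2) (KM.surjective_eval 0 b)
  let J : Cur g →ₗ[k] KM (0 : LinearMap.BilinForm k g) :=
    (LinearMap.inl k (Cur g) k : Cur g →ₗ[k] Cur g × k)
  have hform : ∀ n, KM.form (0 : LinearMap.BilinForm k g) n = 0 := by
    intro n
    refine Cur.ext_mk fun i a j c => ?_
    rw [KM.form_mk]
    simp
  have hd : ∀ a, J (der k a) = der k (J a) := fun a => Prod.ext rfl rfl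
  have hn : ∀ n a c, J (nmul k n a c) = nmul k n (J a) (J c) := fun n a c =>
    Prod.ext rfl (LinearMap.congr_fun (LinearMap.congr_fun (hform n) a) c).symm
  obtain ⟨F, hF, -⟩ := UEnv.existsUnique_lift (k := k)
    (UEnv.isAssoc (KM.genFamily (0 : LinearMap.BilinForm k g) b) fun _ _ => 2)
    (fun i : ι => (Cur.mk 0 (b i) : Cur g)) (fun _ _ => 2) (ρ ∘ₗ J)
    (fun a => by rw [LinearMap.comp_apply, hd, ρd]; rfl)
    (fun n a c => by rw [LinearMap.comp_apply, hn, ρn]; rfl)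
    (fun i j n h => by
      change nmul k n (ρ (KM.genFamily 0 b (some i))) (ρ (KM.genFamily 0 b (some j))) = 0
      rw [ρg, ρg, UEnv.gen_local _ _ _ _ n h])
  exact ⟨F, hF.1, fun i => (hF.2 i).trans (ρg (some i))⟩

end LieEnvelopes

/-! ### The isomorphisms for the associated graded algebras -/

section Main

variable {k g ι : Type*} [Field k] [CharZero k] [LieRing g] [LieAlgebra k g]

/-- The associated graded algebra of the envelope of a current conformal algebra. -/
theorem exists_confEquiv_gr_cur (b : Module.Basis ι k g) :
    ∃ φ : ConfEquiv k
        (Gr k (UEnv.gen k (fun i : ι => (Cur.mk 0 (b i) : Cur g)) (fun _ _ => 2)))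
        (ComConf k (fun _ _ : ι => 2)),
      ∀ i, φ.toLinearEquiv (Gr.gen k _ i) = ComConf.gen k _ i := by
  classical
  -- The isomorphism does not depend on an order; an arbitrary one is chosen so that basic monomials
  -- make sense.
  let _ : LinearOrder ι := linearOrderOfSTO WellOrderingRel
  set x := UEnv.gen k (fun i : ι => (Cur.mk 0 (b i) : Cur g)) (fun _ _ => 2) with hx
  obtain ⟨F, hF, hFg⟩ := Gr.exists_comHom (x := x) (UEnv.isAssoc _ _)
    (fun i j n hn => UEnv.gen_local _ _ i j n hn)
    (UEnv.comm_gen_mem _ _ (Cur.surjective_eval b) (Cur.nmul_mem_span b)) (id : ι → ι)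
  obtain ⟨J, hJ, hJg⟩ := exists_curHom b
  obtain ⟨σ, hσ, hσ1, hσ2⟩ := exists_symbolFamily (k := k) (b := b) (B := 0) (fun _ _ => rfl)
    (fun _ _ _ => rfl)
  -- J preserves monomials and their degrees, so the functionals for K(g) with the zero form pull
  -- back to the envelope of Cur g.
  have hJm : ∀ t, J (monVal k x t) = monVal k (fun i => UEnv.gen k _ _ (some i)) t := fun t =>
    (map_monVal hJ x t).trans (by simp only [hx, hJg])
  have hli := Gr.linearIndependent_basicMon (x := x) (id : ι → ι) (fun N => σ N ∘ₗ J)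
    (fun N t ht => by
      rw [LinearMap.comp_apply, hJm, ← monVal_map]
      exact hσ N _ (by rwa [deg_map]))
    (fun w s z => (congrArg (σ _) (hJm _)).trans (hσ1 w s z))
    (fun w y z => (congrArg (σ _) (hJm _)).trans (hσ2 w y z))
  obtain ⟨φ, hφ⟩ := exists_confEquiv hF
    ⟨injective_of_linearIndependent_comp ComConf.span_basicMonomial (by
      simp only [← monVal_basicMon, map_monVal hF, hFg]
      exact hli),
    surjective_of_generators hF Gr.span_monVal_gen fun i => ⟨_, hFg i⟩⟩
  exact ⟨φ, fun i => by rw [← hφ (ComConf.gen k _ i), hFg]; rfl⟩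

variable {B : LinearMap.BilinForm k g}

/-- Independence is stated for the images under F so that it serves twice: it gives injectivity of
F, and also independence in ComConf itself. -/
theorem exists_comHom_gr_KM [LinearOrder ι] (b : Module.Basis ι k g) (hB : ∀ x y, B x y = B y x)
    (hB' : ∀ x y z, B ⁅x, y⁆ z = B x ⁅y, z⁆) :
    ∃ F : ComConf k (fun _ _ : ι => 2) →ₗ[k]
        Gr k (UEnv.gen k (KM.genFamily B b) (fun _ _ => 2)),
      IsConfHom k F ∧ (∀ i, F (ComConf.gen k _ i) = Gr.gen k _ (some i)) ∧
      LinearIndependent k fun p => F (basicMonomial k _ p) := by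
  obtain ⟨F, hF, hFg⟩ := Gr.exists_comHom (x := UEnv.gen k (KM.genFamily B b) (fun _ _ => 2))
    (UEnv.isAssoc _ _) (fun i j n hn => UEnv.gen_local _ _ i j n hn)
    (UEnv.comm_gen_mem _ _ (KM.surjective_eval B b) (KM.nmul_mem_span B b)) (some : ι → Option ι)
  obtain ⟨σ, hσ, hσ1, hσ2⟩ := exists_symbolFamily (b := b) hB hB'
  refine ⟨F, hF, hFg, ?_⟩
  simp only [← monVal_basicMon, map_monVal hF, hFg]
  exact Gr.linearIndependent_basicMon some σ hσ hσ1 hσ2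

/-- An associated graded algebra that is generated by a copy of a free commutative conformal
algebra and a central element is their direct sum. -/
theorem exists_confEquiv_prod {V : Type*} [AddCommGroup V] [Module k V] [ConformalAlgebra k V]
    [LinearOrder ι] {x : Option ι → V} {F : ComConf k (fun _ _ : ι => 2) →ₗ[k] Gr k x}
    (hF : IsConfHom k F) (hFg : ∀ i, F (ComConf.gen k _ i) = Gr.gen k x (some i))
    (hinj : Function.Injective F) (hd : der k (x none) = 0) {τ : V →ₗ[k] k} (τe : τ (x none) = 1)
    (τd : ∀ s z, τ (monVal k (fun i => x (some i)) (Mon.d^[s] (.of z))) = 0) :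
    ∃ φ : ConfEquiv k (Gr k x) (ComConf k (fun _ _ : ι => 2) × TorsionLine k),
      (∀ i, φ.toLinearEquiv (Gr.gen k x (some i)) = (ComConf.gen k _ i, 0)) ∧
      φ.toLinearEquiv (Gr.gen k x none) = (0, TorsionLine.e k) := by
  have he : der k (Gr.gen k x none) = 0 := by
    rw [Gr.gen, Gr.der_cls]
    refine Gr.cls_eq_zero ?_
    dsimp only
    rw [hd]
    exact Submodule.zero_mem _
  let E : TorsionLine k →ₗ[k] Gr k x :=
    (LinearMap.toSpanSingleton k (Gr k x) (Gr.gen k x none) : k →ₗ[k] Gr k x)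
  have hE : ∀ s, ∃ c : k, E s = c • Gr.gen k x none ∧ (c = 0 → s = 0) :=
    fun s => ⟨s, rfl, fun h => h⟩
  let G : ComConf k (fun _ _ : ι => 2) × TorsionLine k →ₗ[k] Gr k x := F.coprod E
  have hG : ∀ a s, G (a, s) = F a + E s := fun a s => rfl
  have hGhom : IsConfHom k G := by
    constructor
    · rintro ⟨a, s⟩
      change F (der k a) + E 0 = _
      obtain ⟨c, hc, -⟩ := hE s
      rw [hG, map_add, map_zero, hF.map_der, hc, map_smul, he, smul_zero]
    · rintro n ⟨a, s⟩ ⟨a', s'⟩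
      change F (nmul k n a a') + E 0 = _
      obtain ⟨c, hc, -⟩ := hE s
      obtain ⟨c', hc', -⟩ := hE s'
      rw [hG, hG, map_zero, hF.map_nmul, hc, hc']
      simp only [map_add, map_smul, LinearMap.add_apply, LinearMap.smul_apply,
        nmul_eq_zero_of_der_right he, nmul_eq_zero_of_der_left he, smul_zero, add_zero]
  -- Θ is τ in degree 1 and zero in all other degrees. It is well defined because every monomial has
  -- at least one letter, so F_0 = 0.
  obtain ⟨Θ, hΘ⟩ := Gr.exists_functional (x := x) (fun N => if N = 1 then τ else 0) (by
    intro N t ht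
    rw [if_neg]
    · rfl
    · have := deg_pos t
      omega)
  -- The basic monomials of degree 1 are the ∂^s z, which τ kills; all others have larger degree. So
  -- Θ separates the class of e from the image of ComConf.
  have hΘF : Θ ∘ₗ F = 0 := by
    refine LinearMap.ext_on_range ComConf.span_basicMonomial fun p => ?_
    rw [LinearMap.comp_apply, ← monVal_basicMon, map_monVal hF]
    simp only [hFg]
    rw [Gr.monVal_gen_map some, hΘ, LinearMap.zero_apply]
    rcases p with ⟨⟨w, s, z⟩, hw⟩ | ⟨⟨w, y, z⟩, hw⟩
    · change (if Mon.deg (wordMon w _) = 1 then τ else 0) (monVal k _ (wordMon w _)) = 0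
      rw [deg_wordMon, deg_iterate_d]
      rcases w with _ | ⟨u, w⟩
      · exact τd s z
      · rw [if_neg]
        · rfl
        · simp [Mon.deg]
    · change (if Mon.deg (wordMon w _) = 1 then τ else 0) (monVal k _ (wordMon w _)) = 0
      rw [deg_wordMon, if_neg]
      · rfl
      · simp only [Mon.deg]
        omega
  have hΘe : Θ (Gr.gen k x none) = 1 := by
    rw [Gr.gen, hΘ, if_pos rfl]
    exact τe
  have hGinj : Function.Injective G := by
    rw [injective_iff_map_eq_zero]
    rintro ⟨a, s⟩ h
    rw [hG] at h
    have hs : s = 0 := by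
      have h1 := congrArg Θ h
      obtain ⟨c, hc, hc0⟩ := hE s
      rw [map_add, map_zero, hc, map_smul, hΘe, ← LinearMap.comp_apply, hΘF,
        LinearMap.zero_apply, zero_add, smul_eq_mul, mul_one] at h1
      exact hc0 h1
    rw [hs, map_zero, add_zero] at h
    rw [hs, hinj (h.trans (map_zero F).symm)]
    rfl
  have hGe : G (0, TorsionLine.e k) = Gr.gen k x none := by
    rw [hG, map_zero, zero_add]
    exact one_smul k _
  have hGg : ∀ i, G (ComConf.gen k _ i, 0) = Gr.gen k x (some i) := fun i => by
    rw [hG, map_zero, add_zero, hFg]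
  obtain ⟨φ, hφ⟩ := exists_confEquiv hGhom ⟨hGinj,
    surjective_of_generators hGhom Gr.span_monVal_gen fun i => match i with
      | some i => ⟨_, hGg i⟩
      | none => ⟨_, hGe⟩⟩
  exact ⟨φ, fun i => by rw [← hφ (ComConf.gen k _ i, 0), hGg], by
    rw [← hφ (0, TorsionLine.e k), hGe]⟩

/-- The associated graded algebra of the envelope of a Kac–Moody conformal algebra. -/
theorem exists_confEquiv_gr_KM (b : Module.Basis ι k g) (hB : ∀ x y, B x y = B y x)
    (hB' : ∀ x y z, B ⁅x, y⁆ z = B x ⁅y, z⁆) :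
    ∃ φ : ConfEquiv k (Gr k (UEnv.gen k (KM.genFamily B b) (fun _ _ => 2)))
        (ComConf k (fun _ _ : ι => 2) × TorsionLine k),
      (∀ i, φ.toLinearEquiv (Gr.gen k _ (some i)) = (ComConf.gen k _ i, 0)) ∧
      φ.toLinearEquiv (Gr.gen k _ none) = (0, TorsionLine.e k) := by
  classical
  let _ : LinearOrder ι := linearOrderOfSTO WellOrderingRel
  obtain ⟨F, hF, hFg, hli⟩ := exists_comHom_gr_KM b hB hB'
  obtain ⟨τ, τe, τd⟩ := exists_centralFunctional (b := b) hB hB'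
  exact exists_confEquiv_prod hF hFg
    (injective_of_linearIndependent_comp ComConf.span_basicMonomial hli)
    (KM.der_gen_none B b _) τe τd

end Main

/-! ### Independence in ComConf for an arbitrary ordered set, from abelian Lie algebras -/

/-- A vector space with the zero bracket. -/
def AbelianLie (V : Type*) : Type _ := V

namespace AbelianLie

variable {k V : Type*} [Field k] [AddCommGroup V] [Module k V]

instance : AddCommGroup (AbelianLie V) := inferInstanceAs (AddCommGroup V)

instance : Module k (AbelianLie V) := inferInstanceAs (Module k V)

instance : LieRing (AbelianLie V) where
  bracket _ _ := 0
  add_lie _ _ _ := (add_zero _).symm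
  lie_add _ _ _ := (add_zero _).symm
  lie_self _ := rfl
  leibniz_lie _ _ _ := (add_zero _).symm

instance : LieAlgebra k (AbelianLie V) where
  lie_smul _ _ _ := (smul_zero _).symm

end AbelianLie

/-- The abelian Lie algebra with basis Y and zero form supplies a homomorphism out of ComConf under
which the basic monomials have independent images. -/
theorem linearIndependent_basicMonomial {k Y : Type*} [Field k] [CharZero k] [LinearOrder Y] :
    LinearIndependent k (basicMonomial k (fun _ _ : Y => 2)) := by
  let b : Module.Basis Y k (AbelianLie (Y →₀ k)) :=
    (Finsupp.basisSingleOne : Module.Basis Y k (Y →₀ k))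
  obtain ⟨F, -, -, h⟩ := exists_comHom_gr_KM (B := 0) b (fun _ _ => rfl) (fun _ _ _ => rfl)
  exact LinearIndependent.of_comp F h

end ConformalAlg

theorem mainTheorem5 (k : Type*) [Field k] [CharZero k] :
    (∀ (Y : Type*) [LinearOrder Y],
      LinearIndependent k (ConformalAlg.basicMonomial k (fun _ _ : Y => 2)) ∧
      Submodule.span k (Set.range (ConformalAlg.basicMonomial k (fun _ _ : Y => 2))) = ⊤) ∧
    (∀ (g : Type*) [LieRing g] [LieAlgebra k g] (ι : Type*) (b : Module.Basis ι k g)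
        (B : LinearMap.BilinForm k g),
      (∀ x y, B x y = B y x) → (∀ x y z, B ⁅x, y⁆ z = B x ⁅y, z⁆) →
      ∃ φ : ConformalAlg.ConfEquiv k
          (ConformalAlg.Gr k
            (ConformalAlg.UEnv.gen k (ConformalAlg.KM.genFamily B b) (fun _ _ => 2)))
          (ConformalAlg.ComConf k (fun _ _ : ι => 2) × ConformalAlg.TorsionLine k),
        (∀ i, φ.toLinearEquiv (ConformalAlg.Gr.gen k _ (some i)) =
          (ConformalAlg.ComConf.gen k _ i, 0)) ∧
        φ.toLinearEquiv (ConformalAlg.Gr.gen k _ none) = (0, ConformalAlg.TorsionLine.e k)) ∧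
    (∀ (g : Type*) [LieRing g] [LieAlgebra k g] (ι : Type*) (b : Module.Basis ι k g),
      ∃ φ : ConformalAlg.ConfEquiv k
          (ConformalAlg.Gr k
            (ConformalAlg.UEnv.gen k (fun i : ι => ConformalAlg.Cur.mk 0 (b i)) (fun _ _ => 2)))
          (ConformalAlg.ComConf k (fun _ _ : ι => 2)),
        ∀ i, φ.toLinearEquiv (ConformalAlg.Gr.gen k _ i) = ConformalAlg.ComConf.gen k _ i) :=
  ⟨fun _ _ => ⟨ConformalAlg.linearIndependent_basicMonomial,
      ConformalAlg.ComConf.span_basicMonomial⟩,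
    fun _ _ _ _ b _ hB hB' => ConformalAlg.exists_confEquiv_gr_KM b hB hB',
    fun _ _ _ _ b => ConformalAlg.exists_confEquiv_gr_cur b⟩
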